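/- Let $H=(H,\Delta,\varepsilon,\Phi,S,\alpha,\beta)$ be a quasi-Hopf algebra over a field $k$ (in Drinfeld's sense: $(\mathrm{id}\otimes\Delta)\Delta(h)=\Phi\,(\Delta\otimes\mathrm{id})\Delta(h)\,\Phi^{-1}$, with the antipode $S$ a bijective anti-automorphism of the algebra $H$), and write $\Phi=X^1\otimes X^2\otimes X^3=Y^1\otimes Y^2\otimes Y^3$, $\Phi^{-1}=x^1\otimes x^2\otimes x^3$, $\Delta(h)=h_1\otimes h_2$ (summation understood). Let ${}_H\mathcal M$ be the monoidal category of left $H$-modules, with $h\cdot(u\otimes v)=h_1\cdot u\otimes h_2\cdot v$ and associativity constraint $(u\otimes v)\otimes w\mapsto X^1\cdot u\otimes(X^2\cdot v\otimes X^3\cdot w)$; an algebra in ${}_H\mathcal M$ is called a left $H$-module algebra. Let ${}_H^H\mathcal{YD}$ be the (pre)braided monoidal category of left Yetter–Drinfeld modules over $H$: left $H$-modules $M$ with a linear map $M\to H\otimes M$, $m\mapsto m_{(-1)}\otimes m_{(0)}$, such that for all $m\in M$, $h\in H$ $$X^1m_{(-1)}\otimes (X^2\cdot m_{(0)})_{(-1)}X^3\otimes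 (X^2\cdot m_{(0)})_{(0)}=X^1\big((Y^1\cdot m)_{(-1)}\big)_1Y^2\otimes X^2\big((Y^1\cdot m)_{(-1)}\big)_2Y^3\otimes X^3\cdot (Y^1\cdot m)_{(0)},$$ $$\varepsilon(m_{(-1)})m_{(0)}=m,\qquad h_1m_{(-1)}\otimes h_2\cdot m_{(0)}=(h_1\cdot m)_{(-1)}h_2\otimes(h_1\cdot m)_{(0)}.$$ Its associativity constraint is that of ${}_H\mathcal M$, its braiding is $m\otimes n\mapsto m_{(-1)}\cdot n\otimes m_{(0)}$, and $M\otimes N$ carries the coaction $$m\otimes n\mapsto X^1(x^1Y^1\cdot m)_{(-1)}x^2(Y^2\cdot n)_{(-1)}Y^3\otimes\big(X^2\cdot(x^1Y^1\cdot m)_{(0)}\otimes X^3x^3\cdot(Y^2\cdot n)_{(0)}\big).$$ For a left $H$-module algebra $C$ and an algebra $A$ in ${}_H^H\mathcal{YD}$, let $C\diamond A$ be the twisted tensor product of $C$ and $A$ in ${}_H\mathcal M$ with respect to the map $R:A\otimes C\to C\otimes A$, $R(a\otimes c)=a_{(-1)}\cdot c\otimes a_{(0)}$. That is, it is the $H$-module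 $C\otimes A$ with unit $1_C\otimes 1_A$ and multiplication $$(\mu_C\otimes\mu_A)\circ a^{-1}_{C,C,A\otimes A}\circ(\mathrm{id}_C\otimes a_{C,A,A})\circ(\mathrm{id}_C\otimes R\otimes\mathrm{id}_A)\circ(\mathrm{id}_C\otimes a^{-1}_{A,C,A})\circ a_{C,A,C\otimes A},$$ where $a$ is the associativity constraint of ${}_H\mathcal M$. If $C$ is also an algebra in ${}_H^H\mathcal{YD}$, the same multiplication and unit, together with the coaction of the tensor product, give the braided tensor product $C\,\underline{\otimes}\,A$ in ${}_H^H\mathcal{YD}$. Let $H_0$ be the vector space $H$ with unit $\beta$, action $h\triangleright h'=h_1h'S(h_2)$, multiplication $h*h'=X^1hS(x^1X^2)\alpha x^2X^3_1h'S(x^3X^3_2)$ and coaction $$h\mapsto X^1Y^1_1h_1g^1S(q^2Y^2_2)Y^3\otimes X^2Y^1_2h_2g^2S(X^3q^1Y^2_1).$$ Here $q^1\otimes q^2=X^1\otimes S^{-1}(\alpha X^3)X^2$ and $g^1\otimes g^2=\Delta(S(x^1)\alpha x^2)\,\delta\,(S\otimes S)(\Delta^{cop}(x^3))$, where $\delta=B^1\beta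 S(B^4)\otimes B^2\beta S(B^3)$ and $B^1\otimes B^2\otimes B^3\otimes B^4=(\Delta\otimes\mathrm{id}\otimes\mathrm{id})(\Phi)(\Phi^{-1}\otimes1)$. **Proposition.** Let $A$ be an algebra in ${}_H^H\mathcal{YD}$ and $C$ a left $H$-module algebra. Then $H_0$ and $A\,\underline{\otimes}\,H_0$ are algebras in ${}_H^H\mathcal{YD}$; $C\diamond A$, $(C\diamond A)\diamond H_0$ and $C\diamond(A\,\underline{\otimes}\,H_0)$ are left $H$-module algebras; and the linear map determined by $$(C\diamond A)\diamond H_0\to C\diamond(A\,\underline{\otimes}\,H_0),\qquad (c\otimes a)\otimes h\mapsto X^1\cdot c\otimes(X^2\cdot a\otimes X^3\triangleright h),$$ is an isomorphism of algebras in ${}_H\mathcal M$ (bijective, $H$-linear, multiplicative and unital). -/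

import Mathlib

open scoped TensorProduct

noncomputable section

/-- A quasi-bialgebra `(H, Δ, ε, Φ)` over a field `k`. Triple tensor powers are bracketed to the
right. -/
class QuasiBialgebra (k H : Type*) [Field k] [Ring H] [Algebra k H] where
  /-- the comultiplication `Δ` -/
  comul : H →ₐ[k] H ⊗[k] H
  /-- the counit `ε` -/
  counit : H →ₐ[k] k
  /-- the (invertible) reassociator `Φ` -/
  Phi : (H ⊗[k] (H ⊗[k] H))ˣ
  /-- `(id ⊗ Δ)(Δ(h)) = Φ (Δ ⊗ id)(Δ(h)) Φ⁻¹` -/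
  coassoc : ∀ h : H,
    Algebra.TensorProduct.map (AlgHom.id k H) comul (comul h) =
      (Phi : H ⊗[k] (H ⊗[k] H)) *
        Algebra.TensorProduct.assoc k k k H H H
          (Algebra.TensorProduct.map comul (AlgHom.id k H) (comul h)) *
        ((Phi⁻¹ : (H ⊗[k] (H ⊗[k] H))ˣ) : H ⊗[k] (H ⊗[k] H))
  /-- `(id ⊗ ε)(Δ(h)) = h ⊗ 1` -/
  counit_right : ∀ h : H,
    Algebra.TensorProduct.map (AlgHom.id k H) counit (comul h) = h ⊗ₜ[k] (1 : k)
  /-- `(ε ⊗ id)(Δ(h)) = 1 ⊗ h` -/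
  counit_left : ∀ h : H,
    Algebra.TensorProduct.map counit (AlgHom.id k H) (comul h) = (1 : k) ⊗ₜ[k] h
  /-- `(1 ⊗ Φ) (id ⊗ Δ ⊗ id)(Φ) (Φ ⊗ 1) = (id ⊗ id ⊗ Δ)(Φ) (Δ ⊗ id ⊗ id)(Φ)` -/
  pentagon :
    ((1 : H) ⊗ₜ[k] (Phi : H ⊗[k] (H ⊗[k] H))) *
        Algebra.TensorProduct.map (AlgHom.id k H)
          ((Algebra.TensorProduct.assoc k k k H H H).toAlgHom.comp
            (Algebra.TensorProduct.map comul (AlgHom.id k H))) (Phi : H ⊗[k] (H ⊗[k] H)) *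
        Algebra.TensorProduct.map (AlgHom.id k H)
          (Algebra.TensorProduct.map (AlgHom.id k H)
            (Algebra.TensorProduct.includeLeft : H →ₐ[k] H ⊗[k] H))
          (Phi : H ⊗[k] (H ⊗[k] H)) =
      Algebra.TensorProduct.map (AlgHom.id k H) (Algebra.TensorProduct.map (AlgHom.id k H) comul)
          (Phi : H ⊗[k] (H ⊗[k] H)) *
        Algebra.TensorProduct.assoc k k k H H (H ⊗[k] H)
          (Algebra.TensorProduct.map comul (AlgHom.id k (H ⊗[k] H))
            (Phi : H ⊗[k] (H ⊗[k] H)))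
  /-- `(ε ⊗ id ⊗ id)(Φ) = 1` -/
  counit_Phi_left :
    Algebra.TensorProduct.map counit (AlgHom.id k (H ⊗[k] H)) (Phi : H ⊗[k] (H ⊗[k] H)) = 1
  /-- `(id ⊗ ε ⊗ id)(Φ) = 1` -/
  counit_Phi_mid :
    Algebra.TensorProduct.map (AlgHom.id k H) (Algebra.TensorProduct.map counit (AlgHom.id k H))
      (Phi : H ⊗[k] (H ⊗[k] H)) = 1
  /-- `(id ⊗ id ⊗ ε)(Φ) = 1` -/
  counit_Phi_right :
    Algebra.TensorProduct.map (AlgHom.id k H) (Algebra.TensorProduct.map (AlgHom.id k H) counit)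
      (Phi : H ⊗[k] (H ⊗[k] H)) = 1

/-- A quasi-Hopf algebra: a quasi-bialgebra with a (bijective) algebra anti-automorphism `S` and
elements `α`, `β`. -/
class QuasiHopfAlgebra (k H : Type*) [Field k] [Ring H] [Algebra k H]
    extends QuasiBialgebra k H where
  /-- the antipode `S` -/
  S : H ≃ₗ[k] H
  S_mul : ∀ a b : H, S (a * b) = S b * S a
  alpha : H
  beta : H
  /-- `S(h₁) α h₂ = ε(h) α` -/
  S_alpha : ∀ h : H,
    LinearMap.mul' k H
      (TensorProduct.map (LinearMap.mulRight k alpha ∘ₗ S.toLinearMap) LinearMap.id (comul h)) =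
      counit h • alpha
  /-- `h₁ β S(h₂) = ε(h) β` -/
  beta_S : ∀ h : H,
    LinearMap.mul' k H
      (TensorProduct.map (LinearMap.mulRight k beta) S.toLinearMap (comul h)) =
      counit h • beta
  /-- `X¹ β S(X²) α X³ = 1`, where `Φ = X¹ ⊗ X² ⊗ X³` -/
  Phi_beta_alpha :
    LinearMap.mul' k H
      (TensorProduct.map (LinearMap.mulRight k beta)
        (LinearMap.mul' k H ∘ₗ
          TensorProduct.map (LinearMap.mulRight k alpha ∘ₗ S.toLinearMap) LinearMap.id)
        (Phi : H ⊗[k] (H ⊗[k] H))) = 1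
  /-- `S(x¹) α x² β S(x³) = 1`, where `Φ⁻¹ = x¹ ⊗ x² ⊗ x³` -/
  Phi_inv_alpha_beta :
    LinearMap.mul' k H
      (TensorProduct.map (LinearMap.mulRight k alpha ∘ₗ S.toLinearMap)
        (LinearMap.mul' k H ∘ₗ
          TensorProduct.map (LinearMap.mulRight k beta) S.toLinearMap)
        ((Phi⁻¹ : (H ⊗[k] (H ⊗[k] H))ˣ) : H ⊗[k] (H ⊗[k] H))) = 1

namespace QuasiHopf

/-! ### Auxiliary linear algebra -/

section Aux

variable {k : Type*} [Field k]

/-- The action of `B ⊗ B'` on `M ⊗ N` for a `B`-module `M` and a `B'`-module `N`: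
`(b ⊗ b') · (m ⊗ n) = b·m ⊗ b'·n`. -/
def tensorAct {B B' M N : Type*} [Ring B] [Algebra k B] [Ring B'] [Algebra k B']
    [AddCommGroup M] [Module k M] [AddCommGroup N] [Module k N]
    (ρ : B →ₐ[k] Module.End k M) (σ : B' →ₐ[k] Module.End k N) :
    B ⊗[k] B' →ₐ[k] Module.End k (M ⊗[k] N) :=
  (Module.endTensorEndAlgHom (R := k) (S := k) (A := k) (M := M) (N := N)).comp
    (Algebra.TensorProduct.map ρ σ)

/-- `u ⊗ v ↦ Q v ∘ T ∘ P u`. -/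
def sandwich {U V M N N' L : Type*} [AddCommGroup U] [Module k U] [AddCommGroup V] [Module k V]
    [AddCommGroup M] [Module k M] [AddCommGroup N] [Module k N] [AddCommGroup N'] [Module k N']
    [AddCommGroup L] [Module k L]
    (P : U →ₗ[k] M →ₗ[k] N) (T : N →ₗ[k] N') (Q : V →ₗ[k] N' →ₗ[k] L) :
    U ⊗[k] V →ₗ[k] M →ₗ[k] L :=
  TensorProduct.lift
    (LinearMap.mk₂ k (fun u v => Q v ∘ₗ T ∘ₗ P u)
      (fun _ _ _ => by ext; simp) (fun _ _ _ => by ext; simp)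
      (fun _ _ _ => by ext; simp) (fun _ _ _ => by ext; simp))

/-- Right multiplication on the first factor of `B ⊗ M`: `b ↦ (x ⊗ m ↦ x b ⊗ m)`. -/
def rmulFst (B M : Type*) [Ring B] [Algebra k B] [AddCommGroup M] [Module k M] :
    B →ₗ[k] B ⊗[k] M →ₗ[k] B ⊗[k] M :=
  LinearMap.rTensorHom M ∘ₗ (LinearMap.mul k B).flip

/-- Two-sided multiplication: `u ⊗ v ↦ (x ↦ u x v)`. -/
def twoSided (B : Type*) [Ring B] [Algebra k B] : B ⊗[k] B →ₗ[k] B →ₗ[k] B :=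
  sandwich (LinearMap.mul k B) LinearMap.id (LinearMap.mul k B).flip

end Aux

variable {k H : Type*} [Field k] [Ring H] [Algebra k H]

/-! ### The monoidal category of left `H`-modules

A left `H`-module is a `k`-space `M` with an algebra map `H →ₐ[k] Module.End k M`. -/

section Modules

variable (k H) in
/-- The reassociator `Φ`. -/
def reassoc [QuasiBialgebra k H] : H ⊗[k] (H ⊗[k] H) :=
  ((QuasiBialgebra.Phi : (H ⊗[k] (H ⊗[k] H))ˣ) : H ⊗[k] (H ⊗[k] H))

variable (k H) in
/-- The inverse reassociator `Φ⁻¹`. -/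
def reassocInv [QuasiBialgebra k H] : H ⊗[k] (H ⊗[k] H) :=
  ((QuasiBialgebra.Phi⁻¹ : (H ⊗[k] (H ⊗[k] H))ˣ) : H ⊗[k] (H ⊗[k] H))

variable (k H) in
/-- `Φ` as an element of `(H ⊗ H) ⊗ H`. -/
def reassocL [QuasiBialgebra k H] : (H ⊗[k] H) ⊗[k] H :=
  (Algebra.TensorProduct.assoc k k k H H H).symm (reassoc k H)

variable (k H) in
/-- `Φ⁻¹` as an element of `(H ⊗ H) ⊗ H`. -/
def reassocInvL [QuasiBialgebra k H] : (H ⊗[k] H) ⊗[k] H :=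
  (Algebra.TensorProduct.assoc k k k H H H).symm (reassocInv k H)

variable [QuasiBialgebra k H]
variable {U V W : Type*} [AddCommGroup U] [Module k U] [AddCommGroup V] [Module k V]
  [AddCommGroup W] [Module k W]

/-- The diagonal action `h · (u ⊗ v) = h₁·u ⊗ h₂·v`. -/
def diagAct (ρ : H →ₐ[k] Module.End k U) (σ : H →ₐ[k] Module.End k V) :
    H →ₐ[k] Module.End k (U ⊗[k] V) :=
  (tensorAct ρ σ).comp QuasiBialgebra.comul

/-- The associativity constraint `a_{U,V,W} : (U ⊗ V) ⊗ W → U ⊗ (V ⊗ W)`,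
`(u ⊗ v) ⊗ w ↦ X¹·u ⊗ (X²·v ⊗ X³·w)`. -/
def assocConstraint (ρ : H →ₐ[k] Module.End k U) (σ : H →ₐ[k] Module.End k V)
    (τ : H →ₐ[k] Module.End k W) : (U ⊗[k] V) ⊗[k] W →ₗ[k] U ⊗[k] (V ⊗[k] W) :=
  tensorAct ρ (tensorAct σ τ) (reassoc k H) ∘ₗ (TensorProduct.assoc k U V W).toLinearMap

/-- The inverse constraint `a_{U,V,W}⁻¹ : u ⊗ (v ⊗ w) ↦ (x¹·u ⊗ x²·v) ⊗ x³·w`. -/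
def assocConstraintInv (ρ : H →ₐ[k] Module.End k U) (σ : H →ₐ[k] Module.End k V)
    (τ : H →ₐ[k] Module.End k W) : U ⊗[k] (V ⊗[k] W) →ₗ[k] (U ⊗[k] V) ⊗[k] W :=
  (TensorProduct.assoc k U V W).symm.toLinearMap ∘ₗ
    tensorAct ρ (tensorAct σ τ) (reassocInv k H)

end Modules

/-! ### Algebras in the category of left `H`-modules and in the Yetter–Drinfeld category -/

/-- A left `H`-module structure on the `k`-space `M` with a multiplication and a distinguished
element. The laws of an algebra in `_H M` are the predicate `IsModuleAlgebra`. -/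
structure ModAlgData (k H M : Type*) [Field k] [Ring H] [Algebra k H]
    [AddCommGroup M] [Module k M] where
  act : H →ₐ[k] Module.End k M
  mul : M ⊗[k] M →ₗ[k] M
  one : M

/-- The same together with a linear map `M → H ⊗ M`. The laws of an algebra in the
Yetter–Drinfeld category are the predicate `IsYetterDrinfeldAlgebra`. -/
structure YDAlgData (k H M : Type*) [Field k] [Ring H] [Algebra k H]
    [AddCommGroup M] [Module k M] extends ModAlgData k H M where
  coact : M →ₗ[k] H ⊗[k] M

section Laws

variable [QuasiBialgebra k H]
variable {M N : Type*} [AddCommGroup M] [Module k M] [AddCommGroup N] [Module k N]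

/-- `A` is a left `H`-module algebra, i.e. an algebra in `_H M`. -/
structure IsModuleAlgebra (A : ModAlgData k H M) : Prop where
  /-- `(a a') a'' = (X¹·a)[(X²·a')(X³·a'')]` -/
  assoc : ∀ a b c : M,
    A.mul (A.mul (a ⊗ₜ[k] b) ⊗ₜ[k] c) =
      A.mul (LinearMap.lTensor M A.mul
        (assocConstraint A.act A.act A.act ((a ⊗ₜ[k] b) ⊗ₜ[k] c)))
  one_mul : ∀ a : M, A.mul (A.one ⊗ₜ[k] a) = a
  mul_one : ∀ a : M, A.mul (a ⊗ₜ[k] A.one) = a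
  /-- `h·(a a') = (h₁·a)(h₂·a')` -/
  act_mul : ∀ (h : H) (a b : M),
    A.act h (A.mul (a ⊗ₜ[k] b)) = A.mul (diagAct A.act A.act h (a ⊗ₜ[k] b))
  /-- `h·1 = ε(h) 1` -/
  act_one : ∀ h : H, A.act h A.one = (QuasiBialgebra.counit h : k) • A.one

/-- An isomorphism of algebras in `_H M`: bijective, linear, `H`-linear, multiplicative, unital. -/
structure IsModuleAlgebraIso (A : ModAlgData k H M) (B : ModAlgData k H N) (e : M ≃ₗ[k] N) :
    Prop where
  map_act : ∀ (h : H) (a : M), e (A.act h a) = B.act h (e a)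
  map_mul : ∀ a b : M, e (A.mul (a ⊗ₜ[k] b)) = B.mul (e a ⊗ₜ[k] e b)
  map_one : e A.one = B.one

/-- `act` and `coact` make `M` a left Yetter–Drinfeld module over `H`. -/
structure IsYetterDrinfeldModule (act : H →ₐ[k] Module.End k M) (coact : M →ₗ[k] H ⊗[k] M) :
    Prop where
  /-- `X¹ m₍₋₁₎ ⊗ (X²·m₍₀₎)₍₋₁₎ X³ ⊗ (X²·m₍₀₎)₍₀₎ =
  X¹ (Y¹·m)₍₋₁₎₁ Y² ⊗ X² (Y¹·m)₍₋₁₎₂ Y³ ⊗ X³·(Y¹·m)₍₀₎` -/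
  coassoc : ∀ m : M,
    sandwich (tensorAct (Algebra.lmul k H) act).toLinearMap (LinearMap.lTensor H coact)
        (LinearMap.lTensorHom H ∘ₗ rmulFst H M) (reassocL k H) (coact m) =
      tensorAct (Algebra.lmul k H) (tensorAct (Algebra.lmul k H) act) (reassoc k H)
        (TensorProduct.assoc k H H M
          (sandwich act.toLinearMap
            (LinearMap.rTensor M (QuasiBialgebra.comul (k := k) (H := H)).toLinearMap ∘ₗ coact)
            (rmulFst (H ⊗[k] H) M) (reassoc k H) m))
  /-- `ε(m₍₋₁₎) m₍₀₎ = m` -/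
  counit : ∀ m : M,
    TensorProduct.lid k M
      (LinearMap.rTensor M (QuasiBialgebra.counit (k := k) (H := H)).toLinearMap (coact m)) = m
  /-- `h₁ m₍₋₁₎ ⊗ h₂·m₍₀₎ = (h₁·m)₍₋₁₎ h₂ ⊗ (h₁·m)₍₀₎` -/
  compat : ∀ (h : H) (m : M),
    tensorAct (Algebra.lmul k H) act (QuasiBialgebra.comul h) (coact m) =
      sandwich act.toLinearMap coact (rmulFst H M) (QuasiBialgebra.comul h) m

/-- The coaction of the tensor product of two Yetter–Drinfeld modules:
`m ⊗ n ↦ X¹ (x¹Y¹·m)₍₋₁₎ x² (Y²·n)₍₋₁₎ Y³ ⊗ (X²·(x¹Y¹·m)₍₀₎ ⊗ X³x³·(Y²·n)₍₀₎)`. -/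
def tensorCoact (ρ : H →ₐ[k] Module.End k M) (lamM : M →ₗ[k] H ⊗[k] M)
    (σ : H →ₐ[k] Module.End k N) (lamN : N →ₗ[k] H ⊗[k] N) :
    M ⊗[k] N →ₗ[k] H ⊗[k] (M ⊗[k] N) :=
  tensorAct (Algebra.lmul k H) (tensorAct ρ σ) (reassoc k H) ∘ₗ
    LinearMap.rTensor (M ⊗[k] N) (LinearMap.mul' k H) ∘ₗ
    (TensorProduct.tensorTensorTensorComm k H M H N).toLinearMap ∘ₗ
    LinearMap.rTensor (H ⊗[k] N) lamM ∘ₗ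
    tensorAct ρ (tensorAct (Algebra.lmul k H) σ) (reassocInv k H) ∘ₗ
    sandwich (tensorAct ρ σ).toLinearMap (LinearMap.lTensor M lamN)
      (LinearMap.lTensorHom M ∘ₗ rmulFst H N) (reassocL k H)

/-- `A` is an algebra in the category of left Yetter–Drinfeld modules over `H`: a
Yetter–Drinfeld module and a left `H`-module algebra whose unit and multiplication intertwine the
coactions. -/
structure IsYetterDrinfeldAlgebra (A : YDAlgData k H M) : Prop where
  isYetterDrinfeldModule : IsYetterDrinfeldModule A.act A.coact
  isModuleAlgebra : IsModuleAlgebra A.toModAlgData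
  coact_one : A.coact A.one = (1 : H) ⊗ₜ[k] A.one
  coact_mul : ∀ a b : M,
    A.coact (A.mul (a ⊗ₜ[k] b)) =
      LinearMap.lTensor H A.mul (tensorCoact A.act A.coact A.act A.coact (a ⊗ₜ[k] b))

end Laws

/-! ### Twisted tensor products -/

section Twisted

variable [QuasiBialgebra k H]
variable {M N : Type*} [AddCommGroup M] [Module k M] [AddCommGroup N] [Module k N]

/-- The multiplication on `A ⊗ B` afforded by a map `R : B ⊗ A → A ⊗ B`, namely
`(μ_A ⊗ μ_B) ∘ a⁻¹_{A,A,B⊗B} ∘ (id ⊗ a_{A,B,B}) ∘ (id ⊗ R ⊗ id) ∘ (id ⊗ a⁻¹_{B,A,B}) ∘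
a_{A,B,A⊗B}`, with unit `1 ⊗ 1` and the diagonal `H`-action. -/
def twistedTensor (A : ModAlgData k H M) (B : ModAlgData k H N)
    (R : N ⊗[k] M →ₗ[k] M ⊗[k] N) : ModAlgData k H (M ⊗[k] N) where
  act := diagAct A.act B.act
  mul :=
    TensorProduct.map A.mul B.mul ∘ₗ
      assocConstraintInv A.act A.act (diagAct B.act B.act) ∘ₗ
      LinearMap.lTensor M (assocConstraint A.act B.act B.act) ∘ₗ
      LinearMap.lTensor M (LinearMap.rTensor N R) ∘ₗ
      LinearMap.lTensor M (assocConstraintInv B.act A.act B.act) ∘ₗ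
      assocConstraint A.act B.act (diagAct A.act B.act)
  one := A.one ⊗ₜ[k] B.one

/-- `R(a ⊗ c) = a₍₋₁₎·c ⊗ a₍₀₎`, for a coaction `lam` on `N` and an `H`-action `ρ` on `M`. -/
def coactTwist (ρ : H →ₐ[k] Module.End k M) (lam : N →ₗ[k] H ⊗[k] N) :
    N ⊗[k] M →ₗ[k] M ⊗[k] N :=
  LinearMap.rTensor N (TensorProduct.lift ρ.toLinearMap) ∘ₗ
    (TensorProduct.rightComm k H N M).toLinearMap ∘ₗ
    LinearMap.rTensor M lam

/-- `C ◇ A`: the twisted tensor product in `_H M` of a left `H`-module algebra `C` and an algebra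
`A` in the Yetter–Drinfeld category, with `R(a ⊗ c) = a₍₋₁₎·c ⊗ a₍₀₎`. -/
def diamond (C : ModAlgData k H M) (A : YDAlgData k H N) : ModAlgData k H (M ⊗[k] N) :=
  twistedTensor C A.toModAlgData (coactTwist C.act A.coact)

/-- The braided tensor product of two algebras in the Yetter–Drinfeld category: the twisted tensor
product by the braiding `b ⊗ a ↦ b₍₋₁₎·a ⊗ b₍₀₎`, with the tensor product coaction. -/
def braidedTensor (A : YDAlgData k H M) (B : YDAlgData k H N) : YDAlgData k H (M ⊗[k] N) where
  toModAlgData := twistedTensor A.toModAlgData B.toModAlgData (coactTwist A.act B.coact)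
  coact := tensorCoact A.act A.coact B.act B.coact

end Twisted

/-! ### The algebra `H₀` in the Yetter–Drinfeld category -/

section HZero

variable [QuasiHopfAlgebra k H]

open QuasiBialgebra QuasiHopfAlgebra

theorem S_one : (S (k := k) (1 : H)) = 1 := by
  have h := S_mul (k := k) (1 : H) ((S (k := k) (H := H)).symm 1)
  simpa using h.symm

variable (k H) in
/-- `a ⊗ b ↦ S(b) ⊗ S(a)`. -/
def flipSS : H ⊗[k] H →ₗ[k] H ⊗[k] H :=
  TensorProduct.map (S (k := k) (H := H)).toLinearMap (S (k := k) (H := H)).toLinearMap ∘ₗ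
    (TensorProduct.comm k H H).toLinearMap

variable (k H) in
/-- `S(x¹) α x² ⊗ x³`. -/
def sAlpha : H ⊗[k] H :=
  LinearMap.rTensor H
    (LinearMap.mul' k H ∘ₗ
      TensorProduct.map (LinearMap.mulRight k (alpha k : H) ∘ₗ (S (k := k) (H := H)).toLinearMap)
        LinearMap.id)
    (reassocInvL k H)

variable (k H) in
/-- `δ = B¹ β S(B⁴) ⊗ B² β S(B³)`, where
`B¹ ⊗ B² ⊗ B³ ⊗ B⁴ = (Δ ⊗ id ⊗ id)(Φ) (Φ⁻¹ ⊗ 1)`. -/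
def delta : H ⊗[k] H :=
  twoSided (H ⊗[k] H)
    (LinearMap.lTensor (H ⊗[k] H) (flipSS k H)
      (Algebra.TensorProduct.map comul (AlgHom.id k (H ⊗[k] H)) (reassoc k H) *
        (Algebra.TensorProduct.assoc k k k H H (H ⊗[k] H)).symm
          (Algebra.TensorProduct.map (AlgHom.id k H)
            (Algebra.TensorProduct.map (AlgHom.id k H)
              (Algebra.TensorProduct.includeLeft : H →ₐ[k] H ⊗[k] H))
            (reassocInv k H))))
    ((beta k : H) ⊗ₜ[k] (beta k : H))

variable (k H) in
/-- The inverse `f⁻¹ = g¹ ⊗ g²` of the Drinfeld twist of `H`: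
`f⁻¹ = Δ(S(x¹) α x²) δ (S ⊗ S)(Δᶜᵒᵖ(x³))`. -/
def drinfeldTwistInv : H ⊗[k] H :=
  twoSided (H ⊗[k] H)
    (TensorProduct.map (comul (k := k) (H := H)).toLinearMap
      (flipSS k H ∘ₗ (comul (k := k) (H := H)).toLinearMap) (sAlpha k H))
    (delta k H)

variable (k H) in
/-- `q_R = q¹ ⊗ q² = X¹ ⊗ S⁻¹(α X³) X²`. -/
def qR : H ⊗[k] H :=
  LinearMap.lTensor H
    (LinearMap.mul' k H ∘ₗ (TensorProduct.comm k H H).toLinearMap ∘ₗ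
      LinearMap.lTensor H
        ((S (k := k) (H := H)).symm.toLinearMap ∘ₗ LinearMap.mulLeft k (alpha k : H)))
    (reassoc k H)

variable (k H) in
/-- `u ⊗ w ↦ (h ↦ u h S(w))`. -/
def adS : H ⊗[k] H →ₐ[k] Module.End k H :=
  Algebra.TensorProduct.lift (Algebra.lmul k H)
    (AlgHom.ofLinearMap ((LinearMap.mul k H).flip ∘ₗ (S (k := k) (H := H)).toLinearMap)
      (by ext; simp [S_one]) (fun a b => by ext; simp [S_mul, mul_assoc]))
    (fun a b => by ext; simp [mul_assoc])

theorem adS_tmul (u w h : H) :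
    adS k H (u ⊗ₜ[k] w) h = u * h * S (k := k) w := by
  unfold adS
  erw [Algebra.TensorProduct.lift_tmul]
  simp [mul_assoc]

variable (k H) in
/-- The algebra `H₀` in the Yetter–Drinfeld category, on the space `H`: unit `β`, action
`h ▷ h' = h₁ h' S(h₂)`, multiplication `h * h' = X¹ h S(x¹X²) α x² X³₁ h' S(x³ X³₂)` and coaction
`h ↦ X¹ Y¹₁ h₁ g¹ S(q² Y²₂) Y³ ⊗ X² Y¹₂ h₂ g² S(X³ q¹ Y²₁)`. -/
def HZero : YDAlgData k H H where
  act := (adS k H).comp comul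
  mul :=
    LinearMap.mul' k H ∘ₗ
      tensorAct (adS k H) (adS k H)
        (LinearMap.lTensor (H ⊗[k] H)
          (LinearMap.mulLeft k (sAlpha k H) ∘ₗ (comul (k := k) (H := H)).toLinearMap)
          (reassocL k H))
  one := beta k
  coact :=
    twoSided (H ⊗[k] H)
        (LinearMap.lTensor (H ⊗[k] H)
          (Algebra.TensorProduct.includeRight.toLinearMap ∘ₗ (S (k := k) (H := H)).toLinearMap)
          (reassocL k H)) ∘ₗ
      twoSided (H ⊗[k] H)
        (TensorProduct.map (comul (k := k) (H := H)).toLinearMap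
          (LinearMap.mul' k (H ⊗[k] H) ∘ₗ
            TensorProduct.map
              (flipSS k H ∘ₗ LinearMap.mulLeft k (qR k H) ∘ₗ
                (comul (k := k) (H := H)).toLinearMap)
              (Algebra.TensorProduct.includeLeft : H →ₐ[k] H ⊗[k] H).toLinearMap)
          (reassoc k H)) ∘ₗ
      LinearMap.mulRight k (drinfeldTwistInv k H) ∘ₗ
      (comul (k := k) (H := H)).toLinearMap

end HZero

end QuasiHopf

end

set_option linter.unusedVariables false
set_option linter.unusedSectionVars false

noncomputable section

namespace QuasiHopf

/-! ### Morphisms of modules -/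

section TensorActLemmas

variable {k : Type*} [Field k]

section

variable {B B' M N : Type*} [Ring B] [Algebra k B] [Ring B'] [Algebra k B']
  [AddCommGroup M] [Module k M] [AddCommGroup N] [Module k N]

/-! A coaction on an `H`-module `M` amounts to a half-braiding `M ⊗ N → N ⊗ M`, `m ⊗ n ↦ m₍₋₁₎·n ⊗
m₍₀₎`, natural in the `H`-module `N`; the coaction is its value at `N = H`, `n = 1`. In this
dictionary the Yetter–Drinfeld compatibility is `H`-linearity, coassociativity is the hexagon, the
counit law says that invariant vectors are passed trivially, and the tensor product coaction is the
composite of two half-braidings (`coactTwist_tensorCoact`). The statements about `C ◇ A` and braided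
tensor products then become diagram chases from pentagon, hexagon and naturality.

The chases take place on right-nested tensor products ("towers"), where the half-braiding `tb` and
the multiplication `mulX` act at the front and hardly any constraint remains. Associativity of `C ◇
A` is `diaAct_diaAct`. That the multiplication of a braided tensor product respects the coactions
rests on the braid relation `tb_tb_tb`. The isomorphism exists for every Yetter–Drinfeld algebra `B`
in place of `H₀` (`isModuleAlgebraIso_assoc`): in `(C ◇ A) ◇ B` the hexagon splits the passage of
`B` past `C ⊗ A`, in `C ◇ (A ⊗ B)` the tensor coaction splits the passage of `A ⊗ B` past `C`, and
the resulting products differ only in the order of operations that commute by naturality.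

It remains to see that `H₀` is a Yetter–Drinfeld algebra. An `H`-bimodule `P` becomes an `H`-module
under `h ▷ p = h₁ p S(h₂)`. This functor is right adjoint to `V ↦ V ⊗ H`, with counit given by `E(p)
= X¹ p S(X²) α X³`; only the uniqueness half is needed: `H`-linear maps into the adjoint module are
determined by their composite with `E` (`ext_eval`). Now `H₀` is the adjoint module of the regular
bimodule, and `z ⊗ m ↦ E(z)·m` lets it act naturally on every `H`-module. Its product is the one for
which these are module structures (`evalAct_zMul`). Its half-braiding is the one for which acting on
`U ⊗ N` means passing `U` and then acting on `N` (`evalAct_zBraid`). Every axiom follows by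
comparing actions.

Finally these abstract structures are matched with the closed formulas. For the product this takes
the pentagon and the antipode axiom for `α` (`HZero_mul`). For the coaction it takes the relation
between `f⁻¹` and `Δ ∘ S` (`drinfeldTwistInv_coS`) and the computation of the coevaluation
(`comul_coevElem`), combined in `HZero_coact`. -/

@[simp]
theorem tensorAct_tmul (ρ : B →ₐ[k] Module.End k M) (σ : B' →ₐ[k] Module.End k N)
    (b : B) (b' : B') (m : M) (n : N) :
    tensorAct ρ σ (b ⊗ₜ[k] b') (m ⊗ₜ[k] n) = ρ b m ⊗ₜ[k] σ b' n := by
  simp [tensorAct, Module.endTensorEndAlgHom_apply]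

theorem tensorAct_mul_apply (ρ : B →ₐ[k] Module.End k M) (σ : B' →ₐ[k] Module.End k N)
    (s t : B ⊗[k] B') (x : M ⊗[k] N) :
    tensorAct ρ σ (s * t) x = tensorAct ρ σ s (tensorAct ρ σ t x) := by
  rw [map_mul]; rfl

/-- Maps that intertwine the factors intertwine the tensor products. -/
theorem map_tensorAct {M' N' : Type*} [AddCommGroup M'] [Module k M'] [AddCommGroup N']
    [Module k N'] {ρ : B →ₐ[k] Module.End k M} {σ : B' →ₐ[k] Module.End k N}
    {ρ' : B →ₐ[k] Module.End k M'} {σ' : B' →ₐ[k] Module.End k N'}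
    (f : M →ₗ[k] M') (g : N →ₗ[k] N') (hf : ∀ b m, f (ρ b m) = ρ' b (f m))
    (hg : ∀ b n, g (σ b n) = σ' b (g n)) (t : B ⊗[k] B') (x : M ⊗[k] N) :
    TensorProduct.map f g (tensorAct ρ σ t x) = tensorAct ρ' σ' t (TensorProduct.map f g x) := by
  induction t with
  | zero => simp
  | add s t hs ht => simp [hs, ht]
  | tmul b b' =>
    induction x with
    | zero => simp
    | add x y hx hy => simp only [map_add, hx, hy]
    | tmul m n => simp [hf, hg]

theorem tensorAct_comp {D D' : Type*} [Ring D] [Algebra k D] [Ring D'] [Algebra k D']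
    (ρ : B →ₐ[k] Module.End k M) (σ : B' →ₐ[k] Module.End k N)
    (φ : D →ₐ[k] B) (ψ : D' →ₐ[k] B') (t : D ⊗[k] D') :
    tensorAct (ρ.comp φ) (σ.comp ψ) t = tensorAct ρ σ (Algebra.TensorProduct.map φ ψ t) := by
  induction t with
  | zero => simp
  | add s t hs ht => simp [hs, ht]
  | tmul b b' => ext; simp

theorem assoc_tensorAct {B'' P : Type*} [Ring B''] [Algebra k B''] [AddCommGroup P] [Module k P]
    (ρ : B →ₐ[k] Module.End k M) (σ : B' →ₐ[k] Module.End k N) (τ : B'' →ₐ[k] Module.End k P)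
    (t : (B ⊗[k] B') ⊗[k] B'') (x : (M ⊗[k] N) ⊗[k] P) :
    TensorProduct.assoc k M N P (tensorAct (tensorAct ρ σ) τ t x) =
      tensorAct ρ (tensorAct σ τ) (Algebra.TensorProduct.assoc k k k B B' B'' t)
        (TensorProduct.assoc k M N P x) := by
  induction t with
  | zero => simp
  | add s t hs ht => simp only [map_add, LinearMap.add_apply, hs, ht]
  | tmul b b'' =>
    induction b with
    | zero => simp
    | add s t hs ht => simp only [map_add, TensorProduct.add_tmul, LinearMap.add_apply, hs, ht]
    | tmul b b' =>
      induction x with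
      | zero => simp
      | add x y hx hy => simp only [map_add, hx, hy]
      | tmul m p =>
        induction m with
        | zero => simp
        | add x y hx hy => simp only [map_add, TensorProduct.add_tmul, hx, hy]
        | tmul m n => simp

theorem lTensor_tensorAct (ρ : B →ₐ[k] Module.End k M) (σ : B' →ₐ[k] Module.End k N)
    (t : B') (x : M ⊗[k] N) :
    LinearMap.lTensor M (σ t) x = tensorAct ρ σ (1 ⊗ₜ[k] t) x := by
  induction x with
  | zero => simp
  | add x y hx hy => simp only [map_add, hx, hy]
  | tmul m p => simp

theorem rTensor_tensorAct (ρ : B →ₐ[k] Module.End k M) (σ : B' →ₐ[k] Module.End k N)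
    (t : B) (x : M ⊗[k] N) :
    LinearMap.rTensor N (ρ t) x = tensorAct ρ σ (t ⊗ₜ[k] 1) x := by
  induction x with
  | zero => simp
  | add x y hx hy => simp only [map_add, hx, hy]
  | tmul m p => simp

end

end TensorActLemmas

section HHom

variable {k H : Type*} [Field k] [Ring H] [Algebra k H]

/-- `H`-linear maps between left `H`-modules. -/
structure HHom {M N : Type*} [AddCommGroup M] [Module k M] [AddCommGroup N] [Module k N]
    (ρ : H →ₐ[k] Module.End k M) (σ : H →ₐ[k] Module.End k N) extends M →ₗ[k] N where
  map_act' : ∀ h m, toLinearMap (ρ h m) = σ h (toLinearMap m)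

variable {M N P Q : Type*} [AddCommGroup M] [Module k M] [AddCommGroup N] [Module k N]
  [AddCommGroup P] [Module k P] [AddCommGroup Q] [Module k Q]
variable {ρ : H →ₐ[k] Module.End k M} {σ : H →ₐ[k] Module.End k N} {τ : H →ₐ[k] Module.End k P}
  {υ : H →ₐ[k] Module.End k Q}

instance : FunLike (HHom ρ σ) M N where
  coe f := f.toLinearMap
  coe_injective f g h := by
    cases f; cases g; congr; exact DFunLike.coe_injective h

instance : LinearMapClass (HHom ρ σ) k M N where
  map_add f := f.toLinearMap.map_add
  map_smulₛₗ f := f.toLinearMap.map_smul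

theorem HHom.toLinearMap_apply (f : HHom ρ σ) (m : M) : f.toLinearMap m = f m := rfl

theorem HHom.map_act (f : HHom ρ σ) (h : H) (m : M) : f (ρ h m) = σ h (f m) := f.map_act' h m

/-- Composition of `H`-linear maps. -/
def HHom.comp (f : HHom σ τ) (g : HHom ρ σ) : HHom ρ τ :=
  ⟨f.toLinearMap ∘ₗ g.toLinearMap, fun h m => by
    simp only [LinearMap.comp_apply, HHom.toLinearMap_apply, HHom.map_act]⟩

theorem HHom.comp_apply (f : HHom σ τ) (g : HHom ρ σ) (m : M) : f.comp g m = f (g m) := rfl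

end HHom

/-! ### Whiskering, the associativity constraint and the pentagon -/

section Monoidal

variable {k H : Type*} [Field k] [Ring H] [Algebra k H] [QuasiBialgebra k H]
variable {M N P Q M' N' P' : Type*} [AddCommGroup M] [Module k M] [AddCommGroup N] [Module k N]
  [AddCommGroup P] [Module k P] [AddCommGroup Q] [Module k Q]
  [AddCommGroup M'] [Module k M'] [AddCommGroup N'] [Module k N'] [AddCommGroup P'] [Module k P']

infixr:70 "⊠" => diagAct

variable (ρ : H →ₐ[k] Module.End k M) (σ : H →ₐ[k] Module.End k N) (τ : H →ₐ[k] Module.End k P)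
  (υ : H →ₐ[k] Module.End k Q)
variable {ρ' : H →ₐ[k] Module.End k M'} {σ' : H →ₐ[k] Module.End k N'}
  {τ' : H →ₐ[k] Module.End k P'}

theorem diagAct_def (h : H) : (ρ ⊠ σ) h = tensorAct ρ σ (QuasiBialgebra.comul h) := rfl

/-- The whiskering `id ⊗ f`. -/
def whL {σ : H →ₐ[k] Module.End k N} (f : HHom σ σ') : HHom (ρ ⊠ σ) (ρ ⊠ σ') :=
  ⟨LinearMap.lTensor M f.toLinearMap, fun h x =>
    map_tensorAct (ρ := ρ) (ρ' := ρ) _ _ (fun _ _ => rfl) f.map_act' _ _⟩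

/-- The whiskering `f ⊗ id`. -/
def whR {ρ : H →ₐ[k] Module.End k M} (f : HHom ρ ρ') : HHom (ρ ⊠ σ) (ρ' ⊠ σ) :=
  ⟨LinearMap.rTensor N f.toLinearMap, fun h x =>
    map_tensorAct (σ := σ) (σ' := σ) _ _ f.map_act' (fun _ _ => rfl) _ _⟩

/-- The associativity constraint as an `H`-linear map. -/
def assocH : HHom ((ρ ⊠ σ) ⊠ τ) (ρ ⊠ (σ ⊠ τ)) :=
  ⟨assocConstraint ρ σ τ, fun h x => by
    -- The two iterated diagonal actions are the actions of `(Δ ⊗ id)Δ(h)` and `(id ⊗ Δ)Δ(h)`, so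
    -- conjugation by `Φ` intertwines them by quasi-coassociativity.
    have e1 : ((ρ ⊠ σ) ⊠ τ) h x = tensorAct (tensorAct ρ σ) τ
        (Algebra.TensorProduct.map QuasiBialgebra.comul (AlgHom.id k H)
          (QuasiBialgebra.comul h)) x := by
      rw [← tensorAct_comp]; rfl
    have e2 : (ρ ⊠ (σ ⊠ τ)) h = tensorAct ρ (tensorAct σ τ)
        (Algebra.TensorProduct.map (AlgHom.id k H) QuasiBialgebra.comul
          (QuasiBialgebra.comul h)) := by
      rw [← tensorAct_comp]; rfl
    rw [e1, e2, QuasiBialgebra.coassoc]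
    simp only [assocConstraint, LinearMap.comp_apply, LinearEquiv.coe_coe, assoc_tensorAct,
      ← tensorAct_mul_apply, mul_assoc, reassoc, Units.inv_mul, mul_one]⟩

theorem assocConstraintInv_assocConstraint (x) :
    assocConstraintInv ρ σ τ (assocConstraint ρ σ τ x) = x := by
  simp only [assocConstraint, assocConstraintInv, LinearMap.comp_apply, LinearEquiv.coe_coe,
    ← tensorAct_mul_apply, reassoc, reassocInv, Units.inv_mul, map_one, Module.End.one_apply,
    LinearEquiv.symm_apply_apply]

theorem assocConstraint_assocConstraintInv (x) :
    assocConstraint ρ σ τ (assocConstraintInv ρ σ τ x) = x := by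
  simp only [assocConstraint, assocConstraintInv, LinearMap.comp_apply, LinearEquiv.coe_coe,
    ← tensorAct_mul_apply, reassoc, reassocInv, Units.mul_inv, map_one, Module.End.one_apply,
    LinearEquiv.apply_symm_apply]

/-- The inverse associativity constraint as an `H`-linear map. -/
def assocInvH : HHom (ρ ⊠ (σ ⊠ τ)) ((ρ ⊠ σ) ⊠ τ) :=
  ⟨assocConstraintInv ρ σ τ, fun h x => by
    obtain ⟨y, rfl⟩ : ∃ y, assocConstraint ρ σ τ y = x :=
      ⟨_, assocConstraint_assocConstraintInv ρ σ τ x⟩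
    have := (assocH ρ σ τ).map_act' h y
    change assocConstraint ρ σ τ _ = _ at this
    change assocConstraintInv ρ σ τ ((ρ ⊠ (σ ⊠ τ)) h ((assocH ρ σ τ).toLinearMap y)) = _
    rw [← this, assocConstraintInv_assocConstraint, assocConstraintInv_assocConstraint]⟩

@[simp] theorem assocH_assocInvH (x) : assocH ρ σ τ (assocInvH ρ σ τ x) = x :=
  assocConstraint_assocConstraintInv ρ σ τ x

@[simp] theorem assocInvH_assocH (x) : assocInvH ρ σ τ (assocH ρ σ τ x) = x :=
  assocConstraintInv_assocConstraint ρ σ τ x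

variable {ρ σ τ υ}

theorem whL_comp_apply {τ : H →ₐ[k] Module.End k P} (f : HHom σ τ) (g : HHom σ' σ)
    (x : M ⊗[k] N') : whL ρ f (whL ρ g x) = whL ρ (f.comp g) x :=
  (LinearMap.lTensor_comp_apply M f.toLinearMap g.toLinearMap x).symm

theorem whR_comp_apply {τ : H →ₐ[k] Module.End k P} (f : HHom σ τ) (g : HHom σ' σ)
    (x : N' ⊗[k] M) : whR ρ f (whR ρ g x) = whR ρ (f.comp g) x :=
  (LinearMap.rTensor_comp_apply M f.toLinearMap g.toLinearMap x).symm

theorem whL_tmul (f : HHom σ τ) (m : M) (n : N) : whL ρ f (m ⊗ₜ[k] n) = m ⊗ₜ[k] f n := rfl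

theorem whR_tmul (f : HHom σ τ) (m : M) (n : N) : whR ρ f (n ⊗ₜ[k] m) = f n ⊗ₜ[k] m := rfl

theorem whL_congr {f g : HHom σ τ} (h : ∀ s, f s = g s) (t : M ⊗[k] N) :
    whL ρ f t = whL ρ g t := by
  have : f = g := DFunLike.ext _ _ h
  rw [this]

theorem whR_congr {f g : HHom σ τ} (h : ∀ s, f s = g s) (t : N ⊗[k] M) :
    whR ρ f t = whR ρ g t := by
  have : f = g := DFunLike.ext _ _ h
  rw [this]

theorem whL_whR (f : HHom ρ ρ') (g : HHom σ σ') (t : M ⊗[k] N) :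
    whL ρ' g (whR σ f t) = whR σ' f (whL ρ g t) := by
  induction t with
  | zero => simp
  | add x y hx hy => simp only [map_add, hx, hy]
  | tmul m n => rfl

theorem map_assocH (f : HHom ρ ρ') (g : HHom σ σ') (h : HHom τ τ') (x : (M ⊗[k] N) ⊗[k] P) :
    TensorProduct.map f.toLinearMap (TensorProduct.map g.toLinearMap h.toLinearMap)
      (assocH ρ σ τ x) = assocH ρ' σ' τ'
        (TensorProduct.map (TensorProduct.map f.toLinearMap g.toLinearMap) h.toLinearMap x) := by
  change TensorProduct.map f.toLinearMap (TensorProduct.map g.toLinearMap h.toLinearMap)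
    (tensorAct ρ (tensorAct σ τ) _ (TensorProduct.assoc k M N P x)) =
    tensorAct ρ' (tensorAct σ' τ') _ (TensorProduct.assoc k M' N' P' _)
  rw [map_tensorAct f.toLinearMap (TensorProduct.map g.toLinearMap h.toLinearMap) (ρ' := ρ')
    (σ' := tensorAct σ' τ') f.map_act' (map_tensorAct _ _ g.map_act' h.map_act')]
  congr 1
  exact DFunLike.congr_fun (TensorProduct.map_map_comp_assoc_eq f.toLinearMap g.toLinearMap
    h.toLinearMap) x

theorem whR_assocH (f : HHom ρ ρ') (x : (M ⊗[k] N) ⊗[k] P) :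
    whR (σ ⊠ τ) f (assocH ρ σ τ x) = assocH ρ' σ τ (whR τ (whR σ f) x) := by
  have := map_assocH f (⟨LinearMap.id, fun _ _ => rfl⟩ : HHom σ σ)
    (⟨LinearMap.id, fun _ _ => rfl⟩ : HHom τ τ) x
  rw [TensorProduct.map_id] at this
  exact this

theorem whM_assocH (f : HHom σ σ') (x : (M ⊗[k] N) ⊗[k] P) :
    whL ρ (whR τ f) (assocH ρ σ τ x) = assocH ρ σ' τ (whR τ (whL ρ f) x) :=
  map_assocH (⟨LinearMap.id, fun _ _ => rfl⟩ : HHom ρ ρ) f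
    (⟨LinearMap.id, fun _ _ => rfl⟩ : HHom τ τ) x

theorem whL_assocH (f : HHom τ τ') (x : (M ⊗[k] N) ⊗[k] P) :
    whL ρ (whL σ f) (assocH ρ σ τ x) = assocH ρ σ τ' (whL (ρ ⊠ σ) f x) := by
  have := map_assocH (⟨LinearMap.id, fun _ _ => rfl⟩ : HHom ρ ρ)
    (⟨LinearMap.id, fun _ _ => rfl⟩ : HHom σ σ) f x
  rw [TensorProduct.map_id] at this
  exact this

theorem whR_assocInvH (f : HHom ρ ρ') (x : M ⊗[k] (N ⊗[k] P)) :
    assocInvH ρ' σ τ (whR (σ ⊠ τ) f x) = whR τ (whR σ f) (assocInvH ρ σ τ x) := by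
  have := whR_assocH (σ := σ) (τ := τ) f (assocInvH ρ σ τ x)
  rw [assocH_assocInvH] at this
  rw [this, assocInvH_assocH]

theorem whM_assocInvH (f : HHom σ σ') (x : M ⊗[k] (N ⊗[k] P)) :
    assocInvH ρ σ' τ (whL ρ (whR τ f) x) = whR τ (whL ρ f) (assocInvH ρ σ τ x) := by
  have := whM_assocH (ρ := ρ) (τ := τ) f (assocInvH ρ σ τ x)
  rw [assocH_assocInvH] at this
  rw [this, assocInvH_assocH]

theorem whL_assocInvH (f : HHom τ τ') (x : M ⊗[k] (N ⊗[k] P)) :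
    assocInvH ρ σ τ' (whL ρ (whL σ f) x) = whL (ρ ⊠ σ) f (assocInvH ρ σ τ x) := by
  have := whL_assocH (ρ := ρ) (σ := σ) f (assocInvH ρ σ τ x)
  rw [assocH_assocInvH] at this
  rw [this, assocInvH_assocH]

theorem assocH_apply (x) : assocH ρ σ τ x =
    tensorAct ρ (tensorAct σ τ) (reassoc k H) (TensorProduct.assoc k M N P x) := rfl

/-- The pentagon identity. -/
theorem pentagonH (x : ((M ⊗[k] N) ⊗[k] P) ⊗[k] Q) :
    assocH ρ σ (τ ⊠ υ) (assocH (ρ ⊠ σ) τ υ x) =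
      whL ρ (assocH σ τ υ) (assocH ρ (σ ⊠ τ) υ (whR υ (assocH ρ σ τ) x)) := by
  -- Each path is plain rebracketing followed by the action of one element of the fourth tensor
  -- power of `H`; the two elements are the two sides of the pentagon axiom for `Φ`.
  have e1 : assocH ρ σ (τ ⊠ υ) (assocH (ρ ⊠ σ) τ υ x) =
      tensorAct ρ (tensorAct σ (tensorAct τ υ))
        (Algebra.TensorProduct.map (AlgHom.id k H)
          (Algebra.TensorProduct.map (AlgHom.id k H) QuasiBialgebra.comul) (reassoc k H) *
        Algebra.TensorProduct.assoc k k k H H (H ⊗[k] H)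
          (Algebra.TensorProduct.map QuasiBialgebra.comul (AlgHom.id k (H ⊗[k] H))
            (reassoc k H)))
        (TensorProduct.assoc k M N (P ⊗[k] Q) (TensorProduct.assoc k (M ⊗[k] N) P Q x)) := by
    have key : tensorAct σ ((tensorAct τ υ).comp QuasiBialgebra.comul) =
        (tensorAct σ (tensorAct τ υ)).comp
          (Algebra.TensorProduct.map (AlgHom.id k H) QuasiBialgebra.comul) :=
      AlgHom.ext fun t => tensorAct_comp σ (tensorAct τ υ) (AlgHom.id k H) QuasiBialgebra.comul t
    change tensorAct (ρ.comp (AlgHom.id k H))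
        (tensorAct σ ((tensorAct τ υ).comp QuasiBialgebra.comul)) (reassoc k H)
      (TensorProduct.assoc k M N (P ⊗[k] Q)
        (tensorAct ((tensorAct ρ σ).comp QuasiBialgebra.comul)
          ((tensorAct τ υ).comp (AlgHom.id k _)) (reassoc k H)
          (TensorProduct.assoc k (M ⊗[k] N) P Q x))) = _
    rw [key, tensorAct_comp, tensorAct_comp, assoc_tensorAct, ← tensorAct_mul_apply]
  have e2 : whL ρ (assocH σ τ υ) (assocH ρ (σ ⊠ τ) υ (whR υ (assocH ρ σ τ) x)) =
      tensorAct ρ (tensorAct σ (tensorAct τ υ))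
        (((1 : H) ⊗ₜ[k] reassoc k H) *
        Algebra.TensorProduct.map (AlgHom.id k H)
          ((Algebra.TensorProduct.assoc k k k H H H).toAlgHom.comp
            (Algebra.TensorProduct.map QuasiBialgebra.comul (AlgHom.id k H))) (reassoc k H) *
        Algebra.TensorProduct.map (AlgHom.id k H)
          (Algebra.TensorProduct.map (AlgHom.id k H)
            (Algebra.TensorProduct.includeLeft : H →ₐ[k] H ⊗[k] H))
          (reassoc k H))
        (TensorProduct.assoc k M N (P ⊗[k] Q) (TensorProduct.assoc k (M ⊗[k] N) P Q x)) := by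
    change LinearMap.lTensor M (tensorAct σ (tensorAct τ υ) (reassoc k H) ∘ₗ
        (TensorProduct.assoc k N P Q).toLinearMap)
      (tensorAct ρ (tensorAct ((tensorAct σ τ).comp QuasiBialgebra.comul)
          (υ.comp (AlgHom.id k H))) (reassoc k H)
        (TensorProduct.assoc k M (N ⊗[k] P) Q
          (LinearMap.rTensor Q (tensorAct ρ (tensorAct σ τ) (reassoc k H) ∘ₗ
            (TensorProduct.assoc k M N P).toLinearMap) x))) = _
    rw [LinearMap.lTensor_comp, LinearMap.rTensor_comp, LinearMap.comp_apply,
      LinearMap.comp_apply, lTensor_tensorAct ρ, rTensor_tensorAct _ υ, assoc_tensorAct,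
      tensorAct_mul_apply, tensorAct_mul_apply]
    congr 1
    have key : ∀ (t : H ⊗[k] (H ⊗[k] H)) (y : M ⊗[k] ((N ⊗[k] P) ⊗[k] Q)),
        LinearMap.lTensor M (TensorProduct.assoc k N P Q).toLinearMap
          (tensorAct ρ (tensorAct ((tensorAct σ τ).comp QuasiBialgebra.comul)
            (υ.comp (AlgHom.id k H))) t y) =
        tensorAct ρ (tensorAct σ (tensorAct τ υ))
          (Algebra.TensorProduct.map (AlgHom.id k H)
            ((Algebra.TensorProduct.assoc k k k H H H).toAlgHom.comp
            (Algebra.TensorProduct.map QuasiBialgebra.comul (AlgHom.id k H))) t)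
          (LinearMap.lTensor M (TensorProduct.assoc k N P Q).toLinearMap y) := by
      intro t y
      rw [← tensorAct_comp]
      refine map_tensorAct _ _ (fun _ _ => rfl) (fun b n => ?_) t y
      change TensorProduct.assoc k N P Q _ = tensorAct σ (tensorAct τ υ)
        (Algebra.TensorProduct.assoc k k k H H H _) (TensorProduct.assoc k N P Q n)
      rw [← assoc_tensorAct, tensorAct_comp]
      rfl
    rw [key]
    congr 1
    have key2 : ∀ (t : H ⊗[k] (H ⊗[k] H)) (y : (M ⊗[k] (N ⊗[k] P)) ⊗[k] Q),
        LinearMap.lTensor M (TensorProduct.assoc k N P Q).toLinearMap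
          (tensorAct ρ (tensorAct (tensorAct σ τ) υ)
            (Algebra.TensorProduct.assoc k k k H (H ⊗[k] H) H (t ⊗ₜ[k] 1))
            (TensorProduct.assoc k M (N ⊗[k] P) Q y)) =
        tensorAct ρ (tensorAct σ (tensorAct τ υ))
          (Algebra.TensorProduct.map (AlgHom.id k H)
            (Algebra.TensorProduct.map (AlgHom.id k H)
              (Algebra.TensorProduct.includeLeft : H →ₐ[k] H ⊗[k] H)) t)
          (LinearMap.lTensor M (TensorProduct.assoc k N P Q).toLinearMap
            (TensorProduct.assoc k M (N ⊗[k] P) Q y)) := by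
      intro t y
      induction t with
      | zero => simp
      | add s t hs ht => simp only [TensorProduct.add_tmul, map_add, LinearMap.add_apply, hs, ht]
      | tmul a b =>
        induction y with
        | zero => simp
        | add s t hs ht => simp only [map_add, hs, ht]
        | tmul m q =>
          induction m with
          | zero => simp
          | add s t hs ht => simp only [TensorProduct.add_tmul, map_add, hs, ht]
          | tmul m n =>
            induction b with
            | zero => simp
            | add s t hs ht =>
              simp only [TensorProduct.tmul_add, TensorProduct.add_tmul, map_add,
                LinearMap.add_apply, hs, ht]
            | tmul b c =>
              induction n with
              | zero => simp
              | add s t hs ht =>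
                simp only [TensorProduct.tmul_add, TensorProduct.add_tmul, map_add, hs, ht]
              | tmul n p => simp
    rw [key2]
    congr 1
    -- Once all elements of `H` have been pulled out, what is left is the pentagon for tensor
    -- products of vector spaces.
    have key3 : ∀ x : ((M ⊗[k] N) ⊗[k] P) ⊗[k] Q,
        LinearMap.lTensor M (TensorProduct.assoc k N P Q).toLinearMap
          (TensorProduct.assoc k M (N ⊗[k] P) Q
            (LinearMap.rTensor Q (TensorProduct.assoc k M N P).toLinearMap x)) =
        TensorProduct.assoc k M N (P ⊗[k] Q) (TensorProduct.assoc k (M ⊗[k] N) P Q x) := by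
      intro x
      exact DFunLike.congr_fun (show LinearMap.lTensor M (TensorProduct.assoc k N P Q).toLinearMap
          ∘ₗ (TensorProduct.assoc k M (N ⊗[k] P) Q).toLinearMap ∘ₗ
            LinearMap.rTensor Q (TensorProduct.assoc k M N P).toLinearMap =
        (TensorProduct.assoc k M N (P ⊗[k] Q)).toLinearMap ∘ₗ
          (TensorProduct.assoc k (M ⊗[k] N) P Q).toLinearMap by ext; simp) x
    exact key3 x
  rw [e1, e2]
  exact (congrArg (fun e => tensorAct ρ (tensorAct σ (tensorAct τ υ)) e _)
    QuasiBialgebra.pentagon).symm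

end Monoidal

end QuasiHopf

namespace QuasiHopf

/-! ### Invariant vectors and the normalization of `Φ` -/

section Invariants

variable {k H : Type*} [Field k] [Ring H] [Algebra k H] [QuasiBialgebra k H]
variable {M N P : Type*} [AddCommGroup M] [Module k M] [AddCommGroup N] [Module k N]
  [AddCommGroup P] [Module k P]
variable {ρ : H →ₐ[k] Module.End k M} {σ : H →ₐ[k] Module.End k N} {τ : H →ₐ[k] Module.End k P}

/-- `H` acts on `u` through the counit. -/
def IsInvariant (ρ : H →ₐ[k] Module.End k M) (u : M) : Prop :=
  ∀ h : H, ρ h u = (QuasiBialgebra.counit h : k) • u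

/-- An invariant vector sees its leg of `H` only through `ε`, so the leg may be replaced by a scalar
(`Algebra.ofId`). In this form the counit axioms for `Δ` and `Φ` can be applied. -/
theorem tensorAct_invariant_left {B : Type*} [Ring B] [Algebra k B] {u : M}
    (hu : IsInvariant ρ u) (χ : B →ₐ[k] Module.End k N) (t : H ⊗[k] B) (y : N) :
    tensorAct ρ χ t (u ⊗ₜ[k] y) = tensorAct (Algebra.ofId k (Module.End k M)) χ
      (Algebra.TensorProduct.map QuasiBialgebra.counit (AlgHom.id k B) t) (u ⊗ₜ[k] y) := by
  induction t with
  | zero => simp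
  | add s t hs ht => simp only [map_add, LinearMap.add_apply, hs, ht]
  | tmul a b => simp [hu a, Algebra.ofId_apply]

theorem tensorAct_invariant_mid {u : N} (hu : IsInvariant σ u) (t : H ⊗[k] (H ⊗[k] H))
    (x : M) (y : P) :
    tensorAct ρ (tensorAct σ τ) t (x ⊗ₜ[k] (u ⊗ₜ[k] y)) =
      tensorAct ρ (tensorAct (Algebra.ofId k (Module.End k N)) τ)
      (Algebra.TensorProduct.map (AlgHom.id k H)
        (Algebra.TensorProduct.map QuasiBialgebra.counit (AlgHom.id k H)) t)
        (x ⊗ₜ[k] (u ⊗ₜ[k] y)) := by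
  induction t with
  | zero => simp
  | add s t hs ht => simp only [map_add, LinearMap.add_apply, hs, ht]
  | tmul a b => simp [tensorAct_invariant_left hu]

theorem tensorAct_invariant_right {u : P} (hu : IsInvariant τ u) (t : H ⊗[k] (H ⊗[k] H))
    (x : M) (y : N) :
    tensorAct ρ (tensorAct σ τ) t (x ⊗ₜ[k] (y ⊗ₜ[k] u)) =
      tensorAct ρ (tensorAct σ (Algebra.ofId k (Module.End k P)))
      (Algebra.TensorProduct.map (AlgHom.id k H)
        (Algebra.TensorProduct.map (AlgHom.id k H) QuasiBialgebra.counit) t)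
        (x ⊗ₜ[k] (y ⊗ₜ[k] u)) := by
  induction t with
  | zero => simp
  | add s t hs ht => simp only [map_add, LinearMap.add_apply, hs, ht]
  | tmul a b =>
    induction b with
    | zero => simp
    | add s t hs ht =>
      simp only [TensorProduct.tmul_add, map_add, LinearMap.add_apply, hs, ht]
    | tmul b c => simp [hu c, Algebra.ofId_apply]

theorem diagAct_invariant_left {u : M} (hu : IsInvariant ρ u) (h : H) (y : N) :
    (ρ ⊠ σ) h (u ⊗ₜ[k] y) = u ⊗ₜ[k] σ h y := by
  rw [diagAct_def, tensorAct_invariant_left hu, QuasiBialgebra.counit_left]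
  simp

theorem IsInvariant.tmul {u : M} {v : N} (hu : IsInvariant ρ u) (hv : IsInvariant σ v) :
    IsInvariant (ρ ⊠ σ) (u ⊗ₜ[k] v) := fun h => by
  rw [diagAct_invariant_left hu, hv h, TensorProduct.tmul_smul]

/-- Applying `ε` to any leg of `Φ` gives `1`, so the constraint is invisible next to an invariant
vector. Units of module algebras, and later `β`, are such vectors; this is what makes the unit laws
work. -/
theorem assocH_invariant_left {u : M} (hu : IsInvariant ρ u) (y : N) (z : P) :
    assocH ρ σ τ ((u ⊗ₜ[k] y) ⊗ₜ[k] z) = u ⊗ₜ[k] (y ⊗ₜ[k] z) := by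
  rw [assocH_apply, TensorProduct.assoc_tmul, tensorAct_invariant_left hu, reassoc,
    QuasiBialgebra.counit_Phi_left, map_one]
  rfl

theorem assocH_invariant_mid {u : N} (hu : IsInvariant σ u) (y : M) (z : P) :
    assocH ρ σ τ ((y ⊗ₜ[k] u) ⊗ₜ[k] z) = y ⊗ₜ[k] (u ⊗ₜ[k] z) := by
  rw [assocH_apply, TensorProduct.assoc_tmul, tensorAct_invariant_mid hu, reassoc,
    QuasiBialgebra.counit_Phi_mid, map_one]
  rfl

theorem assocH_invariant_right {u : P} (hu : IsInvariant τ u) (y : M) (z : N) :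
    assocH ρ σ τ ((y ⊗ₜ[k] z) ⊗ₜ[k] u) = y ⊗ₜ[k] (z ⊗ₜ[k] u) := by
  rw [assocH_apply, TensorProduct.assoc_tmul, tensorAct_invariant_right hu, reassoc,
    QuasiBialgebra.counit_Phi_right, map_one]
  rfl

theorem assocInvH_invariant_left {u : M} (hu : IsInvariant ρ u) (y : N) (z : P) :
    assocInvH ρ σ τ (u ⊗ₜ[k] (y ⊗ₜ[k] z)) = (u ⊗ₜ[k] y) ⊗ₜ[k] z := by
  rw [← assocH_invariant_left hu, assocInvH_assocH]

theorem assocInvH_invariant_mid {u : N} (hu : IsInvariant σ u) (y : M) (z : P) :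
    assocInvH ρ σ τ (y ⊗ₜ[k] (u ⊗ₜ[k] z)) = (y ⊗ₜ[k] u) ⊗ₜ[k] z := by
  rw [← assocH_invariant_mid hu, assocInvH_assocH]

end Invariants

/-! ### The half-braiding afforded by a coaction -/

section Braid

variable {k H : Type*} [Field k] [Ring H] [Algebra k H]

theorem sandwich_tmul {U V M N N' L : Type*} [AddCommGroup U] [Module k U] [AddCommGroup V]
    [Module k V] [AddCommGroup M] [Module k M] [AddCommGroup N] [Module k N] [AddCommGroup N']
    [Module k N'] [AddCommGroup L] [Module k L]
    (P : U →ₗ[k] M →ₗ[k] N) (T : N →ₗ[k] N') (Q : V →ₗ[k] N' →ₗ[k] L) (u : U) (v : V) (m : M) :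
    sandwich P T Q (u ⊗ₜ[k] v) m = Q v (T (P u m)) := by
  simp [sandwich]

theorem rmulFst_tmul {B M : Type*} [Ring B] [Algebra k B] [AddCommGroup M] [Module k M]
    (b x : B) (m : M) : rmulFst (k := k) B M b (x ⊗ₜ[k] m) = (x * b) ⊗ₜ[k] m := by
  simp [rmulFst]

variable [QuasiBialgebra k H]
variable {M N P Q N' P' : Type*} [AddCommGroup M] [Module k M] [AddCommGroup N] [Module k N]
  [AddCommGroup P] [Module k P] [AddCommGroup Q] [Module k Q]
  [AddCommGroup N'] [Module k N'] [AddCommGroup P'] [Module k P']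

/-- `x ⊗ m ↦ x·n ⊗ m`. -/
def applyFst (M : Type*) [AddCommGroup M] [Module k M] (σ : H →ₐ[k] Module.End k N) (n : N) :
    H ⊗[k] M →ₗ[k] N ⊗[k] M :=
  TensorProduct.map (σ.toLinearMap.flip n) LinearMap.id

theorem applyFst_tmul (σ : H →ₐ[k] Module.End k N) (n : N) (x : H) (m : M) :
    applyFst M σ n (x ⊗ₜ[k] m) = σ x n ⊗ₜ[k] m := rfl

theorem coactTwist_tmul (σ : H →ₐ[k] Module.End k N) (lam : M →ₗ[k] H ⊗[k] M) (m : M) (n : N) :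
    coactTwist σ lam (m ⊗ₜ[k] n) = applyFst M σ n (lam m) := by
  simp only [coactTwist, LinearMap.comp_apply, LinearMap.rTensor_tmul]
  induction lam m with
  | zero => simp
  | add x y hx hy => simp only [TensorProduct.add_tmul, map_add, hx, hy]
  | tmul x m => simp [applyFst_tmul]

theorem applyFst_rmulFst (σ : H →ₐ[k] Module.End k N) (n : N) (b : H) (z : H ⊗[k] M) :
    applyFst M σ n (rmulFst H M b z) = applyFst M σ (σ b n) z := by
  induction z with
  | zero => simp
  | add x y hx hy => simp only [map_add, hx, hy]
  | tmul x m => simp [applyFst_tmul, rmulFst_tmul]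

/-- Nothing is lost by evaluating a coaction on the regular module at `1`. This converts identities
between half-braidings back into identities between coactions. -/
theorem applyFst_one (z : H ⊗[k] M) : applyFst M (Algebra.lmul k H) 1 z = z := by
  induction z with
  | zero => simp
  | add x y hx hy => simp only [map_add, hx, hy]
  | tmul x m => simp [applyFst_tmul]

/-- The Yetter–Drinfeld compatibility of an action and a coaction. -/
def IsCompatible (ρ : H →ₐ[k] Module.End k M) (lam : M →ₗ[k] H ⊗[k] M) : Prop :=
  ∀ (h : H) (m : M),
    tensorAct (Algebra.lmul k H) ρ (QuasiBialgebra.comul h) (lam m) =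
      sandwich ρ.toLinearMap lam (rmulFst H M) (QuasiBialgebra.comul h) m

theorem coactTwist_tensorAct (ρ : H →ₐ[k] Module.End k M) (lam : M →ₗ[k] H ⊗[k] M)
    (σ : H →ₐ[k] Module.End k N) (t : H ⊗[k] H) (m : M) (n : N) :
    coactTwist σ lam (tensorAct ρ σ t (m ⊗ₜ[k] n)) =
      applyFst M σ n (sandwich ρ.toLinearMap lam (rmulFst H M) t m) := by
  induction t with
  | zero => simp
  | add s t hs ht => simp only [map_add, LinearMap.add_apply, hs, ht]
  | tmul a b => simp [coactTwist_tmul, sandwich_tmul, applyFst_rmulFst]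

theorem applyFst_tensorAct {B : Type*} [Ring B] [Algebra k B] (ρ : B →ₐ[k] Module.End k M)
    (σ : H →ₐ[k] Module.End k N) (t : H ⊗[k] B) (n : N) (z : H ⊗[k] M) :
    applyFst M σ n (tensorAct (Algebra.lmul k H) ρ t z) =
      tensorAct σ ρ t (applyFst M σ n z) :=
  map_tensorAct _ _ (fun b m => by simp) (fun _ _ => rfl) _ _

/-- Left multiplication on `m₍₋₁₎` is an action after the half-braiding, right multiplication an
action before it; the compatibility axiom evaluated at `n` is therefore `H`-linearity. -/
theorem coactTwist_diagAct {ρ : H →ₐ[k] Module.End k M} {lam : M →ₗ[k] H ⊗[k] M}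
    (hc : IsCompatible ρ lam) (σ : H →ₐ[k] Module.End k N) (h : H) (x : M ⊗[k] N) :
    coactTwist σ lam ((ρ ⊠ σ) h x) = (σ ⊠ ρ) h (coactTwist σ lam x) := by
  induction x with
  | zero => simp
  | add x y hx hy => simp only [map_add, hx, hy]
  | tmul m n =>
    rw [diagAct_def, diagAct_def, coactTwist_tensorAct, ← hc, applyFst_tensorAct,
      coactTwist_tmul]

theorem isCompatible_of_coactTwist {ρ : H →ₐ[k] Module.End k M} {lam : M →ₗ[k] H ⊗[k] M}
    (h : ∀ (h : H) (x : M ⊗[k] H), coactTwist (Algebra.lmul k H) lam ((ρ ⊠ Algebra.lmul k H) h x) =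
      (Algebra.lmul k H ⊠ ρ) h (coactTwist (Algebra.lmul k H) lam x)) :
    IsCompatible ρ lam := fun a m => by
  have := h a (m ⊗ₜ[k] 1)
  rwa [diagAct_def, diagAct_def, coactTwist_tensorAct, coactTwist_tmul, applyFst_one,
    applyFst_one, eq_comm] at this

/-- The half-braiding `m ⊗ n ↦ m₍₋₁₎·n ⊗ m₍₀₎`. -/
def braid {ρ : H →ₐ[k] Module.End k M} {lam : M →ₗ[k] H ⊗[k] M}
    (hc : IsCompatible ρ lam) (σ : H →ₐ[k] Module.End k N) : HHom (ρ ⊠ σ) (σ ⊠ ρ) :=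
  ⟨coactTwist σ lam, coactTwist_diagAct hc σ⟩

variable {ρ : H →ₐ[k] Module.End k M} {lam : M →ₗ[k] H ⊗[k] M} (hc : IsCompatible ρ lam)
  {σ : H →ₐ[k] Module.End k N} {τ : H →ₐ[k] Module.End k P} {υ : H →ₐ[k] Module.End k Q}
  {σ' : H →ₐ[k] Module.End k N'} {τ' : H →ₐ[k] Module.End k P'}

theorem braid_tmul (m : M) (n : N) : braid hc σ (m ⊗ₜ[k] n) = applyFst M σ n (lam m) :=
  coactTwist_tmul σ lam m n

theorem braid_whL (f : HHom σ σ') (x : M ⊗[k] N) :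
    braid hc σ' (whL ρ f x) = whR ρ f (braid hc σ x) := by
  induction x with
  | zero => simp
  | add x y hx hy => simp only [map_add, hx, hy]
  | tmul m n =>
    rw [whL_tmul, braid_tmul, braid_tmul]
    induction lam m with
    | zero => simp
    | add x y hx hy => simp only [map_add, hx, hy]
    | tmul a m => rw [applyFst_tmul, applyFst_tmul, whR_tmul, HHom.map_act]

/-- `x ⊗ (y ⊗ m) ↦ x·n ⊗ (y·p ⊗ m)`. -/
def applyFstSnd (M : Type*) [AddCommGroup M] [Module k M] (σ : H →ₐ[k] Module.End k N)
    (τ : H →ₐ[k] Module.End k P) (n : N) (p : P) :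
    H ⊗[k] (H ⊗[k] M) →ₗ[k] N ⊗[k] (P ⊗[k] M) :=
  TensorProduct.map (σ.toLinearMap.flip n) (applyFst M τ p)

theorem applyFstSnd_one (z : H ⊗[k] (H ⊗[k] M)) :
    applyFstSnd M (Algebra.lmul k H) (Algebra.lmul k H) 1 1 z = z := by
  induction z with
  | zero => simp
  | add x y hx hy => simp only [map_add, hx, hy]
  | tmul x m => simp [applyFstSnd, applyFst_one]

/-- The coassociativity of a coaction in the Yetter–Drinfeld sense. -/
def IsCoassociative (ρ : H →ₐ[k] Module.End k M) (lam : M →ₗ[k] H ⊗[k] M) : Prop :=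
  ∀ m : M,
    sandwich (tensorAct (Algebra.lmul k H) ρ).toLinearMap (LinearMap.lTensor H lam)
        (LinearMap.lTensorHom H ∘ₗ rmulFst H M) (reassocL k H) (lam m) =
      tensorAct (Algebra.lmul k H) (tensorAct (Algebra.lmul k H) ρ) (reassoc k H)
        (TensorProduct.assoc k H H M
          (sandwich ρ.toLinearMap
            (LinearMap.rTensor M (QuasiBialgebra.comul (k := k) (H := H)).toLinearMap ∘ₗ lam)
            (rmulFst (H ⊗[k] H) M) (reassoc k H) m))

/-- Either side of the coassociativity law, evaluated at `n` and `p`, is one path of the hexagon.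
This one is the path that passes `N` first and `P` afterwards. -/
theorem applyFstSnd_sandwich (n : N) (p : P) (t : (H ⊗[k] H) ⊗[k] H) (z : H ⊗[k] M) :
    applyFstSnd M σ τ n p
      (sandwich (tensorAct (Algebra.lmul k H) ρ).toLinearMap (LinearMap.lTensor H lam)
        (LinearMap.lTensorHom H ∘ₗ rmulFst H M) t z) =
    LinearMap.lTensor N (coactTwist τ lam) (tensorAct σ (tensorAct ρ τ)
      (Algebra.TensorProduct.assoc k k k H H H t)
        (TensorProduct.assoc k N M P (applyFst M σ n z ⊗ₜ[k] p))) := by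
  induction t with
  | zero => simp
  | add s t hs ht => simp only [map_add, LinearMap.add_apply, hs, ht]
  | tmul ab c =>
    induction ab with
    | zero => simp
    | add s t hs ht => simp only [map_add, LinearMap.add_apply, TensorProduct.add_tmul, hs, ht]
    | tmul a b =>
      induction z with
      | zero => simp
      | add s t hs ht => simp only [map_add, TensorProduct.add_tmul, hs, ht]
      | tmul x m =>
        simp [sandwich_tmul, applyFst_tmul, applyFstSnd, applyFst_rmulFst, coactTwist_tmul]

/-- The other path: `Δ(m₍₋₁₎)` acting on `n ⊗ p` is the diagonal action of `m₍₋₁₎`, that is, the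
half-braiding with `N ⊗ P` in one go. -/
theorem applyFstSnd_assoc_sandwich (n : N) (p : P) (t : H ⊗[k] (H ⊗[k] H)) (m : M) :
    applyFstSnd M σ τ n p (TensorProduct.assoc k H H M
      (sandwich ρ.toLinearMap
            (LinearMap.rTensor M (QuasiBialgebra.comul (k := k) (H := H)).toLinearMap ∘ₗ lam)
            (rmulFst (H ⊗[k] H) M) t m)) =
      TensorProduct.assoc k N P M (coactTwist (σ ⊠ τ) lam
        (tensorAct ρ (tensorAct σ τ) t (m ⊗ₜ[k] (n ⊗ₜ[k] p)))) := by
  induction t with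
  | zero => simp
  | add s t hs ht => simp only [map_add, LinearMap.add_apply, hs, ht]
  | tmul a bc =>
    induction bc with
    | zero => simp
    | add s t hs ht => simp only [map_add, LinearMap.add_apply, TensorProduct.tmul_add, hs, ht]
    | tmul b c =>
      rw [sandwich_tmul, tensorAct_tmul, tensorAct_tmul, coactTwist_tmul]
      simp only [LinearMap.comp_apply, AlgHom.toLinearMap_apply]
      induction lam (ρ a m) with
      | zero => simp
      | add s t hs ht => simp only [map_add, hs, ht]
      | tmul x m =>
        rw [LinearMap.rTensor_tmul, rmulFst_tmul, applyFst_tmul, diagAct_def]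
        simp only [AlgHom.toLinearMap_apply]
        induction QuasiBialgebra.comul (k := k) x with
        | zero => simp
        | add s t hs ht =>
          simp only [map_add, add_mul, TensorProduct.add_tmul, LinearMap.add_apply, hs, ht]
        | tmul x y => simp [applyFstSnd, applyFst]

theorem applyFstSnd_tensorAct (n : N) (p : P) (t : H ⊗[k] (H ⊗[k] H)) (z : H ⊗[k] (H ⊗[k] M)) :
    applyFstSnd M σ τ n p (tensorAct (Algebra.lmul k H) (tensorAct (Algebra.lmul k H) ρ) t z) =
      tensorAct σ (tensorAct τ ρ) t (applyFstSnd M σ τ n p z) :=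
  map_tensorAct _ _ (fun b m => by simp) (fun b m => applyFst_tensorAct _ _ _ _ _) _ _

/-- The hexagon identity for the half-braiding of a coassociative coaction. -/
theorem braid_hexagon (h : IsCoassociative ρ lam) (x : (M ⊗[k] N) ⊗[k] P) :
    assocH σ τ ρ (braid hc (σ ⊠ τ) (assocH ρ σ τ x)) =
      whL σ (braid hc τ) (assocH σ ρ τ (whR τ (braid hc σ) x)) := by
  induction x with
  | zero => simp
  | add x y hx hy => simp only [map_add, hx, hy]
  | tmul y p =>
    induction y with
    | zero => simp
    | add x y hx hy => simp only [TensorProduct.add_tmul, map_add, hx, hy]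
    | tmul m n =>
      have := congrArg (applyFstSnd M σ τ n p) (h m)
      rw [applyFstSnd_sandwich, applyFstSnd_tensorAct, applyFstSnd_assoc_sandwich] at this
      rw [whR_tmul, braid_tmul]
      rw [reassocL, AlgEquiv.apply_symm_apply] at this
      exact this.symm

theorem isCoassociative_of_hexagon
    (h : ∀ x : (M ⊗[k] H) ⊗[k] H,
      assocH (Algebra.lmul k H) (Algebra.lmul k H) ρ
        (braid hc (Algebra.lmul k H ⊠ Algebra.lmul k H)
          (assocH ρ (Algebra.lmul k H) (Algebra.lmul k H) x)) =
      whL (Algebra.lmul k H) (braid hc (Algebra.lmul k H))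
        (assocH (Algebra.lmul k H) ρ (Algebra.lmul k H)
          (whR (Algebra.lmul k H) (braid hc (Algebra.lmul k H)) x))) :
    IsCoassociative ρ lam := fun m => by
  -- Evaluation at `1 ⊗ 1` in two copies of the regular module recovers the law in `H ⊗ (H ⊗ M)`.
  have := h ((m ⊗ₜ[k] 1) ⊗ₜ[k] 1)
  rw [whR_tmul, braid_tmul] at this
  refine (applyFstSnd_one _).symm.trans (Eq.trans ?_ (applyFstSnd_one _))
  rw [applyFstSnd_sandwich, applyFstSnd_tensorAct, applyFstSnd_assoc_sandwich, reassocL,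
    AlgEquiv.apply_symm_apply]
  exact this.symm

theorem braid_invariant {u : N} (hu : IsInvariant σ u)
    (h : ∀ m : M, TensorProduct.lid k M
      (LinearMap.rTensor M (QuasiBialgebra.counit (k := k) (H := H)).toLinearMap (lam m)) = m)
    (m : M) : braid hc σ (m ⊗ₜ[k] u) = u ⊗ₜ[k] m := by
  rw [braid_tmul]
  conv_rhs => rw [← h m]
  induction lam m with
  | zero => simp
  | add x y hx hy => simp only [TensorProduct.tmul_add, map_add, hx, hy]
  | tmul x m => simp [applyFst_tmul, hu x, TensorProduct.smul_tmul]

end Braid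

end QuasiHopf

namespace QuasiHopf

/-! ### Whiskered identities -/

section Whisker

variable {k H : Type*} [Field k] [Ring H] [Algebra k H] [QuasiBialgebra k H]
variable {M N P Q M' N' P' : Type*} [AddCommGroup M] [Module k M] [AddCommGroup N] [Module k N]
  [AddCommGroup P] [Module k P] [AddCommGroup Q] [Module k Q]
  [AddCommGroup M'] [Module k M'] [AddCommGroup N'] [Module k N'] [AddCommGroup P'] [Module k P']
variable {ρ : H →ₐ[k] Module.End k M} {σ : H →ₐ[k] Module.End k N} {τ : H →ₐ[k] Module.End k P}
  {υ : H →ₐ[k] Module.End k Q}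
  {ρ' : H →ₐ[k] Module.End k M'} {σ' : H →ₐ[k] Module.End k N'} {τ' : H →ₐ[k] Module.End k P'}

theorem whL_comp (f : HHom σ τ) (g : HHom σ' σ) (x : M ⊗[k] N') :
    whL ρ (f.comp g) x = whL ρ f (whL ρ g x) := (whL_comp_apply f g x).symm

theorem whR_comp (f : HHom σ τ) (g : HHom σ' σ) (x : N' ⊗[k] M) :
    whR ρ (f.comp g) x = whR ρ f (whR ρ g x) := (whR_comp_apply f g x).symm

/-- Commuting squares can be whiskered. -/
theorem whL_square {f : HHom σ τ} {g : HHom ρ σ} {f' : HHom σ' τ} {g' : HHom ρ σ'}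
    (h : ∀ s, f (g s) = f' (g' s)) (t : Q ⊗[k] M) :
    whL υ f (whL υ g t) = whL υ f' (whL υ g' t) := by
  rw [whL_comp_apply, whL_comp_apply]; exact whL_congr h t

theorem whR_square {f : HHom σ τ} {g : HHom ρ σ} {f' : HHom σ' τ} {g' : HHom ρ σ'}
    (h : ∀ s, f (g s) = f' (g' s)) (t : M ⊗[k] Q) :
    whR υ f (whR υ g t) = whR υ f' (whR υ g' t) := by
  rw [whR_comp_apply, whR_comp_apply]; exact whR_congr h t

@[simp] theorem whL_assocH_assocInvH (x : Q ⊗[k] (M ⊗[k] (N ⊗[k] P))) :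
    whL υ (assocH ρ σ τ) (whL υ (assocInvH ρ σ τ) x) = x := by
  rw [whL_comp_apply, whL_congr (g := ⟨LinearMap.id, fun _ _ => rfl⟩)
    (fun s => assocH_assocInvH ρ σ τ s)]
  exact DFunLike.congr_fun (LinearMap.lTensor_id _ _) x

@[simp] theorem whL_assocInvH_assocH (x : Q ⊗[k] ((M ⊗[k] N) ⊗[k] P)) :
    whL υ (assocInvH ρ σ τ) (whL υ (assocH ρ σ τ) x) = x := by
  rw [whL_comp_apply, whL_congr (g := ⟨LinearMap.id, fun _ _ => rfl⟩)
    (fun s => assocInvH_assocH ρ σ τ s)]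
  exact DFunLike.congr_fun (LinearMap.lTensor_id _ _) x

@[simp] theorem whR_assocH_assocInvH (x : (M ⊗[k] (N ⊗[k] P)) ⊗[k] Q) :
    whR υ (assocH ρ σ τ) (whR υ (assocInvH ρ σ τ) x) = x := by
  rw [whR_comp_apply, whR_congr (g := ⟨LinearMap.id, fun _ _ => rfl⟩)
    (fun s => assocH_assocInvH ρ σ τ s)]
  exact DFunLike.congr_fun (LinearMap.rTensor_id _ _) x

variable (ρ σ τ υ) in
theorem assocH_surj (x : M ⊗[k] (N ⊗[k] P)) : ∃ y, assocH ρ σ τ y = x :=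
  ⟨_, assocH_assocInvH ρ σ τ x⟩

variable (ρ σ τ υ) in
theorem whR_assocH_surj (x : (M ⊗[k] (N ⊗[k] P)) ⊗[k] Q) : ∃ y, whR υ (assocH ρ σ τ) y = x :=
  ⟨_, whR_assocH_assocInvH x⟩

end Whisker

/-! ### The half-braiding on towers `M ⊗ (U ⊗ X) → U ⊗ (M ⊗ X)` -/

section Tower

variable {k H : Type*} [Field k] [Ring H] [Algebra k H] [QuasiBialgebra k H]
variable {M N P Q N' P' : Type*} [AddCommGroup M] [Module k M] [AddCommGroup N] [Module k N]
  [AddCommGroup P] [Module k P] [AddCommGroup Q] [Module k Q]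
  [AddCommGroup N'] [Module k N'] [AddCommGroup P'] [Module k P']
variable {ρ : H →ₐ[k] Module.End k M} {lam : M →ₗ[k] H ⊗[k] M} (hc : IsCompatible ρ lam)

/-- The half-braiding `M ⊗ (U ⊗ X) → U ⊗ (M ⊗ X)`. -/
def tb (σ : H →ₐ[k] Module.End k N) (τ : H →ₐ[k] Module.End k P) :
    HHom (ρ ⊠ (σ ⊠ τ)) (σ ⊠ (ρ ⊠ τ)) :=
  (assocH σ ρ τ).comp ((whR τ (braid hc σ)).comp (assocInvH ρ σ τ))

variable {σ : H →ₐ[k] Module.End k N} {τ : H →ₐ[k] Module.End k P} {υ : H →ₐ[k] Module.End k Q}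
  {σ' : H →ₐ[k] Module.End k N'} {τ' : H →ₐ[k] Module.End k P'}

theorem tb_apply (x : M ⊗[k] (N ⊗[k] P)) :
    tb hc σ τ x = assocH σ ρ τ (whR τ (braid hc σ) (assocInvH ρ σ τ x)) := rfl

theorem tb_assocH (x : (M ⊗[k] N) ⊗[k] P) :
    tb hc σ τ (assocH ρ σ τ x) = assocH σ ρ τ (whR τ (braid hc σ) x) := by
  rw [tb_apply, assocInvH_assocH]

theorem tb_whL (f : HHom τ τ') (x : M ⊗[k] (N ⊗[k] P)) :
    tb hc σ τ' (whL ρ (whL σ f) x) = whL σ (whL ρ f) (tb hc σ τ x) := by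
  rw [tb_apply, tb_apply, whL_assocH, whL_assocInvH, whL_whR]

theorem tb_whR (f : HHom σ σ') (x : M ⊗[k] (N ⊗[k] P)) :
    tb hc σ' τ (whL ρ (whR τ f) x) = whR (ρ ⊠ τ) f (tb hc σ τ x) := by
  rw [tb_apply, tb_apply, whR_assocH, whM_assocInvH, whR_square (fun s => braid_whL hc f s)]

/-- Two pentagons and naturality: a half-braiding at the front of a tower ignores how the tail
behind it is bracketed. -/
theorem tb_ext (y : (M ⊗[k] (N ⊗[k] P)) ⊗[k] Q) :
    tb hc σ (τ ⊠ υ) (whL ρ (assocH σ τ υ) (assocH ρ (σ ⊠ τ) υ y)) =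
      whL σ (assocH ρ τ υ) (assocH σ (ρ ⊠ τ) υ (whR υ (tb hc σ τ) y)) := by
  obtain ⟨z, rfl⟩ := whR_assocH_surj ρ σ τ υ y
  rw [← pentagonH, tb_assocH, whR_assocH, pentagonH, whR_square (fun s => tb_assocH hc s)]

/-- The hexagon tensored with a tail. The pentagons absorb the constraints, so that only the one
splitting `N ⊗ P` remains. -/
theorem tb_hexagon (h : IsCoassociative ρ lam) (x : M ⊗[k] ((N ⊗[k] P) ⊗[k] Q)) :
    assocH σ τ (ρ ⊠ υ) (tb hc (σ ⊠ τ) υ x) =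
      whL σ (tb hc τ υ) (tb hc σ (τ ⊠ υ) (whL ρ (assocH σ τ υ) x)) := by
  obtain ⟨y, rfl⟩ := assocH_surj ρ (σ ⊠ τ) υ x
  obtain ⟨z, rfl⟩ := whR_assocH_surj ρ σ τ υ y
  rw [← pentagonH, tb_assocH, tb_assocH, pentagonH, whR_assocH, pentagonH,
    whL_square (fun s => tb_assocH hc s), whM_assocH]
  congr 2
  have := whR_congr (ρ := υ) (f := (assocH σ τ ρ).comp ((braid hc (σ ⊠ τ)).comp (assocH ρ σ τ)))
    (g := (whL σ (braid hc τ)).comp ((assocH σ ρ τ).comp (whR τ (braid hc σ))))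
    (braid_hexagon hc h) z
  simpa only [whR_comp] using this

end Tower

/-! ### Algebras and their left modules -/

section LeftModules

variable {k H : Type*} [Field k] [Ring H] [Algebra k H] [QuasiBialgebra k H]
variable {M N P Q N' P' : Type*} [AddCommGroup M] [Module k M] [AddCommGroup N] [Module k N]
  [AddCommGroup P] [Module k P] [AddCommGroup Q] [Module k Q]
  [AddCommGroup N'] [Module k N'] [AddCommGroup P'] [Module k P']
variable {τ : H →ₐ[k] Module.End k P} {υ : H →ₐ[k] Module.End k Q} {σ : H →ₐ[k] Module.End k N}
  {τ' : H →ₐ[k] Module.End k P'}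

variable {C : ModAlgData k H M}

/-- The multiplication of a module algebra as an `H`-linear map. -/
def mulH (hC : IsModuleAlgebra C) : HHom (C.act ⊠ C.act) C.act :=
  ⟨C.mul, fun h x => by
    induction x with
    | zero => simp
    | add x y hx hy => simp only [map_add, hx, hy]
    | tmul a b => exact (hC.act_mul h a b).symm⟩

theorem mulH_assoc (hC : IsModuleAlgebra C) (x : (M ⊗[k] M) ⊗[k] M) :
    mulH hC (whR C.act (mulH hC) x) =
      mulH hC (whL C.act (mulH hC) (assocH C.act C.act C.act x)) := by
  induction x with
  | zero => simp
  | add x y hx hy => simp only [map_add, hx, hy]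
  | tmul y c =>
    induction y with
    | zero => simp
    | add x y hx hy => simp only [TensorProduct.add_tmul, map_add, hx, hy]
    | tmul a b => exact hC.assoc a b c

variable (C) in
/-- A left module over the module algebra `C` in the category of left `H`-modules. -/
structure LeftMod (hC : IsModuleAlgebra C) (τ : H →ₐ[k] Module.End k P) where
  act : HHom (C.act ⊠ τ) τ
  assoc : ∀ x : (M ⊗[k] M) ⊗[k] P,
    act (whR τ (mulH hC) x) = act (whL C.act act (assocH C.act C.act τ x))
  one_act : ∀ x : P, act (C.one ⊗ₜ[k] x) = x

variable (hC : IsModuleAlgebra C)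

/-- The regular left module. -/
def LeftMod.regular : LeftMod C hC C.act := ⟨mulH hC, mulH_assoc hC, hC.one_mul⟩

variable {hC}

theorem whR_assocH_assocInvH_eq {M₁ : Type*} [AddCommGroup M₁] [Module k M₁]
    {ρ : H →ₐ[k] Module.End k M₁} (x : (M₁ ⊗[k] N) ⊗[k] (P ⊗[k] Q)) :
    whR υ (assocH ρ σ τ) (assocInvH (ρ ⊠ σ) τ υ x) =
      assocInvH ρ (σ ⊠ τ) υ (whL ρ (assocInvH σ τ υ) (assocH ρ σ (τ ⊠ υ) x)) := by
  obtain ⟨z, rfl⟩ := assocH_surj (ρ ⊠ σ) τ υ x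
  rw [pentagonH, whL_assocInvH_assocH, assocInvH_assocH, assocInvH_assocH]

variable (υ) in
/-- The left module structure on `Y ⊗ X` for a left module `Y`. -/
def LeftMod.ext (m : LeftMod C hC τ) : LeftMod C hC (τ ⊠ υ) where
  act := (whR υ m.act).comp (assocInvH C.act τ υ)
  assoc x := by
    have := whR_congr (ρ := υ) (f := (m.act).comp (whR τ (mulH hC)))
      (g := m.act.comp ((whL C.act m.act).comp (assocH C.act C.act τ))) m.assoc
      (assocInvH (C.act ⊠ C.act) τ υ x)
    simp only [whR_comp] at this
    simp only [HHom.comp_apply, whL_comp]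
    rw [whR_assocInvH, this, whM_assocInvH, whR_assocH_assocInvH_eq]
  one_act x := by
    have h1 : IsInvariant C.act C.one := hC.act_one
    induction x with
    | zero => simp
    | add x y hx hy => simp only [TensorProduct.tmul_add, map_add, hx, hy]
    | tmul x y =>
      rw [HHom.comp_apply, assocInvH_invariant_left h1, whR_tmul, m.one_act]

theorem LeftMod.ext_act_apply (m : LeftMod C hC τ) (x) :
    (m.ext υ).act x = whR υ m.act (assocInvH C.act τ υ x) := rfl

theorem LeftMod.ext_whL {σ' : H →ₐ[k] Module.End k N'} (m : LeftMod C hC τ) (f : HHom υ σ')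
    (x : M ⊗[k] (P ⊗[k] Q)) :
    (m.ext σ').act (whL C.act (whL τ f) x) = whL τ f ((m.ext υ).act x) := by
  rw [m.ext_act_apply, m.ext_act_apply, whL_assocInvH, whL_whR]

/-- The action touches only the first tensor factor; extending by two modules in turn or by their
tensor product therefore agrees, up to the pentagon. -/
theorem LeftMod.ext_ext (m : LeftMod C hC τ) (y : (M ⊗[k] (P ⊗[k] Q)) ⊗[k] N) :
    (m.ext (υ ⊠ σ)).act (whL C.act (assocH τ υ σ) (assocH C.act (τ ⊠ υ) σ y)) =
      assocH τ υ σ (whR σ (m.ext υ).act y) := by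
  obtain ⟨z, rfl⟩ := whR_assocH_surj C.act τ υ σ y
  rw [← pentagonH, m.ext_act_apply, assocInvH_assocH, whR_assocH]
  congr 1
  rw [whR_comp_apply]
  exact whR_congr
    (fun s => by rw [HHom.comp_apply, m.ext_act_apply, assocInvH_assocH]) z

/-- The multiplication `C ⊗ (C ⊗ X) → C ⊗ X`. -/
def mulX (hC : IsModuleAlgebra C) (τ : H →ₐ[k] Module.End k P) : HHom (C.act ⊠ (C.act ⊠ τ)) (C.act ⊠ τ) := ((LeftMod.regular hC).ext τ).act

theorem mulX_apply (x : M ⊗[k] (M ⊗[k] P)) :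
    mulX hC τ x = whR τ (mulH hC) (assocInvH C.act C.act τ x) := rfl

theorem mulX_assoc (x : M ⊗[k] (M ⊗[k] (M ⊗[k] P))) :
    mulX hC τ (mulX hC (C.act ⊠ τ) x) = mulX hC τ (whL C.act (mulX hC τ) x) := by
  have := ((LeftMod.regular hC).ext τ).assoc (assocInvH C.act C.act (C.act ⊠ τ) x)
  rwa [assocH_assocInvH] at this

theorem mulX_whL (f : HHom τ τ') (x : M ⊗[k] (M ⊗[k] P)) :
    mulX hC τ' (whL C.act (whL C.act f) x) = whL C.act f (mulX hC τ x) :=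
  LeftMod.ext_whL _ _ _

theorem mulX_ext (y : (M ⊗[k] (M ⊗[k] Q)) ⊗[k] N) :
    mulX hC (υ ⊠ σ) (whL C.act (assocH C.act υ σ) (assocH C.act (C.act ⊠ υ) σ y)) =
      assocH C.act υ σ (whR σ (mulX hC υ) y) :=
  LeftMod.ext_ext _ _

/-- An action of an algebra on `X` is linear over the algebra. -/
theorem LeftMod.act_mulX (m : LeftMod C hC τ) (x : M ⊗[k] (M ⊗[k] P)) :
    m.act (mulX hC τ x) = m.act (whL C.act m.act x) := by
  rw [mulX_apply, m.assoc, assocH_assocInvH]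

/-- The hexagon splits the passage of `C ⊗ C`, and naturality applies to the product because it is
`H`-linear. No coaction on `C` is involved, which is why `C` can be a mere module algebra. -/
theorem tb_mulX {ρ : H →ₐ[k] Module.End k N} {lam : N →ₗ[k] H ⊗[k] N} (hc : IsCompatible ρ lam)
    (h : IsCoassociative ρ lam) (x : N ⊗[k] (M ⊗[k] (M ⊗[k] P))) :
    tb hc C.act τ (whL ρ (mulX hC τ) x) =
      mulX hC (ρ ⊠ τ) (whL C.act (tb hc C.act τ) (tb hc C.act (C.act ⊠ τ) x)) := by
  obtain ⟨y, rfl⟩ : ∃ y, whL ρ (assocH C.act C.act τ) y = x := ⟨_, whL_assocH_assocInvH x⟩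
  rw [← tb_hexagon hc h, mulX_apply, assocInvH_assocH, ← tb_whR]
  congr 1
  rw [whL_comp_apply]
  exact whL_congr (fun s => by rw [HHom.comp_apply, mulX_apply, assocInvH_assocH]) y

end LeftModules

end QuasiHopf

namespace QuasiHopf

/-! ### Tensor products of Yetter–Drinfeld modules -/

section TensorYD

variable {k H : Type*} [Field k] [Ring H] [Algebra k H] [QuasiBialgebra k H]
variable {M N P Q : Type*} [AddCommGroup M] [Module k M] [AddCommGroup N] [Module k N]
  [AddCommGroup P] [Module k P] [AddCommGroup Q] [Module k Q]
variable {ρ : H →ₐ[k] Module.End k M} {lam : M →ₗ[k] H ⊗[k] M} (hc : IsCompatible ρ lam)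
  {σ : H →ₐ[k] Module.End k N} {mu : N →ₗ[k] H ⊗[k] N} (hd : IsCompatible σ mu)
  {υ : H →ₐ[k] Module.End k P} {ξ : H →ₐ[k] Module.End k Q}

/-- A product in `H` acts as a composite. Multiplying the two coaction legs thus means applying the
half-braiding of `N` first and that of `M` second. -/
theorem applyFst_mul_lam (u : P) (w : M ⊗[k] (H ⊗[k] N)) :
    applyFst (M ⊗[k] N) υ u (LinearMap.rTensor (M ⊗[k] N) (LinearMap.mul' k H)
      (TensorProduct.tensorTensorTensorComm k H M H N (LinearMap.rTensor (H ⊗[k] N) lam w))) =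
    TensorProduct.assoc k P M N (LinearMap.rTensor N (coactTwist υ lam)
      ((TensorProduct.assoc k M P N).symm (LinearMap.lTensor M (applyFst N υ u) w))) := by
  induction w with
  | zero => simp
  | add x y hx hy => simp only [map_add, hx, hy]
  | tmul m z =>
    induction z with
    | zero => simp
    | add x y hx hy => simp only [TensorProduct.tmul_add, map_add, hx, hy]
    | tmul y n =>
      simp only [LinearMap.rTensor_tmul, LinearMap.lTensor_tmul, applyFst_tmul,
        TensorProduct.assoc_symm_tmul, coactTwist_tmul]
      induction lam m with
      | zero => simp
      | add x y hx hy => simp only [TensorProduct.add_tmul, map_add, hx, hy]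
      | tmul x m => simp [applyFst_tmul]

theorem lTensor_applyFst_sandwich (u : P) (t : (H ⊗[k] H) ⊗[k] H) (m : M) (n : N) :
    LinearMap.lTensor M (applyFst N υ u)
      (sandwich (tensorAct ρ σ).toLinearMap (LinearMap.lTensor M mu)
        (LinearMap.lTensorHom M ∘ₗ rmulFst H N) t (m ⊗ₜ[k] n)) =
    LinearMap.lTensor M (coactTwist υ mu) (tensorAct ρ (tensorAct σ υ)
      (Algebra.TensorProduct.assoc k k k H H H t) (m ⊗ₜ[k] (n ⊗ₜ[k] u))) := by
  induction t with
  | zero => simp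
  | add s t hs ht => simp only [map_add, LinearMap.add_apply, hs, ht]
  | tmul ab c =>
    induction ab with
    | zero => simp
    | add s t hs ht => simp only [map_add, LinearMap.add_apply, TensorProduct.add_tmul, hs, ht]
    | tmul a b => simp [sandwich_tmul, applyFst_rmulFst, coactTwist_tmul]

/-- The half-braiding of a tensor product is the composite of the half-braidings. -/
theorem coactTwist_tensorCoact (x : (M ⊗[k] N) ⊗[k] P) :
    coactTwist υ (tensorCoact ρ lam σ mu) x =
      tb hc υ σ (whL ρ (braid hd υ) (assocH ρ σ υ x)) := by
  induction x with
  | zero => simp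
  | add x y hx hy => simp only [map_add, hx, hy]
  | tmul y u =>
    induction y with
    | zero => simp
    | add x y hx hy => simp only [TensorProduct.add_tmul, map_add, hx, hy]
    | tmul m n =>
      rw [coactTwist_tmul, tensorCoact]
      simp only [LinearMap.comp_apply]
      rw [applyFst_tensorAct]
      change tensorAct υ (tensorAct ρ σ) (reassoc k H) (applyFst (M ⊗[k] N) υ u
        (LinearMap.rTensor (M ⊗[k] N) (LinearMap.mul' k H)
      (TensorProduct.tensorTensorTensorComm k H M H N (LinearMap.rTensor (H ⊗[k] N) lam _)))) = _
      rw [applyFst_mul_lam]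
      have applyFst_trivAct := map_tensorAct (ρ := ρ) (ρ' := ρ) (σ := tensorAct (Algebra.lmul k H) σ)
        (σ' := tensorAct υ σ) LinearMap.id (applyFst N υ u) (fun _ _ => rfl)
        (fun b m => applyFst_tensorAct _ _ _ _ _) (reassocInv k H)
        (sandwich (tensorAct ρ σ).toLinearMap (LinearMap.lTensor M mu)
          (LinearMap.lTensorHom M ∘ₗ rmulFst H N) (reassocL k H) (m ⊗ₜ[k] n))
      change LinearMap.lTensor M (applyFst N υ u) _ =
        tensorAct ρ (tensorAct υ σ) _ (LinearMap.lTensor M (applyFst N υ u) _) at applyFst_trivAct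
      rw [applyFst_trivAct, lTensor_applyFst_sandwich, reassocL, AlgEquiv.apply_symm_apply]
      rfl

/-- The tensor product coaction is compatible with the diagonal action. -/
theorem isCompatible_tensorCoact (hc : IsCompatible ρ lam) (hd : IsCompatible σ mu) :
    IsCompatible (ρ ⊠ σ) (tensorCoact ρ lam σ mu) :=
  isCompatible_of_coactTwist fun h x => by
    rw [coactTwist_tensorCoact hc hd, coactTwist_tensorCoact hc hd, HHom.map_act, HHom.map_act,
      HHom.map_act]

theorem braid_tensor (ht : IsCompatible (ρ ⊠ σ) (tensorCoact ρ lam σ mu))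
    (x : (M ⊗[k] N) ⊗[k] P) :
    braid ht υ x = tb hc υ σ (whL ρ (braid hd υ) (assocH ρ σ υ x)) :=
  coactTwist_tensorCoact hc hd x

/-- `braid_tensor` with a tail attached. It is dual to `tb_hexagon`: here the moving object is a
tensor product, there the object being passed. -/
theorem tb_tensor (ht : IsCompatible (ρ ⊠ σ) (tensorCoact ρ lam σ mu))
    (x : (M ⊗[k] N) ⊗[k] (P ⊗[k] Q)) :
    whL υ (assocH ρ σ ξ) (tb ht υ ξ x) =
      tb hc υ (σ ⊠ ξ) (whL ρ (tb hd υ ξ) (assocH ρ σ (υ ⊠ ξ) x)) := by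
  obtain ⟨y, rfl⟩ := assocH_surj (ρ ⊠ σ) υ ξ x
  have := whR_congr (ρ := ξ) (f := braid ht υ)
    (g := (tb hc υ σ).comp ((whL ρ (braid hd υ)).comp (assocH ρ σ υ))) (braid_tensor hc hd ht) y
  rw [tb_assocH, this, whR_comp, whR_comp, ← tb_ext, ← whM_assocH, pentagonH,
    whL_square (fun s => tb_assocH hd s)]

/-- The braid relation. -/
theorem tb_tb_tb (h : IsCoassociative σ mu) (x : N ⊗[k] (M ⊗[k] (P ⊗[k] Q))) :
    whL υ (tb hd ρ ξ) (tb hd υ (ρ ⊠ ξ) (whL σ (tb hc υ ξ) x)) =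
      tb hc υ (σ ⊠ ξ) (whL ρ (tb hd υ ξ) (tb hd ρ (υ ⊠ ξ) x)) := by
  obtain ⟨y, rfl⟩ : ∃ y, whL σ (assocH ρ υ ξ) y = x := ⟨_, whL_assocH_assocInvH x⟩
  -- By the hexagon, `N` passes `M ⊗ P` and `P ⊗ M` in one go; the braid relation is then naturality
  -- of the half-braiding of `N` with respect to the `H`-linear map `M ⊗ P → P ⊗ M`.
  rw [whL_square (fun s => tb_assocH hc s), ← tb_hexagon hd h, ← tb_hexagon hd h, tb_assocH,
    ← tb_whR]

theorem braid_hexagon_tb (h : IsCoassociative ρ lam) (x : M ⊗[k] (P ⊗[k] Q)) :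
    assocH υ ξ ρ (braid hc (υ ⊠ ξ) x) = whL υ (braid hc ξ) (tb hc υ ξ x) := by
  obtain ⟨y, rfl⟩ := assocH_surj ρ υ ξ x
  rw [tb_assocH, braid_hexagon hc h]

theorem isCoassociative_tensorCoact (h : IsCoassociative ρ lam) (h' : IsCoassociative σ mu)
    (hc : IsCompatible ρ lam) (hd : IsCompatible σ mu) :
    IsCoassociative (ρ ⊠ σ) (tensorCoact ρ lam σ mu) := by
  have ht := isCompatible_tensorCoact hc hd
  refine isCoassociative_of_hexagon ht fun x => ?_
  -- The hexagon is needed only on the regular module, but the argument works for an arbitrary one.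
  generalize Algebra.lmul k H = ν
  have e1 := whL_congr (ρ := ν) (f := braid ht ν)
    (g := (tb hc ν σ).comp ((whL ρ (braid hd ν)).comp (assocH ρ σ ν))) (braid_tensor hc hd ht)
    (tb ht ν ν (assocH (ρ ⊠ σ) ν ν x))
  rw [← tb_assocH, e1, whL_comp, whL_comp, tb_tensor hc hd, ← tb_whL, braid_tensor hc hd,
    tb_hexagon hc h, whL_square (fun s => braid_hexagon_tb hd h' s)]

/-- The counit law of a coaction. -/
def IsCounital (lam : M →ₗ[k] H ⊗[k] M) : Prop :=
  ∀ m : M, TensorProduct.lid k M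
    (LinearMap.rTensor M (QuasiBialgebra.counit (k := k) (H := H)).toLinearMap (lam m)) = m

variable (k H) in
/-- The trivial action on `k`. -/
def trivAct : H →ₐ[k] Module.End k k := (Algebra.lmul k k).comp QuasiBialgebra.counit

theorem isInvariant_trivAct : IsInvariant (trivAct k H) (1 : k) := fun h => by
  simp [trivAct]

theorem applyFst_trivAct (z : H ⊗[k] M) : applyFst M (trivAct k H) (1 : k) z =
    (1 : k) ⊗ₜ[k] TensorProduct.lid k M
      (LinearMap.rTensor M (QuasiBialgebra.counit (k := k) (H := H)).toLinearMap z) := by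
  induction z with
  | zero => simp
  | add x y hx hy => simp only [TensorProduct.tmul_add, map_add, hx, hy]
  | tmul x y => simp [applyFst_tmul, trivAct, TensorProduct.smul_tmul']

theorem tb_invariant_mid (h : IsCounital lam) {u : P} (hu : IsInvariant υ u) (m : M) (n : Q) :
    tb hc υ ξ (m ⊗ₜ[k] (u ⊗ₜ[k] n)) = u ⊗ₜ[k] (m ⊗ₜ[k] n) := by
  rw [tb_apply, assocInvH_invariant_mid hu, whR_tmul, braid_invariant hc hu h,
    assocH_invariant_left hu]

theorem isCounital_tensorCoact (h : IsCounital lam) (h' : IsCounital mu)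
    (hc : IsCompatible ρ lam) (hd : IsCompatible σ mu) :
    IsCounital (tensorCoact ρ lam σ mu) := by
  have ht := isCompatible_tensorCoact hc hd
  have h1 := isInvariant_trivAct (k := k) (H := H)
  intro x
  -- The counit law is the triviality of the half-braiding with the unit object `k`, a property that
  -- passes to composites.
  have : braid ht (trivAct k H) (x ⊗ₜ[k] (1 : k)) = (1 : k) ⊗ₜ[k] x := by
    induction x with
    | zero => simp
    | add x y hx hy => simp only [TensorProduct.add_tmul, TensorProduct.tmul_add, map_add, hx, hy]
    | tmul m n =>
      rw [braid_tensor hc hd, assocH_invariant_right h1, whL_tmul, braid_invariant hd h1 h',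
        tb_invariant_mid hc h h1]
  rw [braid_tmul, applyFst_trivAct] at this
  simpa using congrArg (TensorProduct.lid k _) this

theorem isYetterDrinfeldModule_tensorCoact (h : IsYetterDrinfeldModule ρ lam)
    (h' : IsYetterDrinfeldModule σ mu) :
    IsYetterDrinfeldModule (ρ ⊠ σ) (tensorCoact ρ lam σ mu) :=
  ⟨isCoassociative_tensorCoact h.coassoc h'.coassoc h.compat h'.compat,
    isCounital_tensorCoact h.counit h'.counit h.compat h'.compat,
    isCompatible_tensorCoact h.compat h'.compat⟩

end TensorYD

/-! ### Algebras in the Yetter–Drinfeld category -/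

section YDAlg

variable {k H : Type*} [Field k] [Ring H] [Algebra k H] [QuasiBialgebra k H]
variable {M N P Q : Type*} [AddCommGroup M] [Module k M] [AddCommGroup N] [Module k N]
  [AddCommGroup P] [Module k P] [AddCommGroup Q] [Module k Q]
variable {A : YDAlgData k H M} (hA : IsYetterDrinfeldAlgebra A)
  {υ : H →ₐ[k] Module.End k P} {ξ : H →ₐ[k] Module.End k Q}

theorem IsYetterDrinfeldAlgebra.compat (hA : IsYetterDrinfeldAlgebra A) :
    IsCompatible A.act A.coact := hA.isYetterDrinfeldModule.compat

theorem IsYetterDrinfeldAlgebra.coassoc (hA : IsYetterDrinfeldAlgebra A) :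
    IsCoassociative A.act A.coact := hA.isYetterDrinfeldModule.coassoc

theorem IsYetterDrinfeldAlgebra.counit (hA : IsYetterDrinfeldAlgebra A) :
    IsCounital A.coact := hA.isYetterDrinfeldModule.counit

theorem IsYetterDrinfeldAlgebra.isInvariant_one (hA : IsYetterDrinfeldAlgebra A) :
    IsInvariant A.act A.one := hA.isModuleAlgebra.act_one

theorem applyFst_lTensor {M' : Type*} [AddCommGroup M'] [Module k M'] (f : M →ₗ[k] M') (u : P)
    (z : H ⊗[k] M) :
    applyFst M' υ u (LinearMap.lTensor H f z) = LinearMap.lTensor P f (applyFst M υ u z) := by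
  induction z with
  | zero => simp
  | add x y hx hy => simp only [map_add, hx, hy]
  | tmul x m => simp [applyFst_tmul]

/-- The half-braiding is compatible with the multiplication. -/
theorem braid_mulH (x : (M ⊗[k] M) ⊗[k] P) :
    braid hA.compat υ (whR υ (mulH hA.isModuleAlgebra) x) =
      whL υ (mulH hA.isModuleAlgebra) (tb hA.compat υ A.act
        (whL A.act (braid hA.compat υ) (assocH A.act A.act υ x))) := by
  rw [← braid_tensor hA.compat hA.compat (isCompatible_tensorCoact hA.compat hA.compat)]
  induction x with
  | zero => simp
  | add x y hx hy => simp only [map_add, hx, hy]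
  | tmul y u =>
    rw [whR_tmul, braid_tmul, braid_tmul]
    induction y with
    | zero => simp
    | add x y hx hy =>
      simp only [map_add, hx, hy]
    | tmul a b =>
      have : A.coact (mulH hA.isModuleAlgebra (a ⊗ₜ[k] b)) = _ := hA.coact_mul a b
      rw [this, applyFst_lTensor]
      rfl

/-- Here the product is formed in the object that moves, so it is multiplicativity of the coaction
that counts, not naturality as in `tb_mulX`. -/
theorem tb_mulX_self (x : M ⊗[k] (M ⊗[k] (P ⊗[k] Q))) :
    tb hA.compat υ ξ (mulX hA.isModuleAlgebra (υ ⊠ ξ) x) =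
      whL υ (mulX hA.isModuleAlgebra ξ) (tb hA.compat υ (A.act ⊠ ξ)
        (whL A.act (tb hA.compat υ ξ) x)) := by
  obtain ⟨y, rfl⟩ := assocH_surj A.act A.act (υ ⊠ ξ) x
  obtain ⟨z, rfl⟩ := assocH_surj (A.act ⊠ A.act) υ ξ y
  have e1 := whR_congr (ρ := ξ) (f := (braid hA.compat υ).comp (whR υ (mulH hA.isModuleAlgebra)))
    (g := (whL υ (mulH hA.isModuleAlgebra)).comp ((tb hA.compat υ A.act).comp
      ((whL A.act (braid hA.compat υ)).comp (assocH A.act A.act υ))))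
    (braid_mulH hA) z
  simp only [whR_comp] at e1
  rw [mulX_apply, assocInvH_assocH, whR_assocH, tb_assocH, e1, ← whM_assocH]
  have e2 : ∀ s, whL υ (mulX hA.isModuleAlgebra ξ) (whL υ (assocH A.act A.act ξ) s) =
      whL υ (whR ξ (mulH hA.isModuleAlgebra)) s := fun s => by
    rw [whL_comp_apply]
    exact whL_congr (fun s => by rw [HHom.comp_apply, mulX_apply, assocInvH_assocH]) s
  rw [← e2, ← tb_ext, ← whM_assocH, pentagonH, whL_square (fun s => tb_assocH hA.compat s)]

theorem braid_one (u : P) : braid hA.compat υ (A.one ⊗ₜ[k] u) = u ⊗ₜ[k] A.one := by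
  rw [braid_tmul, hA.coact_one, applyFst_tmul, map_one]; rfl

theorem tb_one (u : P) (v : Q) :
    tb hA.compat υ ξ (A.one ⊗ₜ[k] (u ⊗ₜ[k] v)) = u ⊗ₜ[k] (A.one ⊗ₜ[k] v) := by
  rw [tb_apply, assocInvH_invariant_left hA.isInvariant_one, whR_tmul, braid_one hA,
    assocH_invariant_mid hA.isInvariant_one]

end YDAlg

end QuasiHopf

namespace QuasiHopf

section Squares

variable {k H : Type*} [Field k] [Ring H] [Algebra k H] [QuasiBialgebra k H]
variable {M N P P' P'' Q : Type*} [AddCommGroup M] [Module k M] [AddCommGroup N] [Module k N]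
  [AddCommGroup P] [Module k P] [AddCommGroup Q] [Module k Q]
  [AddCommGroup P'] [Module k P'] [AddCommGroup P''] [Module k P'']
variable {ρ : H →ₐ[k] Module.End k M} {σ : H →ₐ[k] Module.End k N} {τ : H →ₐ[k] Module.End k P}
  {υ : H →ₐ[k] Module.End k Q} {τ' : H →ₐ[k] Module.End k P'} {τ'' : H →ₐ[k] Module.End k P''}

theorem whL_square₃ {f : HHom τ σ} {g : HHom ρ τ} {f' : HHom τ'' σ} {g' : HHom τ' τ''}
    {h' : HHom ρ τ'} (h : ∀ s, f (g s) = f' (g' (h' s))) (t : Q ⊗[k] M) :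
    whL υ f (whL υ g t) = whL υ f' (whL υ g' (whL υ h' t)) := by
  rw [whL_comp_apply, whL_comp_apply, whL_comp_apply]; exact whL_congr h t

end Squares

/-! ### The twisted tensor product of a module algebra and a Yetter–Drinfeld algebra -/

section Diamond

variable {k H : Type*} [Field k] [Ring H] [Algebra k H] [QuasiBialgebra k H]
variable {M N P Q : Type*} [AddCommGroup M] [Module k M] [AddCommGroup N] [Module k N]
  [AddCommGroup P] [Module k P] [AddCommGroup Q] [Module k Q]
variable {C : ModAlgData k H N} (hC : IsModuleAlgebra C)
  {A : YDAlgData k H M} (hA : IsYetterDrinfeldAlgebra A)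
  {τ : H →ₐ[k] Module.End k P} {υ : H →ₐ[k] Module.End k Q}

/-- The action `C ⊗ (A ⊗ (C ⊗ Y)) → C ⊗ Y` for a left `A`-module `Y`. -/
def diaAct (m : LeftMod A.toModAlgData hA.isModuleAlgebra τ) :
    HHom (C.act ⊠ (A.act ⊠ (C.act ⊠ τ))) (C.act ⊠ τ) :=
  (whL C.act m.act).comp ((mulX hC (A.act ⊠ τ)).comp (whL C.act (tb hA.compat C.act τ)))

variable {hA}

theorem diaAct_apply (m : LeftMod A.toModAlgData hA.isModuleAlgebra τ)
    (x : N ⊗[k] (M ⊗[k] (N ⊗[k] P))) :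
    diaAct hC hA m x =
      whL C.act m.act (mulX hC (A.act ⊠ τ) (whL C.act (tb hA.compat C.act τ) x)) := rfl

variable (hA) in
/-- The multiplication of `C ◇ A` as an `H`-linear map. -/
def diaMul : HHom ((C.act ⊠ A.act) ⊠ (C.act ⊠ A.act)) (C.act ⊠ A.act) :=
  (diaAct hC hA (LeftMod.regular hA.isModuleAlgebra)).comp
    (assocH C.act A.act (C.act ⊠ A.act))

variable (hA) in
-- The defining composite is regrouped: its three middle maps form `tb`, and multiplying in `C` can
-- be separated from multiplying in `A`.
theorem diamond_mul_eq : (diamond C A).mul = (diaMul hC hA).toLinearMap := by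
  have e : ∀ y, TensorProduct.map C.mul A.mul y =
      whL C.act (mulH hA.isModuleAlgebra) (whR (A.act ⊠ A.act) (mulH hC) y) := fun y => by
    induction y with
    | zero => simp
    | add x y hx hy => simp only [map_add, hx, hy]
    | tmul a b => rfl
  refine LinearMap.ext fun x => ?_
  rw [HHom.toLinearMap_apply, diaMul, HHom.comp_apply, diaAct_apply, tb, whL_comp, whL_comp]
  exact e _

variable (hA) in
theorem diaMul_apply (x : (N ⊗[k] M) ⊗[k] (N ⊗[k] M)) :
    diaMul hC hA x = whL C.act (mulH hA.isModuleAlgebra) (mulX hC (A.act ⊠ A.act)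
      (whL C.act (tb hA.compat C.act A.act) (assocH C.act A.act (C.act ⊠ A.act) x))) := rfl

/-- No operation in `diaAct` reaches the tail `Q`. Together with `diaAct_diaAct` this reduces
associativity in `C ◇ A` to towers. -/
theorem diaAct_ext (m : LeftMod A.toModAlgData hA.isModuleAlgebra τ)
    (s : (N ⊗[k] (M ⊗[k] (N ⊗[k] P))) ⊗[k] Q) :
    assocH C.act τ υ (whR υ (diaAct hC hA m) s) =
      diaAct hC hA (m.ext υ) (whL C.act (whL A.act (assocH C.act τ υ))
        (whL C.act (assocH A.act (C.act ⊠ τ) υ)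
          (assocH C.act (A.act ⊠ (C.act ⊠ τ)) υ s))) := by
  have e1 := whL_congr (ρ := C.act) (f := (tb hA.compat C.act (τ ⊠ υ)).comp
    ((whL A.act (assocH C.act τ υ)).comp (assocH A.act (C.act ⊠ τ) υ)))
    (g := (whL C.act (assocH A.act τ υ)).comp ((assocH C.act (A.act ⊠ τ) υ).comp
      (whR υ (tb hA.compat C.act τ)))) (tb_ext hA.compat)
    (assocH C.act (A.act ⊠ (C.act ⊠ τ)) υ s)
  simp only [whL_comp] at e1
  have e2 : ∀ s, whL C.act (m.ext υ).act (whL C.act (assocH A.act τ υ) s) =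
      whL C.act (whR υ m.act) s := fun s => by
    rw [whL_comp_apply]
    exact whL_congr (fun s => by rw [HHom.comp_apply, m.ext_act_apply, assocInvH_assocH]) s
  rw [diaAct_apply, e1, whM_assocH, mulX_whL, mulX_ext, e2, whM_assocH, diaAct, whR_comp, whR_comp]

/-- The core of associativity: `C ⊗ Y` behaves as a module over `C ◇ A` for every left `A`-module
`Y`. Both sides are brought to the form in which all half-braidings come first, then the products in
`C`, then the actions of `A`. -/
theorem diaAct_diaAct (m : LeftMod A.toModAlgData hA.isModuleAlgebra τ)
    (x : N ⊗[k] (M ⊗[k] (N ⊗[k] (M ⊗[k] (N ⊗[k] P))))) :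
    diaAct hC hA m (diaAct hC hA
        ((LeftMod.regular hA.isModuleAlgebra).ext (C.act ⊠ τ)) x) =
      diaAct hC hA m (whL C.act (whL A.act (diaAct hC hA m)) x) := by
  have e1 : ∀ y, whL C.act (whL A.act (diaAct hC hA m)) y =
      whL C.act (whL A.act (whL C.act m.act)) (whL C.act (whL A.act (mulX hC (A.act ⊠ τ)))
        (whL C.act (whL A.act (whL C.act (tb hA.compat C.act τ))) y)) := fun y => by
    rw [whL_comp_apply, whL_comp_apply]
    exact whL_congr (fun s => by simp only [HHom.comp_apply, diaAct, whL_comp]) y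
  rw [diaAct_apply, diaAct_apply, diaAct_apply, e1]
  change whL C.act m.act (mulX hC _ (whL C.act (tb hA.compat C.act τ)
    (whL C.act (mulX hA.isModuleAlgebra _) _))) = _
  -- On the left, `A·A` passing `C` splits into two passages; on the right, `A` passing `C·C` does.
  -- The rest is associativity in `C`, associativity of the `A`-action and naturality.
  rw [whL_square₃ (fun s => tb_mulX_self hA s), mulX_whL,
    ← mulX_whL (whL A.act (tb hA.compat C.act τ)), ← mulX_whL (tb hA.compat C.act (A.act ⊠ τ)),
    mulX_assoc,
    whL_square (fun s => (tb_whL hA.compat m.act s)), mulX_whL,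
    whL_square (fun s => (m.act_mulX s).symm),
    whL_square₃ (fun s => tb_mulX hA.compat hA.coassoc s),
    whL_square (fun s => tb_whL hA.compat (tb hA.compat C.act τ) s)]

variable (hA) in
theorem diaMul_assoc (x : ((N ⊗[k] M) ⊗[k] (N ⊗[k] M)) ⊗[k] (N ⊗[k] M)) :
    diaMul hC hA (whR (C.act ⊠ A.act) (diaMul hC hA) x) =
      diaMul hC hA (whL (C.act ⊠ A.act) (diaMul hC hA)
        (assocH (C.act ⊠ A.act) (C.act ⊠ A.act) (C.act ⊠ A.act) x)) := by
  rw [diaMul, whR_comp, HHom.comp_apply, diaAct_ext, ← pentagonH, whL_comp,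
    HHom.comp_apply, diaAct_diaAct, whL_assocH, whL_assocH]

/-- `C ◇ A` is a module algebra. -/
theorem isModuleAlgebra_diamond (hC : IsModuleAlgebra C) (hA : IsYetterDrinfeldAlgebra A) :
    IsModuleAlgebra (diamond C A) := by
  have hC1 : IsInvariant C.act C.one := hC.act_one
  have hA1 := hA.isInvariant_one
  have h1 : IsInvariant (C.act ⊠ A.act) (C.one ⊗ₜ[k] A.one) := hC1.tmul hA1
  refine ⟨fun a b c => ?_, fun x => ?_, fun x => ?_, fun h a b => ?_, h1⟩
  · rw [diamond_mul_eq hC hA]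
    exact diaMul_assoc hC hA ((a ⊗ₜ[k] b) ⊗ₜ[k] c)
  · rw [diamond_mul_eq hC hA]
    induction x with
    | zero => simp
    | add x y hx hy => simp only [TensorProduct.tmul_add, map_add, hx, hy]
    | tmul c a =>
      change diaMul hC hA ((C.one ⊗ₜ[k] A.one) ⊗ₜ[k] _) = _
      rw [diaMul_apply, assocH_invariant_left hC1, whL_tmul, tb_one hA, mulX,
        LeftMod.one_act, whL_tmul]
      congr 1
      exact hA.isModuleAlgebra.one_mul a
  · rw [diamond_mul_eq hC hA]
    induction x with
    | zero => simp
    | add x y hx hy => simp only [TensorProduct.add_tmul, map_add, hx, hy]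
    | tmul c a =>
      change diaMul hC hA (_ ⊗ₜ[k] (C.one ⊗ₜ[k] A.one)) = _
      rw [diaMul_apply, assocH_invariant_right h1, whL_tmul,
        tb_invariant_mid hA.compat hA.counit hC1, mulX_apply, assocInvH_invariant_mid hC1,
        whR_tmul, whL_tmul]
      congr 1
      · exact hC.mul_one c
      · exact hA.isModuleAlgebra.mul_one a
  · rw [diamond_mul_eq hC hA]
    exact (HHom.map_act (diaMul hC hA) h (a ⊗ₜ[k] b)).symm

variable (hA) in
theorem mulH_diamond (hD : IsModuleAlgebra (diamond C A)) (x : (N ⊗[k] M) ⊗[k] (N ⊗[k] M)) :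
    mulH hD x = diaMul hC hA x := DFunLike.congr_fun (diamond_mul_eq hC hA) x

variable (hA) in
/-- The multiplication of `C ◇ A` on towers. -/
theorem assocH_mulX_diamond (hD : IsModuleAlgebra (diamond C A))
    (v : (N ⊗[k] M) ⊗[k] ((N ⊗[k] M) ⊗[k] P)) :
    assocH C.act A.act τ (mulX hD τ v) =
      diaAct hC hA ((LeftMod.regular hA.isModuleAlgebra).ext τ)
        (whL C.act (whL A.act (assocH C.act A.act τ))
          (assocH C.act A.act ((C.act ⊠ A.act) ⊠ τ) v)) := by
  obtain ⟨w, rfl⟩ := assocH_surj (C.act ⊠ A.act) (C.act ⊠ A.act) τ v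
  have e : whR τ (mulH hD) w = whR τ (diaAct hC hA (LeftMod.regular hA.isModuleAlgebra))
      (whR τ (assocH C.act A.act (C.act ⊠ A.act)) w) :=
    (whR_congr (ρ := τ) (f := mulH hD) (g := diaMul hC hA)
      (mulH_diamond hC hA hD) w).trans (whR_comp _ _ _)
  have e' : mulX hD τ (assocH (C.act ⊠ A.act) (C.act ⊠ A.act) τ w) = whR τ (mulH hD) w := by
    rw [mulX_apply]
    exact congrArg _ (assocInvH_assocH (C.act ⊠ A.act) (C.act ⊠ A.act) τ w)
  rw [e', e]
  refine (diaAct_ext hC (LeftMod.regular hA.isModuleAlgebra) _).trans ?_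
  rw [← pentagonH]

end Diamond

/-! ### The braided tensor product as a Yetter–Drinfeld algebra -/

section Braided

variable {k H : Type*} [Field k] [Ring H] [Algebra k H] [QuasiBialgebra k H]
variable {M N P Q : Type*} [AddCommGroup M] [Module k M] [AddCommGroup N] [Module k N]
  [AddCommGroup P] [Module k P] [AddCommGroup Q] [Module k Q]
variable {A : YDAlgData k H M} (hA : IsYetterDrinfeldAlgebra A)
  {B : YDAlgData k H N} (hB : IsYetterDrinfeldAlgebra B)
  {υ : H →ₐ[k] Module.End k P}

theorem braid_mulX (x : N ⊗[k] (N ⊗[k] P)) :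
    braid hB.compat υ (mulX hB.isModuleAlgebra υ x) =
      whL υ (mulH hB.isModuleAlgebra) (tb hB.compat υ B.act (whL B.act (braid hB.compat υ) x)) := by
  rw [mulX_apply, braid_mulH hB, assocH_assocInvH]

/-- The half-braiding of a tensor product of Yetter–Drinfeld algebras is compatible with the
multiplication. -/
theorem braid_diaAct (ht : IsCompatible (A.act ⊠ B.act)
      (tensorCoact A.act A.coact B.act B.coact))
    (x : ((M ⊗[k] N) ⊗[k] (M ⊗[k] N)) ⊗[k] P) :
    braid ht υ (whR υ (diaMul hA.isModuleAlgebra hB) x) =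
    whL υ (diaMul hA.isModuleAlgebra hB) (tb ht υ (A.act ⊠ B.act)
        (whL (A.act ⊠ B.act) (braid ht υ) (assocH (A.act ⊠ B.act) (A.act ⊠ B.act) υ x))) := by
  set D := A.act ⊠ B.act with hD
  have hb : ∀ s, braid ht υ s = ((tb hA.compat υ B.act).comp
      ((whL A.act (braid hB.compat υ)).comp (assocH A.act B.act υ))) s :=
    braid_tensor hA.compat hB.compat ht
  have e2 : ∀ y, whL A.act (whL B.act (braid ht υ)) y =
      whL A.act (whL B.act (tb hA.compat υ B.act))
        (whL A.act (whL B.act (whL A.act (braid hB.compat υ)))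
          (whL A.act (whL B.act (assocH A.act B.act υ)) y)) := fun y => by
    rw [whL_comp_apply, whL_comp_apply]
    refine whL_congr (fun s => ?_) y
    rw [whL_congr hb, HHom.comp_apply, HHom.comp_apply, whL_comp, whL_comp]
  have e3 : ∀ y, whL υ (diaAct hA.isModuleAlgebra hB (LeftMod.regular hB.isModuleAlgebra)) y =
      whL υ (whL A.act (mulH hB.isModuleAlgebra)) (whL υ (mulX hA.isModuleAlgebra _)
        (whL υ (whL A.act (tb hB.compat A.act B.act)) y)) := fun y => by
    rw [diaAct, whL_comp, whL_comp]; rfl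
  have e4 : ∀ s, tb hA.compat υ (B.act ⊠ B.act) (whL A.act (tb hB.compat υ B.act)
      (whL A.act (whL B.act (braid hB.compat υ)) s)) = tb hA.compat υ (B.act ⊠ B.act)
      (whL A.act (tb hB.compat υ B.act)
      (whL A.act (whL B.act (braid hB.compat υ)) s)) := fun _ => rfl
  rw [diaMul, whL_comp, tb_tensor hA.compat hB.compat, whR_comp, hb, HHom.comp_apply, HHom.comp_apply,
    diaAct_ext, ← pentagonH, ← whL_assocH, e2, e3, diaAct_apply]
  change tb hA.compat υ B.act (whL A.act (braid hB.compat υ)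
    (whL A.act (mulX hB.isModuleAlgebra υ) _)) = _
  rw [whL_square₃ (fun s => braid_mulX hB s), tb_whL, ← mulX_whL, ← mulX_whL, tb_mulX_self hA,
    ← whL_square (fun s => tb_whL hB.compat (braid hB.compat υ) s)]
  generalize whL A.act (whL B.act (whL A.act (braid hB.compat υ))) _ = s
  -- The sides now differ in whether `B` passes the second factor `A` before or after both have
  -- passed `υ`. The braid relation exchanges the two orders.
  have e5 := whL_congr (ρ := A.act) (f := (tb hA.compat υ (B.act ⊠ B.act)).comp
    ((whL A.act (tb hB.compat υ B.act)).comp (tb hB.compat A.act (υ ⊠ B.act))))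
    (g := (whL υ (tb hB.compat A.act B.act)).comp
      ((tb hB.compat υ (A.act ⊠ B.act)).comp (whL B.act (tb hA.compat υ B.act))))
    (fun s => (tb_tb_tb hA.compat hB.compat hB.coassoc s).symm) s
  simp only [whL_comp] at e5
  rw [e5, tb_whL]

/-- The braided tensor product of two algebras in the Yetter–Drinfeld category. -/
theorem isYetterDrinfeldAlgebra_braidedTensor (hA : IsYetterDrinfeldAlgebra A)
    (hB : IsYetterDrinfeldAlgebra B) :
    IsYetterDrinfeldAlgebra (braidedTensor A B) := by
  have ht : IsCompatible (A.act ⊠ B.act) (tensorCoact A.act A.coact B.act B.coact) :=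
    isCompatible_tensorCoact hA.compat hB.compat
  have hM : IsModuleAlgebra (braidedTensor A B).toModAlgData :=
    isModuleAlgebra_diamond hA.isModuleAlgebra hB
  refine ⟨isYetterDrinfeldModule_tensorCoact hA.isYetterDrinfeldModule
    hB.isYetterDrinfeldModule, hM, ?_, fun a b => ?_⟩
  -- Both coaction laws are read off from the half-braiding with the regular module, evaluated at
  -- `1`.
  · have := braid_tensor hA.compat hB.compat ht (υ := Algebra.lmul k H)
      ((A.one ⊗ₜ[k] B.one) ⊗ₜ[k] (1 : H))
    rw [assocH_invariant_left hA.isInvariant_one, whL_tmul, braid_one hB, tb_one hA, braid_tmul,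
      applyFst_one] at this
    exact this
  · have := braid_diaAct hA hB ht (υ := Algebra.lmul k H) ((a ⊗ₜ[k] b) ⊗ₜ[k] (1 : H))
    rw [← braid_tensor ht ht (isCompatible_tensorCoact ht ht), whR_tmul, braid_tmul, braid_tmul,
      applyFst_one, applyFst_one] at this
    change tensorCoact A.act A.coact B.act B.coact ((diamond A.toModAlgData B).mul _) =
      LinearMap.lTensor H (diamond A.toModAlgData B).mul _
    rw [diamond_mul_eq hA.isModuleAlgebra hB]
    exact this

end Braided

/-! ### Associativity of the twisted tensor product -/

section Iso

variable {k H : Type*} [Field k] [Ring H] [Algebra k H] [QuasiBialgebra k H]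
variable {M N P : Type*} [AddCommGroup M] [Module k M] [AddCommGroup N] [Module k N]
  [AddCommGroup P] [Module k P]
variable {C : ModAlgData k H N} {A : YDAlgData k H M} {B : YDAlgData k H P}

/-- The associativity constraint as a linear equivalence. -/
def assocEquiv {ρ : H →ₐ[k] Module.End k M} {σ : H →ₐ[k] Module.End k N}
    {τ : H →ₐ[k] Module.End k P} : (M ⊗[k] N) ⊗[k] P ≃ₗ[k] M ⊗[k] (N ⊗[k] P) :=
  LinearEquiv.ofLinearMap (assocConstraint ρ σ τ) (assocConstraintInv ρ σ τ)
    (LinearMap.ext fun x => assocConstraint_assocConstraintInv ρ σ τ x)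
    (LinearMap.ext fun x => assocConstraintInv_assocConstraint ρ σ τ x)

/-- The multiplication of `(C ◇ A) ◇ B` on towers. -/
theorem assocH_diaMul_diamond (hC : IsModuleAlgebra C) (hA : IsYetterDrinfeldAlgebra A)
    (hB : IsYetterDrinfeldAlgebra B) (hD : IsModuleAlgebra (diamond C A))
    (x : ((N ⊗[k] M) ⊗[k] P) ⊗[k] ((N ⊗[k] M) ⊗[k] P)) :
    assocH C.act A.act B.act (diaMul hD hB x) =
      whL C.act (whL A.act (mulH hB.isModuleAlgebra))
        (whL C.act (mulX hA.isModuleAlgebra (B.act ⊠ B.act))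
          (mulX hC (A.act ⊠ (A.act ⊠ (B.act ⊠ B.act)))
            (whL C.act (tb hA.compat C.act (A.act ⊠ (B.act ⊠ B.act)))
          (whL C.act (whL A.act (whL C.act (tb hB.compat A.act B.act)))
            (whL C.act (whL A.act (tb hB.compat C.act (A.act ⊠ B.act)))
    (whL C.act (whL A.act (whL B.act (assocH C.act A.act B.act)))
      (assocH C.act A.act (B.act ⊠ ((C.act ⊠ A.act) ⊠ B.act))
        (assocH (C.act ⊠ A.act) B.act ((C.act ⊠ A.act) ⊠ B.act) x)))))))) := by
  -- The hexagon for `B` splits its passage past `C ⊗ A` into passages past `C` and past `A`.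
  have e2 : ∀ y, whL C.act (whL A.act (assocH C.act A.act (B.act ⊠ B.act)))
      (whL C.act (whL A.act (tb hB.compat (C.act ⊠ A.act) B.act)) y) =
    whL C.act (whL A.act (whL C.act (tb hB.compat A.act B.act)))
      (whL C.act (whL A.act (tb hB.compat C.act (A.act ⊠ B.act)))
        (whL C.act (whL A.act (whL B.act (assocH C.act A.act B.act))) y)) := fun y => by
    rw [whL_comp_apply, whL_comp_apply, whL_comp_apply]
    refine whL_congr (fun s => ?_) y
    rw [HHom.comp_apply, HHom.comp_apply, HHom.comp_apply]
    exact whL_square₃ (tb_hexagon hB.compat hB.coassoc) s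
  rw [diaMul_apply]
  change assocH C.act A.act B.act (whL (C.act ⊠ A.act) (mulH hB.isModuleAlgebra)
    (mulX hD (B.act ⊠ B.act) (whL (C.act ⊠ A.act) (tb hB.compat (C.act ⊠ A.act) B.act)
      (assocH (C.act ⊠ A.act) B.act ((C.act ⊠ A.act) ⊠ B.act) x)))) = _
  rw [← whL_assocH, assocH_mulX_diamond hC hA hD, ← whL_assocH, e2]
  rfl

/-- The multiplication of `C ◇ (A ⊗ B)` on towers. -/
theorem diaMul_braidedTensor (hC : IsModuleAlgebra C) (hA : IsYetterDrinfeldAlgebra A)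
    (hB : IsYetterDrinfeldAlgebra B) (hAB : IsYetterDrinfeldAlgebra (braidedTensor A B))
    (y : (N ⊗[k] (M ⊗[k] P)) ⊗[k] (N ⊗[k] (M ⊗[k] P))) :
    diaMul hC hAB y =
      whL C.act (whL A.act (mulH hB.isModuleAlgebra))
        (whL C.act (mulX hA.isModuleAlgebra (B.act ⊠ B.act))
        (whL C.act (whL A.act (tb hB.compat A.act B.act))
          (mulX hC (A.act ⊠ (B.act ⊠ (A.act ⊠ B.act)))
            (whL C.act (tb hA.compat C.act (B.act ⊠ (A.act ⊠ B.act)))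
            (whL C.act (whL A.act (tb hB.compat C.act (A.act ⊠ B.act)))
              (whL C.act (assocH A.act B.act (C.act ⊠ (A.act ⊠ B.act)))
                (assocH C.act (A.act ⊠ B.act) (C.act ⊠ (A.act ⊠ B.act)) y))))))) := by
  have e3 : ∀ z, whL C.act (mulH hAB.isModuleAlgebra) z =
      whL C.act (whL A.act (mulH hB.isModuleAlgebra))
        (whL C.act (mulX hA.isModuleAlgebra (B.act ⊠ B.act))
        (whL C.act (whL A.act (tb hB.compat A.act B.act))
          (whL C.act (assocH A.act B.act (A.act ⊠ B.act)) z))) := fun z => by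
    rw [whL_comp_apply, whL_comp_apply, whL_comp_apply]
    exact whL_congr (mulH_diamond hA.isModuleAlgebra hB hAB.isModuleAlgebra) z
  -- The formula for the half-braiding of `A ⊗ B` splits its passage past `C`: first `B` passes,
  -- then `A`.
  have e4 : ∀ z, whL C.act (whL C.act (assocH A.act B.act (A.act ⊠ B.act)))
      (whL C.act (tb (isCompatible_tensorCoact hA.compat hB.compat) C.act (A.act ⊠ B.act)) z) =
      whL C.act (tb hA.compat C.act (B.act ⊠ (A.act ⊠ B.act)))
            (whL C.act (whL A.act (tb hB.compat C.act (A.act ⊠ B.act)))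
              (whL C.act (assocH A.act B.act (C.act ⊠ (A.act ⊠ B.act))) z)) :=
    whL_square₃ (tb_tensor hA.compat hB.compat _)
  rw [diaMul_apply, e3]
  change whL C.act _ (whL C.act _ (whL C.act _ (whL C.act (assocH A.act B.act (A.act ⊠ B.act))
    (mulX hC ((A.act ⊠ B.act) ⊠ (A.act ⊠ B.act))
      (whL C.act (tb (isCompatible_tensorCoact hA.compat hB.compat) C.act (A.act ⊠ B.act))
        (assocH C.act (A.act ⊠ B.act) (C.act ⊠ (A.act ⊠ B.act)) y)))))) = _
  rw [← mulX_whL, e4]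

/-- Both products expand into the same elementary moves. They differ only in that `B` passes the
second `A` before or after the first `A` passes `C` and the factors from `C` are multiplied. These
moves concern different tensor factors, so naturality reconciles them. -/
theorem assocH_diamond_mul (hC : IsModuleAlgebra C) (hA : IsYetterDrinfeldAlgebra A)
    (hB : IsYetterDrinfeldAlgebra B) (x : ((N ⊗[k] M) ⊗[k] P) ⊗[k] ((N ⊗[k] M) ⊗[k] P)) :
    assocH C.act A.act B.act ((diamond (diamond C A) B).mul x) =
      (diamond C (braidedTensor A B)).mul
        (whR (C.act ⊠ (A.act ⊠ B.act)) (assocH C.act A.act B.act)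
          (whL ((C.act ⊠ A.act) ⊠ B.act) (assocH C.act A.act B.act) x)) := by
  have hD := isModuleAlgebra_diamond hC hA
  have hAB := isYetterDrinfeldAlgebra_braidedTensor hA hB
  rw [diamond_mul_eq hD hB, diamond_mul_eq hC hAB, HHom.toLinearMap_apply]
  refine (assocH_diaMul_diamond hC hA hB hD x).trans
    (Eq.trans ?_ (diaMul_braidedTensor hC hA hB hAB _).symm)
  rw [← pentagonH, ← whL_assocH, ← whL_assocH,
    whL_square (fun s => tb_whL hA.compat (tb hB.compat A.act B.act) s), mulX_whL]

/-- `(C ◇ A) ◇ B ≅ C ◇ (A ⊗ B)`. -/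
theorem isModuleAlgebraIso_assoc (hC : IsModuleAlgebra C) (hA : IsYetterDrinfeldAlgebra A)
    (hB : IsYetterDrinfeldAlgebra B) :
    IsModuleAlgebraIso (diamond (diamond C A) B) (diamond C (braidedTensor A B))
      (assocEquiv (ρ := C.act) (σ := A.act) (τ := B.act)) where
  map_act h x := HHom.map_act (assocH C.act A.act B.act) h x
  map_mul a b := assocH_diamond_mul hC hA hB (a ⊗ₜ[k] b)
  map_one := assocH_invariant_left (show IsInvariant C.act C.one from hC.act_one) _ _

end Iso

end QuasiHopf

set_option maxSynthPendingDepth 10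

namespace QuasiHopf

open QuasiBialgebra QuasiHopfAlgebra

/-! ### Tensor powers of a quasi-bialgebra -/

section TensorPowers

variable {k : Type*} [Field k]

@[elab_as_elim]
theorem tensor_induction₃ {A B C : Type*} [AddCommGroup A] [Module k A] [AddCommGroup B]
    [Module k B] [AddCommGroup C] [Module k C] {p : A ⊗[k] (B ⊗[k] C) → Prop}
    (t : A ⊗[k] (B ⊗[k] C)) (zero : p 0) (add : ∀ x y, p x → p y → p (x + y))
    (tmul : ∀ a b c, p (a ⊗ₜ[k] (b ⊗ₜ[k] c))) : p t := by
  induction t with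
  | zero => exact zero
  | add x y hx hy => exact add x y hx hy
  | tmul a t =>
    induction t with
    | zero => rw [TensorProduct.tmul_zero]; exact zero
    | add x y hx hy => rw [TensorProduct.tmul_add]; exact add _ _ hx hy
    | tmul b c => exact tmul a b c

@[elab_as_elim]
theorem tensor_induction₄ {A B C D : Type*} [AddCommGroup A] [Module k A] [AddCommGroup B]
    [Module k B] [AddCommGroup C] [Module k C] [AddCommGroup D] [Module k D]
    {p : A ⊗[k] (B ⊗[k] (C ⊗[k] D)) → Prop}
    (t : A ⊗[k] (B ⊗[k] (C ⊗[k] D))) (zero : p 0) (add : ∀ x y, p x → p y → p (x + y))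
    (tmul : ∀ a b c d, p (a ⊗ₜ[k] (b ⊗ₜ[k] (c ⊗ₜ[k] d)))) : p t := by
  induction t using tensor_induction₃ with
  | zero => exact zero
  | add x y hx hy => exact add x y hx hy
  | tmul a b t =>
    induction t with
    | zero => rw [TensorProduct.tmul_zero, TensorProduct.tmul_zero]; exact zero
    | add x y hx hy => rw [TensorProduct.tmul_add, TensorProduct.tmul_add]; exact add _ _ hx hy
    | tmul c d => exact tmul a b c d

variable (k) (H : Type*) [Ring H] [Algebra k H]

/-- `a ⊗ b ⊗ c ↦ a ⊗ b ⊗ c ⊗ 1`. -/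
def padR : H ⊗[k] (H ⊗[k] H) →ₐ[k] H ⊗[k] (H ⊗[k] (H ⊗[k] H)) :=
  Algebra.TensorProduct.map (AlgHom.id k H) (Algebra.TensorProduct.map (AlgHom.id k H)
    (Algebra.TensorProduct.includeLeft : H →ₐ[k] H ⊗[k] H))

@[simp] theorem padR_tmul (a b c : H) :
    padR k H (a ⊗ₜ[k] (b ⊗ₜ[k] c)) = a ⊗ₜ[k] (b ⊗ₜ[k] (c ⊗ₜ[k] 1)) := rfl

/-- `a ⊗ b ⊗ c ↦ 1 ⊗ a ⊗ b ⊗ c`. -/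
def padL : H ⊗[k] (H ⊗[k] H) →ₐ[k] H ⊗[k] (H ⊗[k] (H ⊗[k] H)) :=
  Algebra.TensorProduct.includeRight

@[simp] theorem padL_apply (t : H ⊗[k] (H ⊗[k] H)) : padL k H t = 1 ⊗ₜ[k] t := rfl

variable [QuasiBialgebra k H]

/-- `Δ` on the first of three legs. -/
def comul₁ : H ⊗[k] (H ⊗[k] H) →ₐ[k] H ⊗[k] (H ⊗[k] (H ⊗[k] H)) :=
  (Algebra.TensorProduct.assoc k k k H H (H ⊗[k] H)).toAlgHom.comp
    (Algebra.TensorProduct.map comul (AlgHom.id k (H ⊗[k] H)))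

/-- `Δ` on the second of three legs. -/
def comul₂ : H ⊗[k] (H ⊗[k] H) →ₐ[k] H ⊗[k] (H ⊗[k] (H ⊗[k] H)) :=
  Algebra.TensorProduct.map (AlgHom.id k H)
    ((Algebra.TensorProduct.assoc k k k H H H).toAlgHom.comp
      (Algebra.TensorProduct.map comul (AlgHom.id k H)))

/-- `Δ` on the third of three legs. -/
def comul₃ : H ⊗[k] (H ⊗[k] H) →ₐ[k] H ⊗[k] (H ⊗[k] (H ⊗[k] H)) :=
  Algebra.TensorProduct.map (AlgHom.id k H) (Algebra.TensorProduct.map (AlgHom.id k H) comul)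

@[simp] theorem comul₁_tmul (a : H) (t : H ⊗[k] H) :
    comul₁ k H (a ⊗ₜ[k] t) = TensorProduct.assoc k H H (H ⊗[k] H) (comul a ⊗ₜ[k] t) := rfl

@[simp] theorem comul₂_tmul (a b c : H) :
    comul₂ k H (a ⊗ₜ[k] (b ⊗ₜ[k] c)) =
      a ⊗ₜ[k] TensorProduct.assoc k H H H (comul b ⊗ₜ[k] c) := rfl

@[simp] theorem comul₃_tmul (a b c : H) :
    comul₃ k H (a ⊗ₜ[k] (b ⊗ₜ[k] c)) = a ⊗ₜ[k] (b ⊗ₜ[k] comul c) := rfl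

variable {k H}

@[simp] theorem reassoc_mul_inv : reassoc k H * reassocInv k H = 1 := Units.mul_inv _
@[simp] theorem reassocInv_mul : reassocInv k H * reassoc k H = 1 := Units.inv_mul _

theorem pentagon_elem : padL k H (reassoc k H) * comul₂ k H (reassoc k H) *
    padR k H (reassoc k H) = comul₃ k H (reassoc k H) * comul₁ k H (reassoc k H) :=
  QuasiBialgebra.pentagon

theorem map_reassoc_mul_inv {A : Type*} [Ring A] [Algebra k A]
    (f : H ⊗[k] (H ⊗[k] H) →ₐ[k] A) : f (reassoc k H) * f (reassocInv k H) = 1 := by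
  rw [← map_mul, reassoc_mul_inv, map_one]

theorem map_reassocInv_mul {A : Type*} [Ring A] [Algebra k A]
    (f : H ⊗[k] (H ⊗[k] H) →ₐ[k] A) : f (reassocInv k H) * f (reassoc k H) = 1 := by
  rw [← map_mul, reassocInv_mul, map_one]

theorem map_reassocInv_of {A : Type*} [Ring A] [Algebra k A]
    {f : H ⊗[k] (H ⊗[k] H) →ₐ[k] A} (h : f (reassoc k H) = 1) : f (reassocInv k H) = 1 := by
  simpa [h] using map_reassoc_mul_inv f

/-- This and the next two lemmas are the pentagon solved for different products. They are applied
under functionals that are blind to the outer factors `comul₁`, `comul₂`, `comul₃`, so that only a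
simpler expression in `Φ` or `Φ⁻¹` survives. -/
theorem comul₁_padR_inv : comul₁ k H (reassoc k H) * padR k H (reassocInv k H) =
    comul₃ k H (reassocInv k H) * (padL k H (reassoc k H) * comul₂ k H (reassoc k H)) := by
  have h := congrArg (fun x => comul₃ k H (reassocInv k H) * x * padR k H (reassocInv k H))
    (pentagon_elem (k := k) (H := H))
  simp only [← mul_assoc, map_reassocInv_mul, one_mul] at h
  simp only [mul_assoc, map_reassoc_mul_inv, mul_one] at h
  exact h.symm

theorem comul₃_inv_padL : comul₃ k H (reassocInv k H) * padL k H (reassoc k H) =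
    comul₁ k H (reassoc k H) * (padR k H (reassocInv k H) * comul₂ k H (reassocInv k H)) := by
  have h := congrArg (fun x => x * comul₂ k H (reassocInv k H))
    (comul₁_padR_inv (k := k) (H := H))
  simp only [mul_assoc, map_reassoc_mul_inv, mul_one] at h
  exact h.symm

theorem padR_comul₁_inv : padR k H (reassoc k H) * comul₁ k H (reassocInv k H) =
    comul₂ k H (reassocInv k H) * (padL k H (reassocInv k H) * comul₃ k H (reassoc k H)) := by
  have h := congrArg (fun x => comul₂ k H (reassocInv k H) * (padL k H (reassocInv k H) *
    (x * comul₁ k H (reassocInv k H)))) (pentagon_elem (k := k) (H := H))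
  simp only [mul_assoc, map_reassoc_mul_inv, mul_one] at h
  rw [← h, ← mul_assoc (padL k H (reassocInv k H)), map_reassocInv_mul, one_mul,
    ← mul_assoc (comul₂ k H (reassocInv k H)), map_reassocInv_mul, one_mul]

theorem comul_coassoc (h : H) :
    Algebra.TensorProduct.map (AlgHom.id k H) comul (comul (k := k) h) * reassoc k H =
      reassoc k H * Algebra.TensorProduct.assoc k k k H H H
          (Algebra.TensorProduct.map comul (AlgHom.id k H) (comul h)) := by
  rw [coassoc, mul_assoc, mul_assoc]
  change _ * (_ * (reassocInv k H * reassoc k H)) = _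
  rw [reassocInv_mul, mul_one]; rfl

theorem comul_coassoc_inv (h : H) :
    Algebra.TensorProduct.assoc k k k H H H
          (Algebra.TensorProduct.map comul (AlgHom.id k H) (comul h)) * reassocInv k H =
      reassocInv k H * Algebra.TensorProduct.map (AlgHom.id k H) comul (comul (k := k) h) := by
  rw [coassoc, ← mul_assoc, ← mul_assoc]
  change _ = reassocInv k H * reassoc k H * _ * reassocInv k H
  rw [reassocInv_mul, one_mul]

/-! ### Functionals that absorb the comultiplication -/

section Absorb

variable {P : Type*} [AddCommGroup P] [Module k P]

/-- A functional that absorbs `Δ(u)` in the last two of four legs from the left. -/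
theorem absorb_comul₃ {F : H ⊗[k] (H ⊗[k] (H ⊗[k] H)) →ₗ[k] P}
    (hF : ∀ u s, F (((1 : H) ⊗ₜ[k] ((1 : H) ⊗ₜ[k] comul u)) * s) = (counit u : k) • F s)
    {t : H ⊗[k] (H ⊗[k] H)} (s : H ⊗[k] (H ⊗[k] (H ⊗[k] H)))
    (ht : Algebra.TensorProduct.map (AlgHom.id k H) (Algebra.TensorProduct.map (AlgHom.id k H)
      counit) t = 1) :
    F (comul₃ k H t * s) = F s := by
  -- `F` cannot distinguish `Δ` from `ε` in the last leg; after that replacement the hypothesis on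
  -- `t` finishes.
  suffices h : F (comul₃ k H t * s) = F (Algebra.TensorProduct.map (AlgHom.id k H)
      (Algebra.TensorProduct.map (AlgHom.id k H) (Algebra.ofId k (H ⊗[k] H)))
      (Algebra.TensorProduct.map (AlgHom.id k H) (Algebra.TensorProduct.map (AlgHom.id k H)
      counit) t) * s) by rw [h, ht, map_one, one_mul]
  clear ht
  induction t using tensor_induction₃ with
  | zero => simp
  | add x y hx hy => simp only [map_add, add_mul, hx, hy]
  | tmul a b c =>
    have := hF c ((a ⊗ₜ[k] (b ⊗ₜ[k] 1)) * s)
    simp only [← mul_assoc, Algebra.TensorProduct.tmul_mul_tmul, one_mul, mul_one] at this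
    rw [comul₃_tmul, this, ← map_smul, ← smul_mul_assoc]
    simp [Algebra.ofId_apply, Algebra.algebraMap_eq_smul_one]

/-- As for the third leg: a functional that sees `Δ(u)` only through `ε(u)` does not see `comul₂ t`
when `t` is normalized in that leg, as `Φ` and `Φ⁻¹` are. -/
theorem absorb_comul₂ {F : H ⊗[k] (H ⊗[k] (H ⊗[k] H)) →ₗ[k] P}
    (hF : ∀ u s, F (((1 : H) ⊗ₜ[k] TensorProduct.assoc k H H H (comul u ⊗ₜ[k] 1)) * s) =
      (counit u : k) • F s)
    {t : H ⊗[k] (H ⊗[k] H)} (s : H ⊗[k] (H ⊗[k] (H ⊗[k] H)))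
    (ht : Algebra.TensorProduct.map (AlgHom.id k H) (Algebra.TensorProduct.map counit
      (AlgHom.id k H)) t = 1) :
    F (comul₂ k H t * s) = F s := by
  suffices h : F (comul₂ k H t * s) = F (Algebra.TensorProduct.map (AlgHom.id k H)
      (Algebra.TensorProduct.map (Algebra.ofId k H) Algebra.TensorProduct.includeRight)
      (Algebra.TensorProduct.map (AlgHom.id k H) (Algebra.TensorProduct.map counit
      (AlgHom.id k H)) t) * s) by rw [h, ht, map_one, one_mul]
  clear ht
  induction t using tensor_induction₃ with
  | zero => simp
  | add x y hx hy => simp only [map_add, add_mul, hx, hy]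
  | tmul a b c =>
    have := hF b ((a ⊗ₜ[k] (1 ⊗ₜ[k] (1 ⊗ₜ[k] c))) * s)
    have e : ∀ w : H ⊗[k] H, ((1 : H) ⊗ₜ[k] TensorProduct.assoc k H H H (w ⊗ₜ[k] 1)) *
        (a ⊗ₜ[k] (1 ⊗ₜ[k] (1 ⊗ₜ[k] c))) = a ⊗ₜ[k] TensorProduct.assoc k H H H (w ⊗ₜ[k] c) := by
      intro w
      induction w with
      | zero => simp
      | add x y hx hy =>
        simp only [map_add, TensorProduct.add_tmul, TensorProduct.tmul_add, add_mul, hx, hy]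
      | tmul x y => simp
    rw [← mul_assoc, e] at this
    rw [comul₂_tmul, this, ← map_smul, ← smul_mul_assoc]
    simp [Algebra.ofId_apply, Algebra.algebraMap_eq_smul_one, TensorProduct.smul_tmul]

theorem absorb_comul₁ {F : H ⊗[k] (H ⊗[k] (H ⊗[k] H)) →ₗ[k] P}
    (hF : ∀ u s, F (TensorProduct.assoc k H H (H ⊗[k] H) (comul u ⊗ₜ[k] 1) * s) =
      (counit u : k) • F s)
    {t : H ⊗[k] (H ⊗[k] H)} (s : H ⊗[k] (H ⊗[k] (H ⊗[k] H)))
    (ht : Algebra.TensorProduct.map (counit (k := k)) (AlgHom.id k (H ⊗[k] H)) t = 1) :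
    F (comul₁ k H t * s) = F s := by
  suffices h : F (comul₁ k H t * s) = F (Algebra.TensorProduct.map (Algebra.ofId k H)
      Algebra.TensorProduct.includeRight
      (Algebra.TensorProduct.map counit (AlgHom.id k (H ⊗[k] H)) t) * s) by
    rw [h, ht, map_one, one_mul]
  clear ht
  induction t with
  | zero => simp
  | add x y hx hy => simp only [map_add, add_mul, hx, hy]
  | tmul a b =>
    have := hF a ((1 ⊗ₜ[k] (1 ⊗ₜ[k] b)) * s)
    have e : ∀ w : H ⊗[k] H, (TensorProduct.assoc k H H (H ⊗[k] H) (w ⊗ₜ[k] 1)) *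
        (1 ⊗ₜ[k] (1 ⊗ₜ[k] b)) = TensorProduct.assoc k H H (H ⊗[k] H) (w ⊗ₜ[k] b) := by
      intro w
      induction w with
      | zero => simp
      | add x y hx hy => simp only [map_add, TensorProduct.add_tmul, add_mul, hx, hy]
      | tmul x y => simp
    rw [← mul_assoc, e] at this
    rw [comul₁_tmul, this, ← map_smul, ← smul_mul_assoc]
    simp [Algebra.ofId_apply, Algebra.algebraMap_eq_smul_one, TensorProduct.smul_tmul]

theorem absorb_comul₃_right {F : H ⊗[k] (H ⊗[k] (H ⊗[k] H)) →ₗ[k] P}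
    (hF : ∀ u s, F (s * ((1 : H) ⊗ₜ[k] ((1 : H) ⊗ₜ[k] comul u))) = (counit u : k) • F s)
    {t : H ⊗[k] (H ⊗[k] H)} (s : H ⊗[k] (H ⊗[k] (H ⊗[k] H)))
    (ht : Algebra.TensorProduct.map (AlgHom.id k H) (Algebra.TensorProduct.map (AlgHom.id k H)
      counit) t = 1) :
    F (s * comul₃ k H t) = F s := by
  suffices h : F (s * comul₃ k H t) = F (s * Algebra.TensorProduct.map (AlgHom.id k H)
      (Algebra.TensorProduct.map (AlgHom.id k H) (Algebra.ofId k (H ⊗[k] H)))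
      (Algebra.TensorProduct.map (AlgHom.id k H) (Algebra.TensorProduct.map (AlgHom.id k H)
      counit) t)) by rw [h, ht, map_one, mul_one]
  clear ht
  induction t using tensor_induction₃ with
  | zero => simp
  | add x y hx hy => simp only [map_add, mul_add, hx, hy]
  | tmul a b c =>
    have := hF c (s * (a ⊗ₜ[k] (b ⊗ₜ[k] 1)))
    simp only [mul_assoc, Algebra.TensorProduct.tmul_mul_tmul, one_mul, mul_one] at this
    rw [comul₃_tmul, this, ← map_smul, ← mul_smul_comm]
    simp [Algebra.ofId_apply, Algebra.algebraMap_eq_smul_one]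

theorem absorb_comul₂_right {F : H ⊗[k] (H ⊗[k] (H ⊗[k] H)) →ₗ[k] P}
    (hF : ∀ u s, F (s * ((1 : H) ⊗ₜ[k] TensorProduct.assoc k H H H (comul u ⊗ₜ[k] 1))) =
      (counit u : k) • F s)
    {t : H ⊗[k] (H ⊗[k] H)} (s : H ⊗[k] (H ⊗[k] (H ⊗[k] H)))
    (ht : Algebra.TensorProduct.map (AlgHom.id k H) (Algebra.TensorProduct.map counit
      (AlgHom.id k H)) t = 1) :
    F (s * comul₂ k H t) = F s := by
  suffices h : F (s * comul₂ k H t) = F (s * Algebra.TensorProduct.map (AlgHom.id k H)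
      (Algebra.TensorProduct.map (Algebra.ofId k H) Algebra.TensorProduct.includeRight)
      (Algebra.TensorProduct.map (AlgHom.id k H) (Algebra.TensorProduct.map counit
      (AlgHom.id k H)) t)) by rw [h, ht, map_one, mul_one]
  clear ht
  induction t using tensor_induction₃ with
  | zero => simp
  | add x y hx hy => simp only [map_add, mul_add, hx, hy]
  | tmul a b c =>
    have := hF b (s * (a ⊗ₜ[k] (1 ⊗ₜ[k] (1 ⊗ₜ[k] c))))
    have e : ∀ w : H ⊗[k] H, (a ⊗ₜ[k] (1 ⊗ₜ[k] (1 ⊗ₜ[k] c))) *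
        ((1 : H) ⊗ₜ[k] TensorProduct.assoc k H H H (w ⊗ₜ[k] 1)) =
        a ⊗ₜ[k] TensorProduct.assoc k H H H (w ⊗ₜ[k] c) := by
      intro w
      induction w with
      | zero => simp
      | add x y hx hy =>
        simp only [map_add, TensorProduct.add_tmul, TensorProduct.tmul_add, mul_add, hx, hy]
      | tmul x y => simp
    rw [mul_assoc, e] at this
    rw [comul₂_tmul, this, ← map_smul, ← mul_smul_comm]
    simp [Algebra.ofId_apply, Algebra.algebraMap_eq_smul_one, TensorProduct.smul_tmul]

/-- A functional that absorbs `Δ(u)` in the last two of three legs from the left. -/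
theorem absorb_comul_snd {F : H ⊗[k] (H ⊗[k] H) →ₗ[k] P}
    (hF : ∀ u s, F (((1 : H) ⊗ₜ[k] comul u) * s) = (counit u : k) • F s)
    (h : H) (s : H ⊗[k] (H ⊗[k] H)) :
    F (Algebra.TensorProduct.map (AlgHom.id k H) comul (comul (k := k) h) * s) =
      F ((h ⊗ₜ[k] 1) * s) := by
  have h' : ∀ w : H ⊗[k] H, F (Algebra.TensorProduct.map (AlgHom.id k H) comul w * s) =
      F (Algebra.TensorProduct.map (AlgHom.id k H) (Algebra.ofId k (H ⊗[k] H))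
        (Algebra.TensorProduct.map (AlgHom.id k H) counit w) * s) := by
    intro w
    induction w with
    | zero => simp
    | add x y hx hy => simp only [map_add, add_mul, hx, hy]
    | tmul a b =>
      have := hF b ((a ⊗ₜ[k] 1) * s)
      simp only [← mul_assoc, Algebra.TensorProduct.tmul_mul_tmul, one_mul, mul_one] at this
      rw [Algebra.TensorProduct.map_tmul, AlgHom.id_apply, this, ← map_smul, ← smul_mul_assoc]
      simp [Algebra.ofId_apply, Algebra.algebraMap_eq_smul_one]
  rw [h', counit_right, Algebra.TensorProduct.map_tmul, map_one, AlgHom.id_apply]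

theorem absorb_comul_snd_right {F : H ⊗[k] (H ⊗[k] H) →ₗ[k] P}
    (hF : ∀ u s, F (s * ((1 : H) ⊗ₜ[k] comul u)) = (counit u : k) • F s)
    (h : H) (s : H ⊗[k] (H ⊗[k] H)) :
    F (s * Algebra.TensorProduct.map (AlgHom.id k H) comul (comul (k := k) h)) =
      F (s * (h ⊗ₜ[k] 1)) := by
  have h' : ∀ w : H ⊗[k] H, F (s * Algebra.TensorProduct.map (AlgHom.id k H) comul w) =
      F (s * Algebra.TensorProduct.map (AlgHom.id k H) (Algebra.ofId k (H ⊗[k] H))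
        (Algebra.TensorProduct.map (AlgHom.id k H) counit w)) := by
    intro w
    induction w with
    | zero => simp
    | add x y hx hy => simp only [map_add, mul_add, hx, hy]
    | tmul a b =>
      have := hF b (s * (a ⊗ₜ[k] 1))
      simp only [mul_assoc, Algebra.TensorProduct.tmul_mul_tmul, one_mul, mul_one] at this
      rw [Algebra.TensorProduct.map_tmul, AlgHom.id_apply, this, ← map_smul, ← mul_smul_comm]
      simp [Algebra.ofId_apply, Algebra.algebraMap_eq_smul_one]
  rw [h', counit_right, Algebra.TensorProduct.map_tmul, map_one, AlgHom.id_apply]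

/-- A functional that absorbs `Δ(u)` in the first two of three legs from the left. -/
theorem absorb_comul_fst {F : H ⊗[k] (H ⊗[k] H) →ₗ[k] P}
    (hF : ∀ u s, F (TensorProduct.assoc k H H H (comul u ⊗ₜ[k] 1) * s) = (counit u : k) • F s)
    (h : H) (s : H ⊗[k] (H ⊗[k] H)) :
    F (Algebra.TensorProduct.assoc k k k H H H
      (Algebra.TensorProduct.map comul (AlgHom.id k H) (comul (k := k) h)) * s) =
      F ((1 ⊗ₜ[k] (1 ⊗ₜ[k] h)) * s) := by
  have h' : ∀ w : H ⊗[k] H, F (Algebra.TensorProduct.assoc k k k H H H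
      (Algebra.TensorProduct.map comul (AlgHom.id k H) w) * s) =
      F (Algebra.TensorProduct.map (Algebra.ofId k H) Algebra.TensorProduct.includeRight
        (Algebra.TensorProduct.map counit (AlgHom.id k H) w) * s) := by
    intro w
    induction w with
    | zero => simp
    | add x y hx hy => simp only [map_add, add_mul, hx, hy]
    | tmul a b =>
      have := hF a ((1 ⊗ₜ[k] (1 ⊗ₜ[k] b)) * s)
      have e : ∀ w : H ⊗[k] H, (TensorProduct.assoc k H H H (w ⊗ₜ[k] 1)) *
          (1 ⊗ₜ[k] (1 ⊗ₜ[k] b)) = TensorProduct.assoc k H H H (w ⊗ₜ[k] b) := by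
        intro w
        induction w with
        | zero => simp
        | add x y hx hy => simp only [map_add, TensorProduct.add_tmul, add_mul, hx, hy]
        | tmul x y => simp
      rw [← mul_assoc, e] at this
      rw [Algebra.TensorProduct.map_tmul, AlgHom.id_apply]
      refine Eq.trans this ?_
      rw [← map_smul, ← smul_mul_assoc]
      simp [Algebra.ofId_apply, Algebra.algebraMap_eq_smul_one, TensorProduct.smul_tmul]
  rw [h', counit_left, Algebra.TensorProduct.map_tmul, map_one]
  rfl

end Absorb

theorem counit_reassoc_left :
    Algebra.TensorProduct.map (counit (k := k)) (AlgHom.id k (H ⊗[k] H)) (reassoc k H) = 1 :=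
  counit_Phi_left

theorem counit_reassoc_right :
    Algebra.TensorProduct.map (AlgHom.id k H) (Algebra.TensorProduct.map (AlgHom.id k H) counit)
      (reassoc k H) = 1 :=
  counit_Phi_right

theorem counit_reassocInv_left :
    Algebra.TensorProduct.map (counit (k := k)) (AlgHom.id k (H ⊗[k] H)) (reassocInv k H) = 1 :=
  map_reassocInv_of counit_Phi_left

theorem counit_reassocInv_mid :
    Algebra.TensorProduct.map (AlgHom.id k H) (Algebra.TensorProduct.map counit (AlgHom.id k H))
      (reassocInv k H) = 1 :=
  map_reassocInv_of counit_Phi_mid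

theorem counit_reassocInv_right :
    Algebra.TensorProduct.map (AlgHom.id k H) (Algebra.TensorProduct.map (AlgHom.id k H) counit)
      (reassocInv k H) = 1 :=
  map_reassocInv_of counit_Phi_right

end TensorPowers

end QuasiHopf

namespace QuasiHopf

open QuasiBialgebra QuasiHopfAlgebra

/-! ### Evaluation functionals -/

section Evaluation

variable (k H : Type*) [Field k] [Ring H] [Algebra k H] [QuasiHopfAlgebra k H]

/-- `b ⊗ c ↦ S(b) α c`. -/
def evA : H ⊗[k] H →ₗ[k] H :=
  LinearMap.mul' k H ∘ₗ
    TensorProduct.map (LinearMap.mulRight k (alpha k : H) ∘ₗ (S (k := k) (H := H)).toLinearMap)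
      LinearMap.id

/-- `b ⊗ c ↦ b β S(c)`. -/
def evB : H ⊗[k] H →ₗ[k] H :=
  LinearMap.mul' k H ∘ₗ
    TensorProduct.map (LinearMap.mulRight k (beta k : H)) (S (k := k) (H := H)).toLinearMap

/-- `b ⊗ c ⊗ d ↦ b β S(c) α d`. -/
def evBA : H ⊗[k] (H ⊗[k] H) →ₗ[k] H :=
  LinearMap.mul' k H ∘ₗ TensorProduct.map (LinearMap.mulRight k (beta k : H)) (evA k H)

/-- `b ⊗ c ⊗ d ↦ S(b) α c β S(d)`. -/
def evAB : H ⊗[k] (H ⊗[k] H) →ₗ[k] H :=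
  LinearMap.mul' k H ∘ₗ TensorProduct.map
    (LinearMap.mulRight k (alpha k : H) ∘ₗ (S (k := k) (H := H)).toLinearMap) (evB k H)

variable {k H}

@[simp] theorem evA_tmul (b c : H) :
    evA k H (b ⊗ₜ[k] c) = S (k := k) b * alpha k * c := rfl
@[simp] theorem evB_tmul (b c : H) :
    evB k H (b ⊗ₜ[k] c) = b * beta k * S (k := k) c := rfl
@[simp] theorem evBA_tmul (b : H) (t : H ⊗[k] H) :
    evBA k H (b ⊗ₜ[k] t) = b * beta k * evA k H t := rfl
@[simp] theorem evAB_tmul (b : H) (t : H ⊗[k] H) :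
    evAB k H (b ⊗ₜ[k] t) = S (k := k) b * alpha k * evB k H t := rfl

theorem evA_mul (w : H ⊗[k] H) (b c : H) :
    evA k H (w * (b ⊗ₜ[k] c)) = S (k := k) b * evA k H w * c := by
  induction w with
  | zero => simp
  | add x y hx hy => simp only [map_add, add_mul, mul_add, hx, hy]
  | tmul x y => simp [S_mul, mul_assoc]

theorem evB_mul (w : H ⊗[k] H) (b c : H) :
    evB k H ((b ⊗ₜ[k] c) * w) = b * evB k H w * S (k := k) c := by
  induction w with
  | zero => simp
  | add x y hx hy => simp only [map_add, add_mul, mul_add, hx, hy]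
  | tmul x y => simp [S_mul, mul_assoc]

theorem evA_comul (u : H) : evA k H (comul u) = (counit u : k) • (alpha k : H) := S_alpha u
theorem evB_comul (u : H) : evB k H (comul u) = (counit u : k) • (beta k : H) := beta_S u

/-- Since `S` reverses products, `S(u₁b) α u₂c = S(b) S(u₁) α u₂ c`, and the antipode axiom applies
in the middle. This and `evB_mul_comul` are the source of the absorption hypotheses. -/
theorem evA_comul_mul (u : H) (s : H ⊗[k] H) :
    evA k H (comul u * s) = (counit u : k) • evA k H s := by
  induction s with
  | zero => simp
  | add x y hx hy => simp only [map_add, mul_add, smul_add, hx, hy]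
  | tmul x y => simp [evA_mul, evA_comul]

theorem evB_mul_comul (u : H) (s : H ⊗[k] H) :
    evB k H (s * comul u) = (counit u : k) • evB k H s := by
  induction s with
  | zero => simp
  | add x y hx hy => simp only [map_add, add_mul, smul_add, hx, hy]
  | tmul x y => simp [evB_mul, evB_comul]

theorem evBA_reassoc : evBA k H (reassoc k H) = 1 := Phi_beta_alpha
theorem evAB_reassocInv : evAB k H (reassocInv k H) = 1 := Phi_inv_alpha_beta

theorem lTensor_evA_comul (u : H) (s : H ⊗[k] (H ⊗[k] H)) :
    LinearMap.lTensor H (evA k H) (((1 : H) ⊗ₜ[k] comul u) * s) =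
      (counit u : k) • LinearMap.lTensor H (evA k H) s := by
  induction s with
  | zero => simp
  | add x y hx hy => simp only [map_add, mul_add, smul_add, hx, hy]
  | tmul x y => simp [evA_comul_mul]

theorem lTensor_evB_comul (u : H) (s : H ⊗[k] (H ⊗[k] H)) :
    LinearMap.lTensor H (evB k H) (s * ((1 : H) ⊗ₜ[k] comul u)) =
      (counit u : k) • LinearMap.lTensor H (evB k H) s := by
  induction s with
  | zero => simp
  | add x y hx hy => simp only [map_add, add_mul, smul_add, hx, hy]
  | tmul x y => simp [evB_mul_comul]

theorem evAB_comul_snd (u : H) (s : H ⊗[k] (H ⊗[k] H)) :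
    evAB k H (s * ((1 : H) ⊗ₜ[k] comul u)) = (counit u : k) • evAB k H s := by
  induction s with
  | zero => simp
  | add x y hx hy => simp only [map_add, add_mul, smul_add, hx, hy]
  | tmul x y => simp [evB_mul_comul]

theorem evAB_comul_fst (u : H) (s : H ⊗[k] (H ⊗[k] H)) :
    evAB k H (TensorProduct.assoc k H H H (comul u ⊗ₜ[k] 1) * s) =
      (counit u : k) • evAB k H s := by
  induction s using tensor_induction₃ with
  | zero => simp
  | add x y hx hy => simp only [map_add, mul_add, smul_add, hx, hy]
  | tmul b c d =>
    have : ∀ w : H ⊗[k] H, evAB k H (TensorProduct.assoc k H H H (w ⊗ₜ[k] 1) *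
        (b ⊗ₜ[k] (c ⊗ₜ[k] d))) = S (k := k) b * evA k H w * c * beta k * S (k := k) d := by
      intro w
      induction w with
      | zero => simp
      | add x y hx hy => simp only [map_add, add_mul, TensorProduct.add_tmul, mul_add, hx, hy]
      | tmul x y => simp [S_mul, mul_assoc]
    rw [this, evA_comul]
    simp [mul_assoc]

end Evaluation

theorem lTensor_absorb_left {k A B C : Type*} [Field k] [Ring A] [Algebra k A] [Ring B]
    [Algebra k B] [AddCommGroup C] [Module k C] {f : B →ₗ[k] C} {b : B} {c : k}
    (h : ∀ s, f (b * s) = c • f s) (s : A ⊗[k] B) :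
    LinearMap.lTensor A f ((1 ⊗ₜ[k] b) * s) = c • LinearMap.lTensor A f s := by
  induction s with
  | zero => simp
  | add x y hx hy => simp only [map_add, mul_add, smul_add, hx, hy]
  | tmul x y => simp [h]

theorem lTensor_absorb_right {k A B C : Type*} [Field k] [Ring A] [Algebra k A] [Ring B]
    [Algebra k B] [AddCommGroup C] [Module k C] {f : B →ₗ[k] C} {b : B} {c : k}
    (h : ∀ s, f (s * b) = c • f s) (s : A ⊗[k] B) :
    LinearMap.lTensor A f (s * (1 ⊗ₜ[k] b)) = c • LinearMap.lTensor A f s := by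
  induction s with
  | zero => simp
  | add x y hx hy => simp only [map_add, add_mul, smul_add, hx, hy]
  | tmul x y => simp [h]

/-! ### Bimodules with the adjoint action -/

/-- An `H`-bimodule. -/
structure Bimod (k H P : Type*) [Field k] [Ring H] [Algebra k H] [AddCommGroup P]
    [Module k P] where
  l : H →ₐ[k] Module.End k P
  r : H →ₗ[k] Module.End k P
  r_one : r 1 = 1
  r_mul : ∀ a b, r (a * b) = r b * r a
  comm : ∀ a b, Commute (l a) (r b)

namespace Bimod

section Basic

variable {k H P : Type*} [Field k] [Ring H] [Algebra k H] [AddCommGroup P] [Module k P]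
  (B : Bimod k H P)

theorem r_mul_apply (a b : H) (p : P) : B.r (a * b) p = B.r b (B.r a p) := by
  rw [B.r_mul]; rfl

theorem l_r (a b : H) (p : P) : B.l a (B.r b p) = B.r b (B.l a p) :=
  LinearMap.congr_fun (B.comm a b) p

/-- `a ⊗ w ↦ g(a) w`. -/
def cap (g : H →ₗ[k] P) : H ⊗[k] H →ₗ[k] P :=
  TensorProduct.lift (B.r.flip ∘ₗ g)

@[simp] theorem cap_tmul (g : H →ₗ[k] P) (a w : H) : B.cap g (a ⊗ₜ[k] w) = B.r w (g a) := rfl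

theorem cap_add (g g' : H →ₗ[k] P) (t : H ⊗[k] H) :
    B.cap (g + g') t = B.cap g t + B.cap g' t := by
  induction t with
  | zero => simp
  | add x y hx hy => simp only [map_add, hx, hy]; abel
  | tmul a b => simp

variable (k H) in
/-- The regular bimodule. -/
def regular : Bimod k H H where
  l := Algebra.lmul k H
  r := (LinearMap.mul k H).flip
  r_one := by ext; simp
  r_mul a b := by ext; simp [mul_assoc]
  comm a b := by ext; simp [mul_assoc]

@[simp] theorem regular_l (a b : H) : (regular k H).l a b = a * b := rfl
@[simp] theorem regular_r (a b : H) : (regular k H).r a b = b * a := rfl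

variable [QuasiBialgebra k H] {U : Type*} [AddCommGroup U] [Module k U]

/-- `U ⊗ P` with the diagonal left action and the right action on `P`. -/
def tensor (ρ : H →ₐ[k] Module.End k U) : Bimod k H (U ⊗[k] P) where
  l := ρ ⊠ B.l
  r := LinearMap.lTensorHom U ∘ₗ B.r
  r_one := by ext; simp [B.r_one]
  r_mul a b := by ext; simp [B.r_mul]
  comm a b := by
    rw [diagAct_def]
    induction comul (k := k) a with
    | zero => simp
    | add x y hx hy => rw [map_add]; exact hx.add_left hy
    | tmul x y =>
      refine TensorProduct.ext' fun u p => ?_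
      simp [B.l_r]

theorem tensor_l (ρ : H →ₐ[k] Module.End k U) (h : H) :
  (B.tensor ρ).l h = tensorAct ρ B.l (comul h) := rfl

@[simp] theorem tensor_r_tmul (ρ : H →ₐ[k] Module.End k U) (h : H) (u : U) (p : P) :
  (B.tensor ρ).r h (u ⊗ₜ[k] p) = u ⊗ₜ[k] B.r h p := rfl

end Basic

variable {k H P V : Type*} [Field k] [Ring H] [Algebra k H] [QuasiHopfAlgebra k H]
  [AddCommGroup P] [Module k P] [AddCommGroup V] [Module k V]
  (B : Bimod k H P)

/-- `a ⊗ w ↦ (p ↦ a p S(w))`. -/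
def adj : H ⊗[k] H →ₐ[k] Module.End k P :=
  Algebra.TensorProduct.lift B.l
    (AlgHom.ofLinearMap (B.r ∘ₗ (S (k := k) (H := H)).toLinearMap)
      (by simp [S_one, B.r_one]) (fun a b => by simp [S_mul, B.r_mul]))
    (fun a b => B.comm _ _)

@[simp] theorem adj_tmul (u w : H) (p : P) :
    B.adj (u ⊗ₜ[k] w) p = B.l u (B.r (S (k := k) w) p) := by
  unfold adj
  erw [Algebra.TensorProduct.lift_tmul]
  rfl

/-- The adjoint action `h ▷ p = h₁ p S(h₂)`. -/
def ad : H →ₐ[k] Module.End k P := B.adj.comp comul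

theorem ad_apply (h : H) : B.ad h = B.adj (comul h) := rfl

/-- `a ⊗ b ⊗ c ↦ a p S(b) α c`. -/
def evalAt (p : P) : H ⊗[k] (H ⊗[k] H) →ₗ[k] P :=
  B.cap (B.l.toLinearMap.flip p) ∘ₗ LinearMap.lTensor H (evA k H)

@[simp] theorem evalAt_tmul (p : P) (a b c : H) :
    B.evalAt p (a ⊗ₜ[k] (b ⊗ₜ[k] c)) = B.r c (B.r (alpha k) (B.r (S (k := k) b) (B.l a p))) := by
  simp [evalAt, B.r_mul_apply]

theorem evalAt_add (p q : P) (t) : B.evalAt (p + q) t = B.evalAt p t + B.evalAt q t := by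
  simp [evalAt, cap_add]

theorem evalAt_smul (c : k) (p : P) (t) : B.evalAt (c • p) t = c • B.evalAt p t := by
  induction t using tensor_induction₃ with
  | zero => simp
  | add x y hx hy => simp only [map_add, smul_add, hx, hy]
  | tmul a b c => simp

theorem evalAt_zero (t) : B.evalAt 0 t = 0 := by
  have := B.evalAt_smul 0 0 t
  rwa [zero_smul, zero_smul] at this

theorem evalAt_comul (p : P) (u : H) (s : H ⊗[k] (H ⊗[k] H)) :
    B.evalAt p (((1 : H) ⊗ₜ[k] comul u) * s) = (counit u : k) • B.evalAt p s := by
  simp only [evalAt, LinearMap.comp_apply, lTensor_evA_comul, map_smul]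

theorem l_evalAt (p : P) (h : H) (t : H ⊗[k] (H ⊗[k] H)) :
    B.l h (B.evalAt p t) = B.evalAt p ((h ⊗ₜ[k] 1) * t) := by
  induction t using tensor_induction₃ with
  | zero => simp
  | add x y hx hy => simp only [map_add, mul_add, hx, hy]
  | tmul a b c => simp [B.l_r]

theorem evalAt_adj (p : P) (w : H ⊗[k] H) (c : H) (t : H ⊗[k] (H ⊗[k] H)) :
    B.r c (B.evalAt (B.adj w p) t) =
      B.evalAt p (t * TensorProduct.assoc k H H H (w ⊗ₜ[k] c)) := by
  induction w with
  | zero => simp [evalAt_zero]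
  | add x y hx hy => simp only [map_add, TensorProduct.add_tmul, LinearMap.add_apply, evalAt_add,
      mul_add, hx, hy]
  | tmul a b =>
    induction t using tensor_induction₃ with
    | zero => simp
    | add x y hx hy => simp only [map_add, add_mul, hx, hy]
    | tmul x y z => simp [B.r_mul_apply, B.l_r, S_mul]

/-- `E(p) = X¹ p S(X²) α X³`. -/
def eval : P →ₗ[k] P where
  toFun p := B.evalAt p (reassoc k H)
  map_add' p q := B.evalAt_add p q _
  map_smul' c p := B.evalAt_smul c p _

theorem eval_apply (p : P) : B.eval p = B.evalAt p (reassoc k H) := rfl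

/-- `h φ(v) = φ(h₁ v) h₂`. -/
def IsEquivariant (τ : H →ₐ[k] Module.End k V) (φ : V →ₗ[k] P) : Prop :=
  ∀ h v, B.l h (φ v) = B.cap (φ ∘ₗ τ.toLinearMap.flip v) (comul h)

/-- This says that `p ⊗ x ↦ E(p) x` is left `H`-linear; it is the counit of the adjunction between
`V ↦ V ⊗ H` and the adjoint module. -/
theorem isEquivariant_eval : B.IsEquivariant B.ad B.eval := fun h p => by
  have key : ∀ w : H ⊗[k] H, B.cap (B.eval ∘ₗ B.ad.toLinearMap.flip p) w =
      B.evalAt p (reassoc k H * Algebra.TensorProduct.assoc k k k H H H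
          (Algebra.TensorProduct.map comul (AlgHom.id k H) w)) := by
    intro w
    induction w with
    | zero => simp
    | add x y hx hy => simp only [map_add, mul_add, hx, hy]
    | tmul a c => exact B.evalAt_adj p (comul a) c _
  -- `Φ (Δ ⊗ id)Δ(h) = (id ⊗ Δ)Δ(h) Φ`, and `S(·) α (·)` absorbs `Δ` in the last two legs, leaving
  -- `h` on the left.
  rw [key, ← comul_coassoc, absorb_comul_snd (B.evalAt_comul p), eval_apply, l_evalAt]

variable {B} {τ : H →ₐ[k] Module.End k V} {φ : V →ₗ[k] P}

/-- `a ⊗ b ⊗ c ↦ φ(a v) b β S(c)`. -/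
def coevalAt (B : Bimod k H P) (τ : H →ₐ[k] Module.End k V) (φ : V →ₗ[k] P) (v : V) :
    H ⊗[k] (H ⊗[k] H) →ₗ[k] P :=
  B.cap (φ ∘ₗ τ.toLinearMap.flip v) ∘ₗ LinearMap.lTensor H (evB k H)

@[simp] theorem coevalAt_tmul (v : V) (a b c : H) :
    B.coevalAt τ φ v (a ⊗ₜ[k] (b ⊗ₜ[k] c)) =
      B.r (S (k := k) c) (B.r (beta k) (B.r b (φ (τ a v)))) := by
  simp [coevalAt, B.r_mul_apply]

theorem coevalAt_comul (v : V) (u : H) (s : H ⊗[k] (H ⊗[k] H)) :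
    B.coevalAt τ φ v (s * ((1 : H) ⊗ₜ[k] comul u)) = (counit u : k) • B.coevalAt τ φ v s := by
  simp only [coevalAt, LinearMap.comp_apply, lTensor_evB_comul, map_smul]

theorem coevalAt_act (v : V) (h : H) (t : H ⊗[k] (H ⊗[k] H)) :
    B.coevalAt τ φ (τ h v) t = B.coevalAt τ φ v (t * (h ⊗ₜ[k] 1)) := by
  induction t using tensor_induction₃ with
  | zero => simp
  | add x y hx hy => simp only [map_add, add_mul, hx, hy]
  | tmul a b c => simp

theorem adj_coevalAt (hφ : B.IsEquivariant τ φ) (v : V) (a b : H) (t : H ⊗[k] (H ⊗[k] H)) :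
    B.adj (a ⊗ₜ[k] b) (B.coevalAt τ φ v t) =
      B.coevalAt τ φ v (TensorProduct.assoc k H H H (comul a ⊗ₜ[k] b) * t) := by
  induction t using tensor_induction₃ with
  | zero => simp
  | add x y hx hy => simp only [map_add, mul_add, hx, hy]
  | tmul x y z =>
    simp only [adj_tmul, coevalAt_tmul, B.l_r, hφ a]
    induction comul (k := k) a with
    | zero => simp
    | add x y hx hy => simp only [map_add, add_mul, TensorProduct.add_tmul, hx, hy]
    | tmul c d => simp [B.r_mul_apply, S_mul]

/-- The `H`-linear map to the adjoint module `v ↦ φ(x¹ v) x² β S(x³)`. -/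
def colift (hφ : B.IsEquivariant τ φ) : HHom τ B.ad where
  toFun v := B.coevalAt τ φ v (reassocInv k H)
  map_add' v w := by
    induction reassocInv k H using tensor_induction₃ with
    | zero => simp
    | add x y hx hy => simp only [map_add, hx, hy]; abel
    | tmul a b c => simp
  map_smul' c v := by
    induction reassocInv k H using tensor_induction₃ with
    | zero => simp
    | add x y hx hy => simp only [map_add, smul_add, hx, hy]
    | tmul a b c => simp
  map_act' h v := by
    have key : ∀ (w : H ⊗[k] H) t, B.adj w (B.coevalAt τ φ v t) =
        B.coevalAt τ φ v (Algebra.TensorProduct.assoc k k k H H H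
          (Algebra.TensorProduct.map comul (AlgHom.id k H) w) * t) := by
      intro w t
      induction w with
      | zero => simp
      | add x y hx hy => simp only [map_add, add_mul, LinearMap.add_apply, hx, hy]
      | tmul a c => exact adj_coevalAt hφ v a c t
    change B.coevalAt τ φ (τ h v) _ = B.adj (comul h) (B.coevalAt τ φ v _)
    rw [key, comul_coassoc_inv, absorb_comul_snd_right (coevalAt_comul v), coevalAt_act]

theorem colift_apply (hφ : B.IsEquivariant τ φ) (v : V) :
    colift hφ v = B.coevalAt τ φ v (reassocInv k H) := rfl

/-- A triangle identity of the adjunction: transposing the evaluation `E` gives the identity. It is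
what yields uniqueness in `ext_eval`. -/
theorem colift_eval (p : P) : colift (B.isEquivariant_eval) p = p := by
  have key : ∀ s t : H ⊗[k] (H ⊗[k] H),
      (B.cap ((⟨⟨fun p => B.evalAt p s, fun p q => B.evalAt_add p q _⟩,
        fun c p => B.evalAt_smul c p _⟩ : P →ₗ[k] P) ∘ₗ B.ad.toLinearMap.flip p) ∘ₗ
        LinearMap.lTensor H (evB k H)) t =
      (B.cap (B.l.toLinearMap.flip p) ∘ₗ LinearMap.lTensor H (evAB k H))
        (padR k H s * comul₁ k H t) := by
    intro s t
    induction t using tensor_induction₃ with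
    | zero => simp
    | add x y hx hy => simp only [map_add, mul_add, hx, hy]
    | tmul x y z =>
      simp only [LinearMap.comp_apply, LinearMap.lTensor_tmul, cap_tmul, comul₁_tmul,
        LinearMap.coe_mk, AddHom.coe_mk, LinearMap.flip_apply, AlgHom.toLinearMap_apply, ad_apply,
        evalAt_adj]
      induction comul (k := k) x with
      | zero => simp
      | add x y hx hy => simp only [map_add, mul_add, TensorProduct.add_tmul, hx, hy]
      | tmul c d =>
        induction s using tensor_induction₃ with
        | zero => simp
        | add x y hx hy => simp only [map_add, add_mul, hx, hy]
        | tmul a b e => simp [B.r_mul_apply, S_mul]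
  have h₃ : ∀ (u : H) s, (B.cap (B.l.toLinearMap.flip p) ∘ₗ LinearMap.lTensor H (evAB k H))
      (s * ((1 : H) ⊗ₜ[k] ((1 : H) ⊗ₜ[k] comul u))) = (counit u : k) •
      (B.cap (B.l.toLinearMap.flip p) ∘ₗ LinearMap.lTensor H (evAB k H)) s := by
    intro u s
    simp only [LinearMap.comp_apply, lTensor_absorb_right (evAB_comul_snd (k := k) u), map_smul]
  have h₂ : ∀ (u : H) s, (B.cap (B.l.toLinearMap.flip p) ∘ₗ LinearMap.lTensor H (evAB k H))
      (((1 : H) ⊗ₜ[k] TensorProduct.assoc k H H H (comul u ⊗ₜ[k] 1)) * s) = (counit u : k) •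
      (B.cap (B.l.toLinearMap.flip p) ∘ₗ LinearMap.lTensor H (evAB k H)) s := by
    intro u s
    simp only [LinearMap.comp_apply, lTensor_absorb_left (evAB_comul_fst (k := k) u), map_smul]
  refine (key (reassoc k H) (reassocInv k H)).trans ?_
  -- The pentagon turns `(Φ ⊗ 1)(Δ ⊗ id ⊗ id)(Φ⁻¹)` into `1 ⊗ Φ⁻¹` between two absorbed factors, and
  -- `S(x¹) α x² β S(x³) = 1` remains.
  rw [padR_comul₁_inv, absorb_comul₂ h₂ _ counit_reassocInv_mid,
    absorb_comul₃_right h₃ _ counit_reassoc_right]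
  simp [evAB_reassocInv, B.r_one]

/-- `H`-linear maps to the adjoint module are determined by their evaluation. -/
theorem ext_eval {f g : HHom τ B.ad} (h : ∀ v, B.eval (f v) = B.eval (g v)) (v : V) :
    f v = g v := by
  -- By the triangle identity and `H`-linearity, `f` can be reconstructed from `E ∘ f` alone.
  have key : ∀ f : HHom τ B.ad, f v =
      B.coevalAt τ ((B.eval : P →ₗ[k] P) ∘ₗ (f.toLinearMap : V →ₗ[k] P)) v (reassocInv k H) := by
    intro f
    rw [← colift_eval (B := B) (f v), colift_apply]
    induction reassocInv k H using tensor_induction₃ with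
    | zero => simp
    | add x y hx hy => simp only [map_add, hx, hy]
    | tmul a b c => simp [HHom.toLinearMap_apply, HHom.map_act]
  rw [key f, key g]
  congr 1
  have : (B.eval : P →ₗ[k] P) ∘ₗ (f.toLinearMap : V →ₗ[k] P) = B.eval ∘ₗ g.toLinearMap := LinearMap.ext h
  rw [this]

end Bimod

end QuasiHopf

namespace QuasiHopf

open QuasiBialgebra QuasiHopfAlgebra

/-! ### Orbit maps and tensoring with an invariant vector -/

section Orbit

variable {k H M : Type*} [Field k] [Ring H] [Algebra k H] [AddCommGroup M] [Module k M]

/-- The identity as an `H`-linear map. -/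
def HHom.id (ρ : H →ₐ[k] Module.End k M) : HHom ρ ρ := ⟨LinearMap.id, fun _ _ => rfl⟩

theorem HHom.id_apply (ρ : H →ₐ[k] Module.End k M) (m : M) : HHom.id ρ m = m := rfl

/-- The `H`-linear map `a ↦ a·m` from the regular module. -/
def orbit (ρ : H →ₐ[k] Module.End k M) (m : M) : HHom (Algebra.lmul k H) ρ :=
  ⟨ρ.toLinearMap.flip m, fun a b => by simp⟩

theorem orbit_apply (ρ : H →ₐ[k] Module.End k M) (m : M) (a : H) : orbit ρ m a = ρ a m := rfl

@[simp] theorem orbit_one (ρ : H →ₐ[k] Module.End k M) (m : M) : orbit ρ m 1 = m := by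
  simp [orbit_apply]

variable [QuasiBialgebra k H] {N P : Type*} [AddCommGroup N] [Module k N]
  [AddCommGroup P] [Module k P]

/-- `m ↦ m ⊗ u` for an invariant element `u`. -/
def tmulInvariant (ρ : H →ₐ[k] Module.End k M) {σ : H →ₐ[k] Module.End k N} {u : N}
    (hu : IsInvariant σ u) : HHom ρ (ρ ⊠ σ) :=
  ⟨(TensorProduct.mk k M N).flip u, fun h m => by
    have key : ∀ w : H ⊗[k] H, tensorAct ρ σ w (m ⊗ₜ[k] u) =
        TensorProduct.rid k M (LinearMap.lTensor M (Algebra.linearMap k k)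
          (tensorAct ρ (Algebra.lmul k k) (Algebra.TensorProduct.map (AlgHom.id k H) counit w)
            (m ⊗ₜ[k] 1))) ⊗ₜ[k] u := by
      intro w
      induction w with
      | zero => simp
      | add x y hx hy => simp only [map_add, LinearMap.add_apply, TensorProduct.add_tmul, hx, hy]
      | tmul a b => simp [hu b, TensorProduct.smul_tmul]
    change ρ h m ⊗ₜ[k] u = (ρ ⊠ σ) h (m ⊗ₜ[k] u)
    rw [diagAct_def, key, counit_right]
    simp⟩

theorem tmulInvariant_apply (ρ : H →ₐ[k] Module.End k M) {σ : H →ₐ[k] Module.End k N} {u : N}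
    (hu : IsInvariant σ u) (m : M) : tmulInvariant ρ hu m = m ⊗ₜ[k] u := rfl

end Orbit

/-! ### Adjoint modules of tensor product bimodules -/

namespace Bimod

variable {k H P P' V U W : Type*} [Field k] [Ring H] [Algebra k H] [QuasiHopfAlgebra k H]
  [AddCommGroup P] [Module k P] [AddCommGroup P'] [Module k P'] [AddCommGroup V] [Module k V]
  [AddCommGroup U] [Module k U] [AddCommGroup W] [Module k W]
  (B : Bimod k H P) (B' : Bimod k H P')

/-- The evaluation `p ⊗ x ↦ E(p) x`. -/
def evalR : HHom (B.ad ⊠ Algebra.lmul k H) B.l :=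
  ⟨TensorProduct.lift (B.r.flip ∘ₗ B.eval), fun h x => by
    induction x with
    | zero => simp
    | add x y hx hy => simp only [map_add, hx, hy]
    | tmul p x =>
      have := congrArg (B.r x) (B.isEquivariant_eval h p)
      refine Eq.trans ?_ (this.symm.trans (B.l_r h x _).symm)
      rw [diagAct_def]
      induction comul (k := k) h with
      | zero => simp
      | add x y hx hy => simp only [map_add, LinearMap.add_apply, hx, hy]
      | tmul a b => simp [B.r_mul_apply]⟩

theorem evalR_tmul (p : P) (x : H) : B.evalR (p ⊗ₜ[k] x) = B.r x (B.eval p) := rfl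

theorem evalR_one (p : P) : B.evalR (p ⊗ₜ[k] 1) = B.eval p := by
  rw [evalR_tmul, B.r_one]; rfl

variable (ρ : H →ₐ[k] Module.End k U)

theorem adj_tensor (w : H ⊗[k] H) (x : U ⊗[k] P) : (B.tensor ρ).adj w x =
    tensorAct ρ B.adj (Algebra.TensorProduct.assoc k k k H H H
      (Algebra.TensorProduct.map comul (AlgHom.id k H) w)) x := by
  induction w with
  | zero => simp
  | add x y hx hy => simp only [map_add, LinearMap.add_apply, hx, hy]
  | tmul a b =>
    rw [adj_tmul, tensor_l, Algebra.TensorProduct.map_tmul]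
    induction comul (k := k) a with
    | zero => simp
    | add x y hx hy => simp only [map_add, LinearMap.add_apply, TensorProduct.add_tmul, hx, hy]
    | tmul c d =>
      induction x with
      | zero => simp
      | add x y hx hy => simp only [map_add, hx, hy]
      | tmul u p => simp

theorem diagAct_ad (h : H) (x : U ⊗[k] P) : (ρ ⊠ B.ad) h x =
    tensorAct ρ B.adj (Algebra.TensorProduct.map (AlgHom.id k H) comul (comul (k := k) h)) x := by
  rw [← tensorAct_comp]; rfl

/-- `u ⊗ p ↦ x¹·u ⊗ x² p S(x³)`. -/
def assocAd : HHom (ρ ⊠ B.ad) (B.tensor ρ).ad :=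
  ⟨tensorAct ρ B.adj (reassocInv k H), fun h x => by
    rw [diagAct_ad, ad_apply, adj_tensor, ← tensorAct_mul_apply, ← tensorAct_mul_apply,
      comul_coassoc_inv]⟩

theorem assocAd_apply (x : U ⊗[k] P) :
    B.assocAd ρ x = tensorAct ρ B.adj (reassocInv k H) x := rfl

/-- `u ⊗ p ↦ X¹·u ⊗ X² p S(X³)`. -/
def assocAdInv : HHom (B.tensor ρ).ad (ρ ⊠ B.ad) :=
  ⟨tensorAct ρ B.adj (reassoc k H), fun h x => by
    rw [diagAct_ad, ad_apply, adj_tensor, ← tensorAct_mul_apply, ← tensorAct_mul_apply,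
      comul_coassoc]⟩

theorem assocAdInv_apply (x : U ⊗[k] P) :
    B.assocAdInv ρ x = tensorAct ρ B.adj (reassoc k H) x := rfl

@[simp] theorem assocAdInv_assocAd (x : U ⊗[k] P) : B.assocAdInv ρ (B.assocAd ρ x) = x := by
  rw [assocAdInv_apply, assocAd_apply, ← tensorAct_mul_apply, reassoc_mul_inv, map_one]; rfl

@[simp] theorem assocAd_assocAdInv (x : U ⊗[k] P) : B.assocAd ρ (B.assocAdInv ρ x) = x := by
  rw [assocAdInv_apply, assocAd_apply, ← tensorAct_mul_apply, reassocInv_mul, map_one]; rfl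

/-- The identification of `U ⊗ P` with its adjoint version respects evaluation. It extends the
uniqueness principle from adjoint modules to tensor products `U ⊗ P` in `ext_evalR`. -/
theorem eval_assocAd (x : U ⊗[k] P) : (B.tensor ρ).eval (B.assocAd ρ x) =
    whL ρ B.evalR (assocH ρ B.ad (Algebra.lmul k H) (x ⊗ₜ[k] 1)) := by
  induction x with
  | zero => simp
  | add x y hx hy => simp only [TensorProduct.add_tmul, map_add, hx, hy]
  | tmul u p =>
  have key : ∀ s t : H ⊗[k] (H ⊗[k] H),
      (B.tensor ρ).evalAt (tensorAct ρ B.adj t (u ⊗ₜ[k] p)) s =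
      TensorProduct.map (ρ.toLinearMap.flip u) (B.evalAt p) (comul₁ k H s * padR k H t) := by
    intro s t
    induction s using tensor_induction₃ with
    | zero => simp
    | add x y hx hy => simp only [map_add, add_mul, hx, hy]
    | tmul a b c =>
      induction t using tensor_induction₃ with
      | zero => simp
      | add x y hx hy =>
        simp only [map_add, mul_add, LinearMap.add_apply, evalAt_add, hx, hy]
      | tmul x y z =>
        simp only [evalAt_tmul, tensorAct_tmul, adj_tmul, comul₁_tmul, padR_tmul, tensor_l]
        induction comul (k := k) a with
        | zero => simp
        | add x y hx hy =>
          simp only [map_add, add_mul, TensorProduct.add_tmul, LinearMap.add_apply, hx, hy]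
        | tmul c d => simp [B.r_mul_apply, S_mul, B.l_r]
  have key' : ∀ t : H ⊗[k] (H ⊗[k] H),
      TensorProduct.map (ρ.toLinearMap.flip u) (B.evalAt p)
        (padL k H (reassoc k H) * comul₂ k H t) =
      whL ρ B.evalR (tensorAct ρ (tensorAct B.ad (Algebra.lmul k H)) t
        (u ⊗ₜ[k] (p ⊗ₜ[k] 1))) := by
    intro t
    induction t using tensor_induction₃ with
    | zero => simp
    | add x y hx hy => simp only [map_add, mul_add, LinearMap.add_apply, hx, hy]
    | tmul x y z => simp [whL_tmul, evalR_tmul, eval_apply, ad_apply, evalAt_adj]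
  have h₃ : ∀ (a : H) s, TensorProduct.map (ρ.toLinearMap.flip u) (B.evalAt p)
      (((1 : H) ⊗ₜ[k] ((1 : H) ⊗ₜ[k] comul a)) * s) = (counit a : k) •
      TensorProduct.map (ρ.toLinearMap.flip u) (B.evalAt p) s := by
    intro a s
    induction s with
    | zero => simp
    | add x y hx hy => simp only [map_add, mul_add, smul_add, hx, hy]
    | tmul x y => simp [evalAt_comul]
  -- By the pentagon `(Δ ⊗ id ⊗ id)(Φ)(Φ⁻¹ ⊗ 1)` becomes `(1 ⊗ Φ)(id ⊗ Δ ⊗ id)(Φ)` up to an absorbed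
  -- factor on the left: the outer `Φ` is the constraint, the inner one belongs to `E`.
  rw [eval_apply, assocAd_apply, key, comul₁_padR_inv,
    absorb_comul₃ h₃ _ counit_reassocInv_right, key']
  rfl

/-- Two `H`-linear maps to `U ⊗ B` agree if their evaluations do. -/
theorem ext_evalR {B : Bimod k H P} {ρ : H →ₐ[k] Module.End k U} {τ : H →ₐ[k] Module.End k V}
    {f g : HHom τ (ρ ⊠ B.ad)}
    (h : ∀ v, whL ρ B.evalR (assocH ρ B.ad (Algebra.lmul k H) (f v ⊗ₜ[k] 1)) =
      whL ρ B.evalR (assocH ρ B.ad (Algebra.lmul k H) (g v ⊗ₜ[k] 1))) (v : V) : f v = g v := by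
  have := ext_eval (f := (B.assocAd ρ).comp f) (g := (B.assocAd ρ).comp g) (fun v => by
    rw [HHom.comp_apply, HHom.comp_apply, eval_assocAd, eval_assocAd, h]) v
  simpa only [HHom.comp_apply, assocAdInv_assocAd] using congrArg (B.assocAdInv ρ) this

variable {B B'}

/-- A morphism of bimodules is a morphism of the adjoint modules. -/
def adMap (f : HHom B.l B'.l) (hf : ∀ x p, f (B.r x p) = B'.r x (f p)) : HHom B.ad B'.ad :=
  ⟨f.toLinearMap, fun h p => by
    rw [ad_apply, ad_apply]
    induction comul (k := k) h with
    | zero => simp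
    | add x y hx hy => simp only [map_add, LinearMap.add_apply, hx, hy]
    | tmul a b => simp only [adj_tmul, HHom.toLinearMap_apply, HHom.map_act, hf]⟩

theorem adMap_apply (f : HHom B.l B'.l) (hf : ∀ x p, f (B.r x p) = B'.r x (f p)) (p : P) :
    adMap f hf p = f p := rfl

theorem eval_adMap (f : HHom B.l B'.l) (hf : ∀ x p, f (B.r x p) = B'.r x (f p)) (p : P) :
    B'.eval (adMap f hf p) = f (B.eval p) := by
  rw [eval_apply, eval_apply]
  induction reassoc k H using tensor_induction₃ with
  | zero => simp
  | add x y hx hy => simp only [map_add, hx, hy]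
  | tmul a b c => simp only [evalAt_tmul, adMap_apply, hf, HHom.map_act]

end Bimod

/-! ### The multiplication of `H₀` -/

section Mul

variable {k H M N V U W : Type*} [Field k] [Ring H] [Algebra k H] [QuasiHopfAlgebra k H]
  [AddCommGroup M] [Module k M] [AddCommGroup N] [Module k N]

open QuasiHopf.Bimod

variable (k H) in
/-- The underlying module of `H₀`. -/
abbrev zAct : H →ₐ[k] Module.End k H := (Bimod.regular k H).ad

/-- The evaluation `z ⊗ m ↦ E(z)·m`. -/
def evalAct (τ : H →ₐ[k] Module.End k M) : HHom (zAct k H ⊠ τ) τ :=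
  ⟨TensorProduct.lift (τ.toLinearMap ∘ₗ (Bimod.regular k H).eval), fun h x => by
    induction x with
    | zero => simp
    | add x y hx hy => simp only [map_add, hx, hy]
    | tmul z m =>
      have := congrArg (orbit τ m) ((Bimod.regular k H).isEquivariant_eval h z)
      rw [regular_l, orbit_apply, map_mul] at this
      refine Eq.trans ?_ this.symm
      rw [diagAct_def]
      induction comul (k := k) h with
      | zero => simp
      | add x y hx hy => simp only [map_add, LinearMap.add_apply, hx, hy]
      | tmul a b => simp [orbit_apply]⟩

theorem evalAct_tmul (τ : H →ₐ[k] Module.End k M) (z : H) (m : M) :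
    evalAct τ (z ⊗ₜ[k] m) = τ ((Bimod.regular k H).eval z) m := rfl

theorem evalAct_whL {τ : H →ₐ[k] Module.End k M} {υ : H →ₐ[k] Module.End k N} (f : HHom τ υ)
    (x : H ⊗[k] M) : evalAct υ (whL (zAct k H) f x) = f (evalAct τ x) := by
  induction x with
  | zero => simp
  | add x y hx hy => simp only [map_add, hx, hy]
  | tmul z m => simp [whL_tmul, evalAct_tmul, HHom.map_act]

theorem evalAct_lmul (x : H ⊗[k] H) :
    evalAct (Algebra.lmul k H) x = (Bimod.regular k H).evalR x := rfl

/-- `Z ⊗ P → P` is a morphism of bimodules. -/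
theorem evalAct_tensor_r (B : Bimod k H M) (x : H) (y : H ⊗[k] M) :
    evalAct B.l ((B.tensor (zAct k H)).r x y) = B.r x (evalAct B.l y) := by
  induction y with
  | zero => simp
  | add x y hx hy => simp only [map_add, hx, hy]
  | tmul z m => simp [evalAct_tmul, l_r]

/-- `Z ⊗ B → B` on adjoint modules, `z ⊗ p ↦ E(y¹ ▷ z) y² p S(y³)`. -/
def adAct (B : Bimod k H M) : HHom (zAct k H ⊠ B.ad) B.ad :=
  (adMap (B := B.tensor (zAct k H)) (evalAct B.l) (evalAct_tensor_r B)).comp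
    (B.assocAd (zAct k H))

theorem adAct_apply (B : Bimod k H M) (x : H ⊗[k] M) :
    adAct B x = evalAct B.l (tensorAct (zAct k H) B.adj (reassocInv k H) x) := rfl

/-- This property characterizes `adAct`: evaluating `z · p` is evaluating `p` and then acting by
`z`, up to the constraint. -/
theorem eval_adAct (B : Bimod k H M) (x : H ⊗[k] M) :
    B.eval (adAct B x) = evalAct B.l (whL (zAct k H) B.evalR
      (assocH (zAct k H) B.ad (Algebra.lmul k H) (x ⊗ₜ[k] 1))) := by
  refine (eval_adMap (B := B.tensor (zAct k H)) (evalAct B.l) (evalAct_tensor_r B) _).trans ?_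
  exact congrArg (evalAct B.l) (B.eval_assocAd _ x)

variable (k H) in
theorem isInvariant_beta : IsInvariant (zAct k H) (beta k) := fun h => by
  rw [ad_apply, ← evB_comul]
  induction comul (k := k) h with
  | zero => simp
  | add x y hx hy => simp only [map_add, LinearMap.add_apply, hx, hy]
  | tmul a b => simp [mul_assoc]

variable (k H) in
-- This is the axiom `X¹ β S(X²) α X³ = 1`; hence `β` acts as the identity on every module, which
-- singles it out as the unit of `H₀`.
theorem eval_beta : (Bimod.regular k H).eval (beta k) = 1 := by
  rw [eval_apply, ← evBA_reassoc (k := k)]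
  induction reassoc k H using tensor_induction₃ with
  | zero => simp
  | add x y hx hy => simp only [map_add, hx, hy]
  | tmul a b c => simp [mul_assoc]

theorem evalAct_beta (τ : H →ₐ[k] Module.End k M) (m : M) :
    evalAct τ ((beta k : H) ⊗ₜ[k] m) = m := by
  rw [evalAct_tmul, eval_beta, map_one]; rfl

variable (k H) in
/-- The multiplication of `H₀`. -/
def zMul : HHom (zAct k H ⊠ zAct k H) (zAct k H) := adAct (Bimod.regular k H)

/-- Every `H`-module is a module over `H₀`. By `ext_eval` this property determines the product. -/
theorem evalAct_zMul (τ : H →ₐ[k] Module.End k M) (x : (H ⊗[k] H) ⊗[k] M) :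
    evalAct τ (whR τ (zMul k H) x) =
      evalAct τ (whL (zAct k H) (evalAct τ) (assocH (zAct k H) (zAct k H) τ x)) := by
  induction x with
  | zero => simp
  | add x y hx hy => simp only [map_add, hx, hy]
  | tmul x m =>
    have h := congrArg (orbit τ m) (eval_adAct (Bimod.regular k H) x)
    -- Since `m` is the image of `1` under an `H`-linear map from the regular module, naturality
    -- reduces the claim to that module.
    have h1 : x ⊗ₜ[k] m = whL (zAct k H ⊠ zAct k H) (orbit τ m) (x ⊗ₜ[k] 1) := by
      rw [whL_tmul, orbit_one]
    have h2 : ∀ y, whL (zAct k H) (evalAct τ) (whL (zAct k H) (whL (zAct k H) (orbit τ m)) y) =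
        whL (zAct k H) (orbit τ m) (whL (zAct k H) (evalAct (Algebra.lmul k H)) y) := by
      intro y
      rw [whL_comp_apply, whL_comp_apply]
      exact whL_congr (fun z => evalAct_whL (orbit τ m) z) y
    rw [whR_tmul, evalAct_tmul, h1, ← whL_assocH, h2, evalAct_whL]
    exact h

theorem isModuleAlgebra_of_zMul (A : ModAlgData k H H) (hact : A.act = zAct k H)
    (hmul : ∀ x, A.mul x = zMul k H x) (hone : A.one = beta k) : IsModuleAlgebra A := by
  obtain ⟨act, mul, one⟩ := A
  obtain rfl : act = zAct k H := hact
  obtain rfl : mul = (zMul k H).toLinearMap := LinearMap.ext hmul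
  obtain rfl : one = beta k := hone
  refine ⟨fun a b c => ?_, fun a => ?_, fun a => ?_, fun h a b => ?_, isInvariant_beta k H⟩
  -- Both bracketings of a triple product act on the regular module by the same threefold action, so
  -- they coincide.
  · refine ext_eval (B := Bimod.regular k H)
      (f := (zMul k H).comp (whR _ (zMul k H)))
      (g := ((zMul k H).comp (whL _ (zMul k H))).comp (assocH _ _ _))
      (fun x => ?_) ((a ⊗ₜ[k] b) ⊗ₜ[k] c)
    rw [← evalR_one, ← evalR_one, ← evalAct_lmul, ← evalAct_lmul]
    simp only [HHom.comp_apply]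
    rw [← whR_tmul (ρ := Algebra.lmul k H) (zMul k H),
      ← whR_tmul (ρ := Algebra.lmul k H) (zMul k H), evalAct_zMul, evalAct_zMul,
      ← whR_tmul (ρ := Algebra.lmul k H) (whR _ (zMul k H)), ← whR_assocH, whL_whR,
      evalAct_zMul, ← whL_assocH, ← whR_tmul (ρ := Algebra.lmul k H) (whL _ (zMul k H)),
      ← whM_assocH, ← whR_tmul (ρ := Algebra.lmul k H) (assocH _ _ _), pentagonH,
      whL_comp_apply, whL_comp_apply, whL_comp_apply]
    congr 1
    refine whL_congr (fun y => ?_) _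
    simp only [HHom.comp_apply]
    exact (evalAct_zMul _ _).symm
  · change zMul k H _ = _
    rw [zMul, adAct_apply, tensorAct_invariant_left (isInvariant_beta k H),
      counit_reassocInv_left, map_one]
    exact evalAct_beta _ _
  · refine ext_eval (B := Bimod.regular k H)
      (f := (zMul k H).comp (tmulInvariant _ (isInvariant_beta k H)))
      (g := HHom.id _) (fun x => ?_) a
    rw [HHom.comp_apply, tmulInvariant_apply, HHom.id_apply, zMul, eval_adAct,
      assocH_invariant_mid (isInvariant_beta k H), whL_tmul, ← evalAct_lmul, evalAct_beta,
      evalAct_tmul]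
    simp
  · exact ((zMul k H).map_act h (a ⊗ₜ[k] b)).symm

end Mul

end QuasiHopf

namespace QuasiHopf

open QuasiBialgebra QuasiHopfAlgebra

/-! ### The half-braiding of `H₀` -/

section HalfBraiding

variable {k H M N P Q : Type*} [Field k] [Ring H] [Algebra k H] [QuasiHopfAlgebra k H]
  [AddCommGroup M] [Module k M] [AddCommGroup N] [Module k N] [AddCommGroup P] [Module k P]
  [AddCommGroup Q] [Module k Q]
  (ρ : H →ₐ[k] Module.End k M) (σ : H →ₐ[k] Module.End k N) (τ : H →ₐ[k] Module.End k P)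
  (υ : H →ₐ[k] Module.End k Q)

open QuasiHopf.Bimod

/-- `u ↦ x¹·u ⊗ x² β S(x³)`. -/
def zCoev : HHom ρ ((Bimod.regular k H).tensor ρ).ad :=
  ((Bimod.regular k H).assocAd ρ).comp (tmulInvariant ρ (isInvariant_beta k H))

theorem zCoev_apply (u : M) :
    zCoev ρ u = (Bimod.regular k H).assocAd ρ (u ⊗ₜ[k] (beta k : H)) := rfl

/-- `zCoev` is the transpose of the identity of `U ⊗ H`; this is the corresponding triangle
identity. -/
theorem evalR_zCoev (x : M ⊗[k] H) : ((Bimod.regular k H).tensor ρ).evalR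
    (whR (Algebra.lmul k H) (zCoev ρ) x) = x := by
  induction x with
  | zero => simp
  | add x y hx hy => simp only [map_add, hx, hy]
  | tmul u h =>
    rw [whR_tmul, evalR_tmul, zCoev_apply, eval_assocAd,
      assocH_invariant_mid (isInvariant_beta k H), whL_tmul, ← evalAct_lmul, evalAct_beta]
    simp

/-- The half-braiding of `H₀`. -/
def zBraid : HHom (zAct k H ⊠ ρ) (ρ ⊠ zAct k H) :=
  ((Bimod.regular k H).assocAdInv ρ).comp
    ((adAct ((Bimod.regular k H).tensor ρ)).comp (whL (zAct k H) (zCoev ρ)))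

theorem zBraid_apply (x : H ⊗[k] M) : zBraid ρ x = (Bimod.regular k H).assocAdInv ρ
    (adAct ((Bimod.regular k H).tensor ρ) (whL (zAct k H) (zCoev ρ) x)) := rfl

variable {ρ σ τ υ}

theorem evalR_zBraid (x : H ⊗[k] M) :
    whL ρ (Bimod.regular k H).evalR
      (assocH ρ (zAct k H) (Algebra.lmul k H) (zBraid ρ x ⊗ₜ[k] 1)) =
    evalAct (ρ ⊠ Algebra.lmul k H) (assocH (zAct k H) ρ (Algebra.lmul k H) (x ⊗ₜ[k] 1)) := by
  rw [← eval_assocAd, zBraid_apply, assocAd_assocAdInv, eval_adAct,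
    ← whR_tmul (ρ := Algebra.lmul k H) (whL (zAct k H) (zCoev ρ)), ← whM_assocH, whL_comp_apply]
  refine congrArg (evalAct (ρ ⊠ Algebra.lmul k H)) ?_
  exact (whL_congr (g := HHom.id (ρ ⊠ Algebra.lmul k H)) (evalR_zCoev ρ) _).trans
    (LinearMap.congr_fun (LinearMap.lTensor_id H (M ⊗[k] H)) _)

/-- The defining property of the half-braiding: to act by `z` on `U ⊗ N`, pass `U` and act on `N`.
By `ext_evalAct` it determines `zBraid`, so the laws below need no formula for it. -/
theorem evalAct_zBraid (x : (H ⊗[k] M) ⊗[k] N) :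
    whL ρ (evalAct σ) (assocH ρ (zAct k H) σ (whR σ (zBraid ρ) x)) =
      evalAct (ρ ⊠ σ) (assocH (zAct k H) ρ σ x) := by
  induction x with
  | zero => simp
  | add x y hx hy => simp only [map_add, hx, hy]
  | tmul x m =>
    have h := congrArg (whL ρ (orbit σ m)) (evalR_zBraid (ρ := ρ) x)
    have h1 : x ⊗ₜ[k] m = whL (zAct k H ⊠ ρ) (orbit σ m) (x ⊗ₜ[k] 1) := by
      rw [whL_tmul, orbit_one]
    have h2 : ∀ y, whL ρ (evalAct σ) (whL ρ (whL (zAct k H) (orbit σ m)) y) =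
        whL ρ (orbit σ m) (whL ρ (evalAct (Algebra.lmul k H)) y) := by
      intro y
      rw [whL_comp_apply, whL_comp_apply]
      exact whL_congr (fun z => evalAct_whL (orbit σ m) z) y
    rw [h1, ← whL_whR, ← whL_assocH, ← whL_assocH, evalAct_whL, h2]
    exact h

/-- `H`-linear maps to `U ⊗ H₀` agree if their evaluations on the regular module do. -/
theorem ext_evalAct {f g : HHom τ (ρ ⊠ zAct k H)}
    (h : ∀ x, whL ρ (evalAct (Algebra.lmul k H))
        (assocH ρ (zAct k H) (Algebra.lmul k H) (whR (Algebra.lmul k H) f x)) =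
      whL ρ (evalAct (Algebra.lmul k H))
        (assocH ρ (zAct k H) (Algebra.lmul k H) (whR (Algebra.lmul k H) g x))) (v : P) :
    f v = g v :=
  ext_evalR (B := Bimod.regular k H) (fun v => h (v ⊗ₜ[k] 1)) v

theorem zBraid_whL {ρ' : H →ₐ[k] Module.End k N} (f : HHom ρ ρ') (x : H ⊗[k] M) :
    zBraid ρ' (whL (zAct k H) f x) = whR (zAct k H) f (zBraid ρ x) := by
  refine ext_evalAct (f := (zBraid ρ').comp (whL (zAct k H) f))
    (g := (whR (zAct k H) f).comp (zBraid ρ)) (fun y => ?_) x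
  rw [← whR_comp_apply, evalAct_zBraid, ← whM_assocH, evalAct_whL, ← whR_comp_apply,
    ← whR_assocH, whL_whR, evalAct_zBraid]

/-- Passing `U ⊗ V` at once or in two steps must give the same map, since both describe the action
of `z` on `U ⊗ (V ⊗ N)`. -/
theorem zBraid_hexagon (x : (H ⊗[k] M) ⊗[k] N) :
    assocH ρ σ (zAct k H) (zBraid (ρ ⊠ σ) (assocH (zAct k H) ρ σ x)) =
      whL ρ (zBraid σ) (assocH ρ (zAct k H) σ (whR σ (zBraid ρ) x)) := by
  set r : HHom ((zAct k H ⊠ ρ) ⊠ σ) (ρ ⊠ (σ ⊠ zAct k H)) :=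
    (whL ρ (zBraid σ)).comp ((assocH ρ (zAct k H) σ).comp (whR σ (zBraid ρ))) with hr
  have main : zBraid (ρ ⊠ σ) (assocH (zAct k H) ρ σ x) = assocInvH ρ σ (zAct k H) (r x) := by
    refine ext_evalAct (f := (zBraid (ρ ⊠ σ)).comp (assocH (zAct k H) ρ σ))
      (g := (assocInvH ρ σ (zAct k H)).comp r) (fun y => ?_) x
    apply (Function.LeftInverse.injective (assocInvH_assocH ρ σ (Algebra.lmul k H)))
    have e1 : ∀ z, whL ρ (whL σ (evalAct (Algebra.lmul k H))) (whL ρ (assocH σ (zAct k H)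
        (Algebra.lmul k H)) (whL ρ (whR (Algebra.lmul k H) (zBraid σ)) z)) =
        whL ρ (evalAct (σ ⊠ Algebra.lmul k H)) (whL ρ (assocH (zAct k H) σ (Algebra.lmul k H))
          z) := by
      intro z
      rw [whL_comp_apply, whL_comp_apply, whL_comp_apply]
      exact whL_congr (fun z => evalAct_zBraid z) z
    have e2 : ∀ z, whR (Algebra.lmul k H) (assocH ρ σ (zAct k H)) (whR (Algebra.lmul k H)
        (assocInvH ρ σ (zAct k H)) z) = z := by
      intro z
      rw [whR_comp_apply]
      exact (whR_congr (g := HHom.id _) (assocH_assocInvH _ _ _) z).trans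
        (LinearMap.congr_fun (LinearMap.rTensor_id _ _) z)
    rw [← whR_comp_apply, evalAct_zBraid, ← whR_comp_apply, ← evalAct_whL,
      ← whL_assocH, pentagonH, e2, ← pentagonH, hr, ← whR_comp_apply, ← whR_comp_apply,
      ← whM_assocH, e1, ← pentagonH, ← whR_assocH, evalAct_zBraid]
  rw [main, assocH_assocInvH]
  rfl

/-- Both sides describe acting by `z z'` on `U ⊗ N`: on one side through the product, on the other
by successive actions of `z'` and `z`. -/
theorem zBraid_zMul (x : (H ⊗[k] H) ⊗[k] M) :
    zBraid ρ (whR ρ (zMul k H) x) = whL ρ (zMul k H) (assocH ρ (zAct k H) (zAct k H)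
      (whR (zAct k H) (zBraid ρ) (assocInvH (zAct k H) ρ (zAct k H)
        (whL (zAct k H) (zBraid ρ) (assocH (zAct k H) (zAct k H) ρ x))))) := by
  refine ext_evalAct (f := (zBraid ρ).comp (whR ρ (zMul k H)))
    (g := (whL ρ (zMul k H)).comp ((assocH ρ (zAct k H) (zAct k H)).comp
      ((whR (zAct k H) (zBraid ρ)).comp ((assocInvH (zAct k H) ρ (zAct k H)).comp
        ((whL (zAct k H) (zBraid ρ)).comp (assocH (zAct k H) (zAct k H) ρ))))))
    (fun y => ?_) x
  have e1 : ∀ z, whL ρ (evalAct (Algebra.lmul k H)) (whL ρ (whR (Algebra.lmul k H) (zMul k H))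
      z) = whL ρ (evalAct (Algebra.lmul k H)) (whL ρ (whL (zAct k H) (evalAct
        (Algebra.lmul k H))) (whL ρ (assocH (zAct k H) (zAct k H) (Algebra.lmul k H)) z)) := by
    intro z
    rw [whL_comp_apply, whL_comp_apply, whL_comp_apply]
    exact whL_congr (fun z => evalAct_zMul _ z) z
  have e2 : ∀ z, whR (Algebra.lmul k H) (assocH (zAct k H) ρ (zAct k H))
      (whR (Algebra.lmul k H) (assocInvH (zAct k H) ρ (zAct k H)) z) = z := by
    intro z
    rw [whR_comp_apply]
    exact (whR_congr (g := HHom.id _) (assocH_assocInvH _ _ _) z).trans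
      (LinearMap.congr_fun (LinearMap.rTensor_id _ _) z)
  have e3 : ∀ z, whL (zAct k H) (whL ρ (evalAct (Algebra.lmul k H))) (whL (zAct k H)
      (assocH ρ (zAct k H) (Algebra.lmul k H)) (whL (zAct k H) (whR (Algebra.lmul k H)
        (zBraid ρ)) z)) = whL (zAct k H) (evalAct (ρ ⊠ Algebra.lmul k H)) (whL (zAct k H)
          (assocH (zAct k H) ρ (Algebra.lmul k H)) z) := by
    intro z
    rw [whL_comp_apply, whL_comp_apply, whL_comp_apply]
    exact whL_congr (fun z => evalAct_zBraid z) z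
  simp only [← whR_comp_apply]
  rw [evalAct_zBraid, ← whR_assocH, evalAct_zMul, ← whM_assocH, e1, ← pentagonH, whL_assocH,
    ← whR_assocH, whL_whR, evalAct_zBraid, ← whL_assocH,
    pentagonH (whR _ (assocInvH (zAct k H) ρ (zAct k H)) _), e2, ← whM_assocH, e3, ← pentagonH]

theorem adAct_beta (B : Bimod k H M) (p : M) : adAct B ((beta k : H) ⊗ₜ[k] p) = p := by
  rw [adAct_apply, tensorAct_invariant_left (isInvariant_beta k H), counit_reassocInv_left,
    map_one]
  exact evalAct_beta _ _

theorem zBraid_beta (u : M) : zBraid ρ ((beta k : H) ⊗ₜ[k] u) = u ⊗ₜ[k] beta k := by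
  rw [zBraid_apply, whL_tmul, adAct_beta, zCoev_apply, assocAdInv_assocAd]

theorem zBraid_invariant {u : M} (hu : IsInvariant ρ u) (z : H) :
    zBraid ρ (z ⊗ₜ[k] u) = u ⊗ₜ[k] z := by
  refine ext_evalR (B := Bimod.regular k H)
    (f := (zBraid ρ).comp (tmulInvariant (zAct k H) hu))
    (g := (⟨TensorProduct.mk k M H u, fun h m => (diagAct_invariant_left hu h m).symm⟩ :
      HHom (zAct k H) (ρ ⊠ zAct k H))) (fun z => ?_) z
  rw [HHom.comp_apply, tmulInvariant_apply, evalR_zBraid, assocH_invariant_mid hu]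
  change _ = whL ρ _ (assocH ρ _ _ ((u ⊗ₜ[k] z) ⊗ₜ[k] (1 : H)))
  rw [assocH_invariant_left hu, whL_tmul, ← evalAct_lmul, evalAct_tmul, evalAct_tmul,
    diagAct_invariant_left hu]

variable {coact : H →ₗ[k] H ⊗[k] H}

/-- A natural family is determined by its value at `1` in the regular module: transport along the
orbit map of `m`. -/
theorem coactTwist_eq_zBraid
    (hcoact : ∀ z, coact z = zBraid (Algebra.lmul k H) (z ⊗ₜ[k] 1)) (x : H ⊗[k] M) :
    coactTwist ρ coact x = zBraid ρ x := by
  induction x with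
  | zero => simp
  | add x y hx hy => simp only [map_add, hx, hy]
  | tmul z m =>
    have : z ⊗ₜ[k] m = whL (zAct k H) (orbit ρ m) (z ⊗ₜ[k] 1) := by rw [whL_tmul, orbit_one]
    rw [coactTwist_tmul, hcoact, this, zBraid_whL]
    rfl

theorem zBraid_eq_braid (hcoact : ∀ z, coact z = zBraid (Algebra.lmul k H) (z ⊗ₜ[k] 1))
    (hc : IsCompatible (zAct k H) coact) (ρ : H →ₐ[k] Module.End k M) :
    zBraid ρ = braid hc ρ :=
  DFunLike.ext _ _ fun x => (coactTwist_eq_zBraid hcoact x).symm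

/-- The coaction laws are translated from the properties of `zBraid`. For `H₀` this leaves only the
identification of its explicit product and coaction with `zMul` and `zBraid`. -/
theorem isYetterDrinfeldAlgebra_of_zBraid {Z : YDAlgData k H H} (hact : Z.act = zAct k H)
    (hmul : ∀ x, Z.mul x = zMul k H x) (hone : Z.one = beta k)
    (hcoact : ∀ z, Z.coact z = zBraid (Algebra.lmul k H) (z ⊗ₜ[k] 1)) :
    IsYetterDrinfeldAlgebra Z := by
  have hM := isModuleAlgebra_of_zMul Z.toModAlgData hact hmul hone
  obtain ⟨⟨act, mul, one⟩, coact⟩ := Z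
  obtain rfl : act = zAct k H := hact
  obtain rfl : mul = (zMul k H).toLinearMap := LinearMap.ext hmul
  obtain rfl : one = beta k := hone
  replace hcoact : ∀ z, coact z = zBraid (Algebra.lmul k H) (z ⊗ₜ[k] 1) := hcoact
  have hc : IsCompatible (zAct k H) coact := isCompatible_of_coactTwist fun h x => by
    rw [coactTwist_eq_zBraid hcoact, coactTwist_eq_zBraid hcoact, HHom.map_act]
  refine ⟨⟨isCoassociative_of_hexagon hc fun x => ?_, fun z => ?_, hc⟩, hM, ?_, fun a b => ?_⟩
  · rw [← zBraid_eq_braid hcoact, ← zBraid_eq_braid hcoact, zBraid_hexagon]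
  · have h := zBraid_invariant (isInvariant_trivAct (k := k) (H := H)) z
    rw [zBraid_eq_braid hcoact hc, braid_tmul, applyFst_trivAct] at h
    simpa using congrArg (TensorProduct.lid k H) h
  · exact (hcoact _).trans (zBraid_beta _)
  · have h := zBraid_zMul (ρ := Algebra.lmul k H) ((a ⊗ₜ[k] b) ⊗ₜ[k] (1 : H))
    rw [zBraid_eq_braid hcoact hc] at h
    have h' := braid_tensor hc hc (isCompatible_tensorCoact hc hc)
      ((a ⊗ₜ[k] b) ⊗ₜ[k] (1 : H)) (υ := Algebra.lmul k H)
    rw [tb_apply] at h'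
    rw [← h', whR_tmul, braid_tmul, braid_tmul, applyFst_one, applyFst_one] at h
    exact h

end HalfBraiding

end QuasiHopf

namespace QuasiHopf

open QuasiBialgebra QuasiHopfAlgebra

/-! ### The Drinfeld twist -/

section Twist

variable (k H : Type*) [Field k] [Ring H] [Algebra k H] [QuasiHopfAlgebra k H]

@[simp] theorem flipSS_tmul (a b : H) :
    flipSS k H (a ⊗ₜ[k] b) = S (k := k) b ⊗ₜ[k] S (k := k) a := rfl

variable {k H} in
theorem flipSS_mul (s t : H ⊗[k] H) : flipSS k H (s * t) = flipSS k H t * flipSS k H s := by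
  induction s with
  | zero => simp
  | add x y hx hy => simp only [map_add, add_mul, mul_add, hx, hy]
  | tmul a b =>
    induction t with
    | zero => simp
    | add x y hx hy => simp only [map_add, add_mul, mul_add, hx, hy]
    | tmul c d => simp [S_mul]

/-- `h ↦ (S ⊗ S)(Δᶜᵒᵖ(h))`. -/
def coS : H →ₗ[k] H ⊗[k] H := flipSS k H ∘ₗ (comul (k := k) (H := H)).toLinearMap

variable {k H}

theorem coS_apply (h : H) : coS k H h = flipSS k H (comul h) := rfl

theorem coS_mul (a b : H) : coS k H (a * b) = coS k H b * coS k H a := by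
  rw [coS_apply, map_mul, flipSS_mul]; rfl

theorem twoSided_tmul {B : Type*} [Ring B] [Algebra k B] (u v x : B) :
    twoSided (k := k) B (u ⊗ₜ[k] v) x = u * x * v := by
  simp [twoSided, sandwich_tmul]

variable (k H)

/-- `q ⊗ w ↦ q (β ⊗ β) (S(w₂) ⊗ S(w₁))`. -/
def coevPair : (H ⊗[k] H) ⊗[k] (H ⊗[k] H) →ₗ[k] H ⊗[k] H :=
  LinearMap.mul' k (H ⊗[k] H) ∘ₗ
    TensorProduct.map (LinearMap.mulRight k ((beta k : H) ⊗ₜ[k] (beta k : H))) (flipSS k H)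

/-- `a ⊗ b ⊗ c ↦ (a ⊗ b) ⊗ (c ⊗ 1)`. -/
def padPair : H ⊗[k] (H ⊗[k] H) →ₐ[k] (H ⊗[k] H) ⊗[k] (H ⊗[k] H) :=
  (Algebra.TensorProduct.assoc k k k H H (H ⊗[k] H)).symm.toAlgHom.comp (padR k H)

/-- `a ⊗ b ↦ (a ⊗ 1) ⊗ (1 ⊗ b)`. -/
def padOuter : H ⊗[k] H →ₐ[k] (H ⊗[k] H) ⊗[k] (H ⊗[k] H) :=
  Algebra.TensorProduct.map (Algebra.TensorProduct.includeLeft : H →ₐ[k] H ⊗[k] H)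
    (Algebra.TensorProduct.includeRight : H →ₐ[k] H ⊗[k] H)

/-- `Δ ⊗ id`. -/
def comulL (T : Type*) [Ring T] [Algebra k T] : H ⊗[k] T →ₐ[k] (H ⊗[k] H) ⊗[k] T :=
  Algebra.TensorProduct.map comul (AlgHom.id k T)

variable {k H}

@[simp] theorem coevPair_tmul (q w : H ⊗[k] H) : coevPair k H (q ⊗ₜ[k] w) =
    q * ((beta k : H) ⊗ₜ[k] (beta k : H)) * flipSS k H w := rfl

@[simp] theorem padPair_tmul (a b c : H) : padPair k H (a ⊗ₜ[k] (b ⊗ₜ[k] c)) =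
    (a ⊗ₜ[k] b) ⊗ₜ[k] (c ⊗ₜ[k] 1) := rfl

@[simp] theorem padOuter_tmul (a b : H) :
    padOuter k H (a ⊗ₜ[k] b) = (a ⊗ₜ[k] 1) ⊗ₜ[k] (1 ⊗ₜ[k] b) := rfl

@[simp] theorem comulL_tmul {T : Type*} [Ring T] [Algebra k T] (a : H) (t : T) :
    comulL k H T (a ⊗ₜ[k] t) = comul a ⊗ₜ[k] t := rfl

theorem delta_eq : delta k H =
    coevPair k H (comulL k H (H ⊗[k] H) (reassoc k H) * padPair k H (reassocInv k H)) := by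
  have key : ∀ (t : (H ⊗[k] H) ⊗[k] (H ⊗[k] H)) x, twoSided (H ⊗[k] H) (LinearMap.lTensor (H ⊗[k] H) (flipSS k H) t) x =
      LinearMap.mul' k (H ⊗[k] H) (TensorProduct.map (LinearMap.mulRight k x) (flipSS k H) t) := by
    intro t x
    induction t with
    | zero => simp
    | add x y hx hy => simp only [map_add, LinearMap.add_apply, hx, hy]
    | tmul a b => simp [twoSided_tmul (k := k)]
  exact key _ _

/-- In `δ` the first leg is paired with the fourth, and the second with the third, each pair through
`b β S(c)`. The antipode axiom for `β` therefore absorbs `Δ(u)` placed in the outer pair. -/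
theorem coevPair_outer (X : (H ⊗[k] H) ⊗[k] (H ⊗[k] H)) (u : H) :
    coevPair k H (X * padOuter k H (comul (k := k) u)) =
      (counit u : k) • coevPair k H X := by
  have key : ∀ (x y c d : H) (w : H ⊗[k] H), coevPair k H (((x ⊗ₜ[k] y) ⊗ₜ[k] (c ⊗ₜ[k] d)) *
      padOuter k H w) =
      (x * evB k H w * S (k := k) d) ⊗ₜ[k] (y * beta k * S (k := k) c) := by
    intro x y c d w
    induction w with
    | zero => simp
    | add x y hx hy =>
      simp only [map_add, add_mul, mul_add, TensorProduct.add_tmul, hx, hy]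
    | tmul a b => simp [S_mul, mul_assoc]
  induction X with
  | zero => simp
  | add x y hx hy => simp only [map_add, add_mul, smul_add, hx, hy]
  | tmul p q =>
    induction p with
    | zero => simp
    | add x y hx hy => simp only [map_add, add_mul, smul_add, TensorProduct.add_tmul, hx, hy]
    | tmul x y =>
      induction q with
      | zero => simp
      | add x y hx hy => simp only [map_add, add_mul, smul_add, TensorProduct.tmul_add, hx, hy]
      | tmul c d =>
        rw [key, evB_comul]
        simp [TensorProduct.smul_tmul']

theorem coevPair_inner (X : (H ⊗[k] H) ⊗[k] (H ⊗[k] H)) (h : H) (b : H) :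
    coevPair k H (X * (padPair k H (Algebra.TensorProduct.map (AlgHom.id k H) comul
      (comul (k := k) h)) * (1 ⊗ₜ[k] (1 ⊗ₜ[k] b)))) =
      coevPair k H (X * ((h ⊗ₜ[k] 1) ⊗ₜ[k] (1 ⊗ₜ[k] b))) := by
  have key : ∀ (x y c d a b : H) (w : H ⊗[k] H),
      coevPair k H (((x ⊗ₜ[k] y) ⊗ₜ[k] (c ⊗ₜ[k] d)) *
      (padPair k H (a ⊗ₜ[k] w) * (1 ⊗ₜ[k] (1 ⊗ₜ[k] b)))) =
      (x * a * beta k * S (k := k) (d * b)) ⊗ₜ[k] (y * evB k H w * S (k := k) c) := by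
    intro x y c d a b w
    induction w with
    | zero => simp
    | add x y hx hy =>
      simp only [map_add, add_mul, mul_add, TensorProduct.tmul_add, hx, hy]
    | tmul e f => simp [S_mul, mul_assoc, Algebra.TensorProduct.one_def]
  have key' : ∀ (a u : H), coevPair k H (X * (padPair k H (a ⊗ₜ[k] comul u) *
      (1 ⊗ₜ[k] (1 ⊗ₜ[k] b)))) = (counit u : k) • coevPair k H (X * ((a ⊗ₜ[k] 1) ⊗ₜ[k]
        (1 ⊗ₜ[k] b))) := by
    intro a u
    induction X with
    | zero => simp
    | add x y hx hy => simp only [map_add, add_mul, smul_add, hx, hy]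
    | tmul p q =>
      induction p with
      | zero => simp
      | add x y hx hy => simp only [map_add, add_mul, smul_add, TensorProduct.add_tmul, hx, hy]
      | tmul x y =>
        induction q with
        | zero => simp
        | add x y hx hy => simp only [map_add, add_mul, smul_add, TensorProduct.tmul_add, hx, hy]
        | tmul c d =>
          rw [key, evB_comul]
          simp
  have key₃ : ∀ w : H ⊗[k] H, coevPair k H (X * (padPair k H (Algebra.TensorProduct.map
      (AlgHom.id k H) comul w) * (1 ⊗ₜ[k] (1 ⊗ₜ[k] b)))) =
      coevPair k H (X * (TensorProduct.rid k H (Algebra.TensorProduct.map (AlgHom.id k H)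
        (counit (k := k)) w) ⊗ₜ[k] 1) ⊗ₜ[k] (1 ⊗ₜ[k] b)) := by
    intro w
    induction w with
    | zero => simp
    | add x y hx hy =>
      simp only [map_add, add_mul, mul_add, TensorProduct.add_tmul, hx, hy]
    | tmul a u =>
      rw [Algebra.TensorProduct.map_tmul, AlgHom.id_apply, key',
        Algebra.TensorProduct.map_tmul, AlgHom.id_apply, TensorProduct.rid_tmul,
        ← TensorProduct.smul_tmul', ← TensorProduct.smul_tmul', mul_smul_comm, map_smul]
  rw [key₃, counit_right]
  simp

/-- `Δ(h₁) δ (S ⊗ S)(Δᶜᵒᵖ(h₂)) = ε(h) δ`. -/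
theorem delta_absorb (h : H) :
    twoSided (H ⊗[k] H) (TensorProduct.map (comul (k := k) (H := H)).toLinearMap (coS k H)
      (comul h)) (delta k H) = (counit h : k) • delta k H := by
  have key : ∀ (w : H ⊗[k] H) (X : (H ⊗[k] H) ⊗[k] (H ⊗[k] H)), twoSided (H ⊗[k] H) (TensorProduct.map
      (comul (k := k) (H := H)).toLinearMap (coS k H) w) (coevPair k H X) =
      coevPair k H (comulL k H (H ⊗[k] H) (Algebra.TensorProduct.map (AlgHom.id k H) comul w) * X) := by
    intro w X
    induction w with
    | zero => simp
    | add x y hx hy => simp only [map_add, add_mul, LinearMap.add_apply, hx, hy]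
    | tmul a b =>
      induction X with
      | zero => simp
      | add x y hx hy => simp only [map_add, mul_add, hx, hy]
      | tmul p q => simp [twoSided_tmul (k := k), flipSS_mul (k := k), coS_apply, mul_assoc]
  -- Quasi-coassociativity moves the iterated coproduct across `Φ⁻¹`; then the inner pair collapses
  -- and only the outer pair is left.
  have key₂ : ∀ (w : H ⊗[k] H) (X : (H ⊗[k] H) ⊗[k] (H ⊗[k] H)), coevPair k H (X * (comulL k H (H ⊗[k] H)
      (Algebra.TensorProduct.assoc k k k H H H (Algebra.TensorProduct.map comul (AlgHom.id k H) w))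
      * padPair k H (reassocInv k H))) = coevPair k H (X * padPair k H (reassocInv k H) *
        padOuter k H w) := by
    intro w X
    induction w with
    | zero => simp
    | add x y hx hy => simp only [map_add, add_mul, mul_add, hx, hy]
    | tmul a b =>
      have e1 : comulL k H (H ⊗[k] H) (Algebra.TensorProduct.assoc k k k H H H
          (Algebra.TensorProduct.map comul (AlgHom.id k H) (a ⊗ₜ[k] b))) =
          padPair k H (Algebra.TensorProduct.assoc k k k H H H
          (Algebra.TensorProduct.map comul (AlgHom.id k H) (comul a))) *
            (1 ⊗ₜ[k] (1 ⊗ₜ[k] b)) := by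
        rw [Algebra.TensorProduct.map_tmul]
        induction comul (k := k) a with
        | zero => simp
        | add x y hx hy => simp only [map_add, add_mul, TensorProduct.add_tmul, hx, hy]
        | tmul c d =>
          rw [Algebra.TensorProduct.map_tmul]
          change comul c ⊗ₜ[k] (d ⊗ₜ[k] b) = padPair k H (TensorProduct.assoc k H H H
            (comul c ⊗ₜ[k] d)) * _
          induction comul (k := k) c with
          | zero => simp
          | add x y hx hy => simp only [map_add, add_mul, TensorProduct.add_tmul, hx, hy]
          | tmul x y => simp
      have e2 : ∀ t : H ⊗[k] (H ⊗[k] H), (1 ⊗ₜ[k] (1 ⊗ₜ[k] b)) * padPair k H t =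
          padPair k H t * (1 ⊗ₜ[k] (1 ⊗ₜ[k] b)) := by
        intro t
        induction t using tensor_induction₃ with
        | zero => simp
        | add x y hx hy => simp only [map_add, add_mul, mul_add, hx, hy]
        | tmul x y z => simp
      rw [e1, mul_assoc, e2, ← mul_assoc (padPair k H _), ← map_mul (padPair k H),
        comul_coassoc_inv, map_mul (padPair k H), mul_assoc (padPair k H _), ← mul_assoc X, coevPair_inner]
      rfl
  rw [delta_eq, key, ← mul_assoc, ← map_mul (comulL k H _), comul_coassoc,
    map_mul (comulL k H _), mul_assoc, key₂,
    coevPair_outer]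

variable (k H) in
/-- `a ⊗ b ⊗ x ↦ Δ(S(a) α b) δ g(x)`. -/
def twistFun {T : Type*} [AddCommGroup T] [Module k T] (g : T →ₗ[k] H ⊗[k] H) :
    H ⊗[k] (H ⊗[k] T) →ₗ[k] H ⊗[k] H :=
  LinearMap.mul' k (H ⊗[k] H) ∘ₗ
    TensorProduct.map (LinearMap.mulRight k (delta k H) ∘ₗ
      (comul (k := k) (H := H)).toLinearMap ∘ₗ evA k H) g ∘ₗ
    (TensorProduct.assoc k H H T).symm.toLinearMap

@[simp] theorem twistFun_tmul {T : Type*} [AddCommGroup T] [Module k T] (g : T →ₗ[k] H ⊗[k] H)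
    (a b : H) (x : T) : twistFun k H g (a ⊗ₜ[k] (b ⊗ₜ[k] x)) =
      comul (evA k H (a ⊗ₜ[k] b)) * delta k H * g x := rfl

theorem twistFun_fst {T : Type*} [Ring T] [Algebra k T] (g : T →ₗ[k] H ⊗[k] H) (u : H)
    (s : H ⊗[k] (H ⊗[k] T)) : twistFun k H g (TensorProduct.assoc k H H T (comul u ⊗ₜ[k] 1) * s) =
      (counit u : k) • twistFun k H g s := by
  induction s using tensor_induction₃ with
  | zero => simp
  | add x y hx hy => simp only [map_add, mul_add, smul_add, hx, hy]
  | tmul a b x =>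
    have : ∀ w : H ⊗[k] H, twistFun k H g (TensorProduct.assoc k H H T (w ⊗ₜ[k] 1) *
        (a ⊗ₜ[k] (b ⊗ₜ[k] x))) = comul (evA k H (w * (a ⊗ₜ[k] b))) * delta k H * g x := by
      intro w
      induction w with
      | zero => simp
      | add x y hx hy => simp only [map_add, add_mul, TensorProduct.add_tmul, hx, hy]
      | tmul c d => simp
    rw [this, evA_comul_mul, map_smul, smul_mul_assoc, smul_mul_assoc, twistFun_tmul]

theorem delta_absorb_mul (p q : H ⊗[k] H) (u : H) :
    twoSided (H ⊗[k] H) (TensorProduct.map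
      (LinearMap.mulLeft k p ∘ₗ (comul (k := k) (H := H)).toLinearMap)
      (LinearMap.mulRight k q ∘ₗ coS k H) (comul u)) (delta k H) =
        (counit u : k) • (p * delta k H * q) := by
  have : ∀ w : H ⊗[k] H, twoSided (H ⊗[k] H) (TensorProduct.map
      (LinearMap.mulLeft k p ∘ₗ (comul (k := k) (H := H)).toLinearMap)
      (LinearMap.mulRight k q ∘ₗ coS k H) w) (delta k H) =
      p * twoSided (H ⊗[k] H) (TensorProduct.map (comul (k := k) (H := H)).toLinearMap (coS k H)
        w) (delta k H) * q := by
    intro w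
    induction w with
    | zero => simp
    | add x y hx hy => simp only [map_add, mul_add, add_mul, LinearMap.add_apply, hx, hy]
    | tmul a b => simp [twoSided_tmul (k := k), mul_assoc]
  rw [this, delta_absorb, mul_smul_comm, smul_mul_assoc]

theorem drinfeldTwistInv_eq : drinfeldTwistInv k H = twistFun k H (coS k H) (reassocInv k H) := by
  have key : ∀ t : H ⊗[k] (H ⊗[k] H), twoSided (H ⊗[k] H)
      (TensorProduct.map (comul (k := k) (H := H)).toLinearMap (coS k H)
        (LinearMap.rTensor H (evA k H) ((Algebra.TensorProduct.assoc k k k H H H).symm t)))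
      (delta k H) = twistFun k H (coS k H) t := by
    intro t
    induction t using tensor_induction₃ with
    | zero => simp
    | add x y hx hy => simp only [map_add, LinearMap.add_apply, hx, hy]
    | tmul a b c => simp [twoSided_tmul (k := k)]
  exact key _

theorem drinfeldTwistInv_coS (h : H) :
    drinfeldTwistInv k H * coS k H h = comul (S (k := k) h) * drinfeldTwistInv k H := by
  have e1 : ∀ t : H ⊗[k] (H ⊗[k] H), twistFun k H (coS k H) t * coS k H h =
      twistFun k H (coS k H) ((1 ⊗ₜ[k] (1 ⊗ₜ[k] h)) * t) := by
    intro t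
    induction t using tensor_induction₃ with
    | zero => simp
    | add x y hx hy => simp only [map_add, add_mul, mul_add, hx, hy]
    | tmul a b c => simp [coS_mul, mul_assoc]
  have e2 : ∀ t : H ⊗[k] (H ⊗[k] H), comul (S (k := k) h) * twistFun k H (coS k H) t =
      twistFun k H (coS k H) (t * (h ⊗ₜ[k] 1)) := by
    intro t
    induction t using tensor_induction₃ with
    | zero => simp
    | add x y hx hy => simp only [map_add, add_mul, mul_add, hx, hy]
    | tmul a b c => simp [S_mul, mul_assoc]
  have h₂ : ∀ (u : H) s, twistFun k H (coS k H) (s * ((1 : H) ⊗ₜ[k] comul u)) =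
      (counit u : k) • twistFun k H (coS k H) s := by
    intro u s
    induction s using tensor_induction₃ with
    | zero => simp
    | add x y hx hy => simp only [map_add, add_mul, smul_add, hx, hy]
    | tmul a b c =>
      have := delta_absorb_mul (k := k) (comul (evA k H (a ⊗ₜ[k] b))) (coS k H c) u
      rw [twistFun_tmul, ← this]
      induction comul (k := k) u with
      | zero => simp
      | add x y hx hy => simp only [map_add, mul_add, TensorProduct.tmul_add,
          LinearMap.add_apply, hx, hy]
      | tmul x y => simp [coS_mul, twoSided_tmul (k := k), mul_assoc]
  -- Expand `h` to `(Δ ⊗ id)Δ(h)`, whose first two legs `S(·) α (·)` absorbs; move it across `Φ⁻¹`;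
  -- then `δ` absorbs the last two legs of `(id ⊗ Δ)Δ(h)`.
  rw [drinfeldTwistInv_eq, e1, e2, ← absorb_comul_fst (twistFun_fst (coS k H)),
    comul_coassoc_inv, absorb_comul_snd_right h₂]

variable (k H) in
/-- `b ⊗ c ⊗ d ↦ S(c) α d ⊗ S(b)`. -/
def qFun : H ⊗[k] (H ⊗[k] H) →ₗ[k] H ⊗[k] H :=
  (TensorProduct.comm k H H).toLinearMap ∘ₗ
    TensorProduct.map (S (k := k) (H := H)).toLinearMap (evA k H)

@[simp] theorem qFun_tmul (b : H) (t : H ⊗[k] H) :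
    qFun k H (b ⊗ₜ[k] t) = evA k H t ⊗ₜ[k] S (k := k) b := rfl

/-- Applying `S` to `S⁻¹(α X³) X²` gives `S(X²) α X³`, so the inverse antipode disappears from all
further computations. -/
theorem qFun_reassoc : qFun k H (reassoc k H) = flipSS k H (qR k H) := by
  have key : ∀ t : H ⊗[k] (H ⊗[k] H), qFun k H t = flipSS k H (LinearMap.lTensor H
    (LinearMap.mul' k H ∘ₗ (TensorProduct.comm k H H).toLinearMap ∘ₗ
      LinearMap.lTensor H
        ((S (k := k) (H := H)).symm.toLinearMap ∘ₗ LinearMap.mulLeft k (alpha k : H))) t) := by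
    intro t
    induction t using tensor_induction₃ with
    | zero => simp
    | add x y hx hy => simp only [map_add, hx, hy]
    | tmul a b c => simp [S_mul, mul_assoc]
  exact key _

theorem coS_qFun (a b : H) (t : H ⊗[k] (H ⊗[k] H)) :
    coS k H a * qFun k H t * (b ⊗ₜ[k] 1) =
      qFun k H (t * TensorProduct.assoc k H H H (comul a ⊗ₜ[k] b)) := by
  rw [coS_apply]
  induction comul (k := k) a with
  | zero => simp
  | add x y hx hy => simp only [map_add, mul_add, add_mul, TensorProduct.add_tmul, hx, hy]
  | tmul c d =>
    induction t using tensor_induction₃ with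
    | zero => simp
    | add x y hx hy => simp only [map_add, mul_add, add_mul, hx, hy]
    | tmul x y z => simp [S_mul, mul_assoc]

theorem qFun_comul (u : H) (s : H ⊗[k] (H ⊗[k] H)) :
    qFun k H (((1 : H) ⊗ₜ[k] comul u) * s) = (counit u : k) • qFun k H s := by
  induction s with
  | zero => simp
  | add x y hx hy => simp only [map_add, mul_add, smul_add, hx, hy]
  | tmul x y => simp [evA_comul_mul, TensorProduct.smul_tmul']

variable (k H) in
/-- `c ⊗ d ↦ (S ⊗ S)(Δᶜᵒᵖ(c)) (S(q²) ⊗ S(q¹)) (d ⊗ 1)`. -/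
def coSq : H ⊗[k] H →ₗ[k] H ⊗[k] H :=
  LinearMap.mul' k (H ⊗[k] H) ∘ₗ TensorProduct.map (coS k H)
    (LinearMap.mulLeft k (qFun k H (reassoc k H)) ∘ₗ
      (Algebra.TensorProduct.includeLeft : H →ₐ[k] H ⊗[k] H).toLinearMap)

@[simp] theorem coSq_tmul (c d : H) : coSq k H (c ⊗ₜ[k] d) =
    coS k H c * (qFun k H (reassoc k H) * (d ⊗ₜ[k] 1)) := rfl

/-- The commutation rule of `q_R` with `H`: after quasi-coassociativity, `S(·) α (·)` absorbs one
coproduct and leaves a single factor `S(u)`. -/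
theorem coSq_comul (u : H) :
    coSq k H (comul u) = qFun k H (reassoc k H) * (1 ⊗ₜ[k] S (k := k) u) := by
  have e1 : ∀ w : H ⊗[k] H, coSq k H w = qFun k H (reassoc k H *
      Algebra.TensorProduct.assoc k k k H H H
        (Algebra.TensorProduct.map comul (AlgHom.id k H) w)) := by
    intro w
    induction w with
    | zero => simp
    | add x y hx hy => simp only [map_add, mul_add, hx, hy]
    | tmul a b => rw [coSq_tmul, ← mul_assoc, coS_qFun]; rfl
  have e2 : ∀ t : H ⊗[k] (H ⊗[k] H), qFun k H ((u ⊗ₜ[k] 1) * t) =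
      qFun k H t * (1 ⊗ₜ[k] S (k := k) u) := by
    intro t
    induction t with
    | zero => simp
    | add x y hx hy => simp only [map_add, mul_add, add_mul, hx, hy]
    | tmul a b => simp [S_mul]
  rw [e1, ← comul_coassoc, absorb_comul_snd qFun_comul, e2]

end Twist

end QuasiHopf

namespace QuasiHopf

open QuasiBialgebra QuasiHopfAlgebra

/-! ### The coaction of `H₀` -/

section TwistCoev

variable {k H : Type*} [Field k] [Ring H] [Algebra k H] [QuasiHopfAlgebra k H]

variable (k H) in
/-- `x¹ ⊗ x² β S(x³)`. -/
def coevElem : H ⊗[k] H := LinearMap.lTensor H (evB k H) (reassocInv k H)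

variable (k H) in
/-- `q ⊗ t ↦ q (β ⊗ β) (S(t₂) α t₃ ⊗ S(t₁))`. -/
def coevQ : (H ⊗[k] H) ⊗[k] (H ⊗[k] (H ⊗[k] H)) →ₗ[k] H ⊗[k] H :=
  LinearMap.mul' k (H ⊗[k] H) ∘ₗ
    TensorProduct.map (LinearMap.mulRight k ((beta k : H) ⊗ₜ[k] (beta k : H))) (qFun k H)

@[simp] theorem coevQ_tmul (q : H ⊗[k] H) (t : H ⊗[k] (H ⊗[k] H)) : coevQ k H (q ⊗ₜ[k] t) =
    q * ((beta k : H) ⊗ₜ[k] (beta k : H)) * qFun k H t := rfl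

variable (k H) in
/-- `q ⊗ c ⊗ d ↦ q ⊗ c ⊗ d ⊗ 1`. -/
def padLast : (H ⊗[k] H) ⊗[k] (H ⊗[k] H) →ₐ[k] (H ⊗[k] H) ⊗[k] (H ⊗[k] (H ⊗[k] H)) :=
  Algebra.TensorProduct.map (AlgHom.id k (H ⊗[k] H)) (Algebra.TensorProduct.map (AlgHom.id k H)
    (Algebra.TensorProduct.includeLeft : H →ₐ[k] H ⊗[k] H))

@[simp] theorem padLast_tmul (q : H ⊗[k] H) (c d : H) :
    padLast k H (q ⊗ₜ[k] (c ⊗ₜ[k] d)) = q ⊗ₜ[k] (c ⊗ₜ[k] (d ⊗ₜ[k] 1)) := rfl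

theorem coevQ_comul (u : H) (s : (H ⊗[k] H) ⊗[k] (H ⊗[k] (H ⊗[k] H))) :
    coevQ k H ((1 ⊗ₜ[k] (1 ⊗ₜ[k] comul u)) * s) = (counit u : k) • coevQ k H s := by
  induction s with
  | zero => simp
  | add x y hx hy => simp only [map_add, mul_add, smul_add, hx, hy]
  | tmul q t => simp [qFun_comul]

theorem coevQ_inner (X : (H ⊗[k] H) ⊗[k] (H ⊗[k] H)) (h : H) (t : H ⊗[k] H) :
    coevQ k H (padLast k H (X * padPair k H (Algebra.TensorProduct.map (AlgHom.id k H) comul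
      (comul (k := k) h))) * (1 ⊗ₜ[k] (1 ⊗ₜ[k] t))) =
      coevQ k H (padLast k H X * ((h ⊗ₜ[k] 1) ⊗ₜ[k] (1 ⊗ₜ[k] t))) := by
  have key : ∀ (Y : (H ⊗[k] H) ⊗[k] (H ⊗[k] H)) (b c : H), coevQ k H (padLast k H Y *
      (1 ⊗ₜ[k] (1 ⊗ₜ[k] (b ⊗ₜ[k] c)))) =
      coevPair k H (Y * (1 ⊗ₜ[k] (1 ⊗ₜ[k] b))) * ((alpha k * c) ⊗ₜ[k] 1) := by
    intro Y b c
    induction Y using tensor_induction₃ with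
    | zero => simp
    | add x y hx hy => simp only [map_add, add_mul, hx, hy]
    | tmul q d e =>
      simp [mul_assoc, S_mul]
  induction t with
  | zero => simp
  | add x y hx hy => simp only [map_add, mul_add, TensorProduct.tmul_add, hx, hy]
  | tmul b c =>
    have e : ((h ⊗ₜ[k] 1) ⊗ₜ[k] (1 ⊗ₜ[k] (b ⊗ₜ[k] c)) :
        (H ⊗[k] H) ⊗[k] (H ⊗[k] (H ⊗[k] H))) = padLast k H ((h ⊗ₜ[k] 1) ⊗ₜ[k] 1) *
          (1 ⊗ₜ[k] (1 ⊗ₜ[k] (b ⊗ₜ[k] c))) := by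
      simp [Algebra.TensorProduct.one_def]
    rw [e, ← mul_assoc, ← map_mul (padLast k H), key, key, mul_assoc, coevPair_inner, mul_assoc X]
    simp

/-- `Δ(Y¹) δ (S ⊗ S)(Δᶜᵒᵖ(Y²)) (S(q²) Y³ ⊗ S(q¹)) = x¹ ⊗ x² β S(x³)`. -/
theorem delta_coSq : twoSided (H ⊗[k] H) (TensorProduct.map
    (comul (k := k) (H := H)).toLinearMap (coSq k H) (reassoc k H)) (delta k H) =
      coevElem k H := by
  have key : ∀ (y x : H ⊗[k] (H ⊗[k] H)) (X : (H ⊗[k] H) ⊗[k] (H ⊗[k] H)),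
      twoSided (H ⊗[k] H) (TensorProduct.map (comul (k := k) (H := H)).toLinearMap
        (LinearMap.mul' k (H ⊗[k] H) ∘ₗ TensorProduct.map (coS k H)
    (LinearMap.mulLeft k (qFun k H x) ∘ₗ
      (Algebra.TensorProduct.includeLeft : H →ₐ[k] H ⊗[k] H).toLinearMap)) y) (coevPair k H X) =
      coevQ k H (comulL k H _ (padL k H x * comul₂ k H y) * padLast k H X) := by
    intro y x X
    induction y using tensor_induction₃ with
    | zero => simp
    | add x y hx hy => simp only [map_add, add_mul, mul_add, LinearMap.add_apply, hx, hy]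
    | tmul a b c =>
      have e : ∀ z : H ⊗[k] (H ⊗[k] H), ∀ d e : H,
          qFun k H (z * (d ⊗ₜ[k] (e ⊗ₜ[k] 1))) = (S (k := k) e ⊗ₜ[k] S (k := k) d) *
            qFun k H z := by
        intro z d e
        induction z using tensor_induction₃ with
        | zero => simp
        | add x y hx hy => simp only [map_add, add_mul, mul_add, hx, hy]
        | tmul x y z => simp [S_mul, mul_assoc]
      induction X using tensor_induction₃ with
      | zero => simp
      | add x y hx hy => simp only [map_add, mul_add, hx, hy]
      | tmul q d f =>
        simp [twoSided_tmul (k := k), mul_assoc]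
        rw [← mul_assoc (coS k H b), coS_qFun, ← mul_assoc x, e,
          ← mul_assoc ((beta k : H) ⊗ₜ[k] (beta k : H)), Algebra.TensorProduct.tmul_mul_tmul]
  have key₂ : ∀ y : H ⊗[k] (H ⊗[k] H), coevQ k H (comulL k H _ (comul₁ k H y) *
      padLast k H (padPair k H (reassocInv k H))) =
      coevElem k H * (evBA k H y ⊗ₜ[k] 1) := by
    intro y
    induction y with
    | zero => simp
    | add x y hx hy => simp only [map_add, add_mul, mul_add, TensorProduct.add_tmul, hx, hy]
    | tmul a t =>
      have e1 : comulL k H _ (comul₁ k H (a ⊗ₜ[k] t)) =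
          padLast k H (padPair k H (Algebra.TensorProduct.assoc k k k H H H
            (Algebra.TensorProduct.map comul (AlgHom.id k H) (comul a)))) *
            (1 ⊗ₜ[k] (1 ⊗ₜ[k] t)) := by
        rw [comul₁_tmul]
        induction comul (k := k) a with
        | zero => simp
        | add x y hx hy => simp only [map_add, add_mul, TensorProduct.add_tmul, hx, hy]
        | tmul c d =>
          rw [Algebra.TensorProduct.map_tmul]
          change comul c ⊗ₜ[k] (d ⊗ₜ[k] t) = padLast k H (padPair k H (TensorProduct.assoc k H H H
            (comul c ⊗ₜ[k] d))) * _
          induction comul (k := k) c with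
          | zero => simp
          | add x y hx hy => simp only [map_add, add_mul, TensorProduct.add_tmul, hx, hy]
          | tmul x y => simp [← Algebra.TensorProduct.one_def]
      have e2 : ∀ s : H ⊗[k] (H ⊗[k] H), (1 ⊗ₜ[k] (1 ⊗ₜ[k] t)) * padLast k H (padPair k H s) =
          padLast k H (padPair k H s) * (1 ⊗ₜ[k] (1 ⊗ₜ[k] t)) := by
        intro s
        induction s using tensor_induction₃ with
        | zero => simp
        | add x y hx hy => simp only [map_add, add_mul, mul_add, hx, hy]
        | tmul x y z => simp [← Algebra.TensorProduct.one_def]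
      have e3 : ∀ s : H ⊗[k] (H ⊗[k] H), coevQ k H (padLast k H (padPair k H s) *
          ((a ⊗ₜ[k] 1) ⊗ₜ[k] (1 ⊗ₜ[k] t))) =
          LinearMap.lTensor H (evB k H) s * (evBA k H (a ⊗ₜ[k] t) ⊗ₜ[k] 1) := by
        intro s
        induction s using tensor_induction₃ with
        | zero => simp
        | add x y hx hy => simp only [map_add, add_mul, hx, hy]
        | tmul x y z => simp [← Algebra.TensorProduct.one_def, mul_assoc]
      rw [e1, mul_assoc, e2, ← mul_assoc, ← map_mul (padLast k H), ← map_mul (padPair k H),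
        comul_coassoc_inv, map_mul (padPair k H), coevQ_inner, e3]
      rfl
  have h₃ : ∀ X s, coevQ k H (comulL k H _ (comul₃ k H (reassoc k H) * X) * s) =
      coevQ k H (comulL k H _ X * s) := by
    intro X s
    have hF : ∀ (u : H) Y, (coevQ k H ∘ₗ LinearMap.mulRight k s ∘ₗ (comulL k H _).toLinearMap)
        (((1 : H) ⊗ₜ[k] ((1 : H) ⊗ₜ[k] comul u)) * Y) = (counit u : k) •
        (coevQ k H ∘ₗ LinearMap.mulRight k s ∘ₗ (comulL k H _).toLinearMap) Y := by
      intro u Y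
      simp only [LinearMap.comp_apply, AlgHom.toLinearMap_apply, map_mul (comulL k H _),
        comulL_tmul, map_one, LinearMap.mulRight_apply, mul_assoc, coevQ_comul]
    exact absorb_comul₃ hF X counit_reassoc_right
  have e4 : padLast k H (comulL k H _ (reassoc k H)) =
      comulL k H _ (padR k H (reassoc k H)) := by
    induction reassoc k H using tensor_induction₃ with
    | zero => simp
    | add x y hx hy => simp only [map_add, hx, hy]
    | tmul x y z => simp
  rw [delta_eq]
  refine (key (reassoc k H) (reassoc k H) _).trans ?_
  -- The pentagon gathers three copies of `Φ` into two. The factor `(id ⊗ id ⊗ Δ)(Φ)` is absorbed by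
  -- `α`; after `key₂` the other contributes `X¹ β S(X²) α X³ = 1`.
  rw [map_mul (padLast k H), e4, ← mul_assoc, ← map_mul (comulL k H _), pentagon_elem, h₃, key₂,
    evBA_reassoc, ← Algebra.TensorProduct.one_def, mul_one]

/-- `Δ(S(w¹) α w²) (x¹ ⊗ x² β S(x³)) (1 ⊗ S(w³)) = f⁻¹ (S(q²) ⊗ S(q¹))` for `Φ⁻¹ = w`. -/
theorem comul_coevElem : LinearMap.mul' k (H ⊗[k] H) (TensorProduct.map
      (LinearMap.mulRight k (coevElem k H) ∘ₗ (comul (k := k) (H := H)).toLinearMap ∘ₗ evA k H)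
      ((Algebra.TensorProduct.includeRight : H →ₐ[k] H ⊗[k] H).toLinearMap ∘ₗ
        (S (k := k) (H := H)).toLinearMap)
      ((TensorProduct.assoc k H H H).symm (reassocInv k H))) =
    drinfeldTwistInv k H * qFun k H (reassoc k H) := by
  have key : ∀ w y : H ⊗[k] (H ⊗[k] H), LinearMap.mul' k (H ⊗[k] H) (TensorProduct.map
      (LinearMap.mulRight k (twoSided (H ⊗[k] H) (TensorProduct.map
    (comul (k := k) (H := H)).toLinearMap (coSq k H) y) (delta k H)) ∘ₗ
        (comul (k := k) (H := H)).toLinearMap ∘ₗ evA k H)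
      ((Algebra.TensorProduct.includeRight : H →ₐ[k] H ⊗[k] H).toLinearMap ∘ₗ
        (S (k := k) (H := H)).toLinearMap)
      ((TensorProduct.assoc k H H H).symm w)) =
      twistFun k H (coSq k H) (comul₃ k H w * padL k H y) := by
    intro w y
    induction w using tensor_induction₃ with
    | zero => simp
    | add x y hx hy => simp only [map_add, add_mul, hx, hy]
    | tmul a b c =>
      induction y using tensor_induction₃ with
      | zero => simp
      | add x y hx hy =>
        simp only [map_add, mul_add, LinearMap.add_apply, TensorProduct.assoc_symm_tmul,
          TensorProduct.map_tmul, LinearMap.comp_apply, LinearMap.mulRight_apply,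
          LinearMap.mul'_apply, add_mul] at hx hy ⊢
        rw [hx, hy]
      | tmul x y z =>
        have e : ∀ v : H ⊗[k] H, coSq k H (v * (y ⊗ₜ[k] z)) =
            coS k H y * coSq k H v * (z ⊗ₜ[k] 1) := by
          intro v
          induction v with
          | zero => simp
          | add x y hx hy => simp only [map_add, add_mul, mul_add, hx, hy]
          | tmul x y => simp [coS_mul, mul_assoc]
        have e' := e (comul c)
        rw [coSq_comul] at e'
        simp [twoSided_tmul (k := k), e', mul_assoc]
  have h₂ : ∀ (u : H) s, twistFun k H (coSq k H) (s * ((1 : H) ⊗ₜ[k] TensorProduct.assoc k H H H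
      (comul u ⊗ₜ[k] 1))) = (counit u : k) • twistFun k H (coSq k H) s := by
    intro u s
    induction s using tensor_induction₄ with
    | zero => simp
    | add x y hx hy => simp only [map_add, add_mul, smul_add, hx, hy]
    | tmul a b c d =>
      have := delta_absorb_mul (k := k) (comul (evA k H (a ⊗ₜ[k] b))) (coSq k H (c ⊗ₜ[k] d)) u
      rw [twistFun_tmul, ← this]
      induction comul (k := k) u with
      | zero => simp
      | add x y hx hy => simp only [map_add, mul_add, TensorProduct.tmul_add,
          TensorProduct.add_tmul, LinearMap.add_apply, hx, hy]
      | tmul x y => simp [coS_mul, twoSided_tmul (k := k), mul_assoc]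
  have e5 : ∀ t : H ⊗[k] (H ⊗[k] H), twistFun k H (coSq k H) (padR k H t) =
      twistFun k H (coS k H) t * qFun k H (reassoc k H) := by
    intro t
    induction t using tensor_induction₃ with
    | zero => simp
    | add x y hx hy => simp only [map_add, add_mul, hx, hy]
    | tmul a b c => simp [mul_assoc, ← Algebra.TensorProduct.one_def]
  -- With the coevaluation expressed through `δ`, the pentagon replaces the pair of reassociators by
  -- `Φ⁻¹ ⊗ 1` between two factors absorbed by `α` and `δ`; what remains is the definition of `f⁻¹`
  -- times the `q`-factor.
  rw [← delta_coSq, key, comul₃_inv_padL, absorb_comul₁ (twistFun_fst (coSq k H)) _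
    counit_reassoc_left, absorb_comul₂_right h₂ _ counit_reassocInv_mid, e5, drinfeldTwistInv_eq]

end TwistCoev

/-! ### The explicit product and coaction of `H₀` -/

section HZero

variable {k H P : Type*} [Field k] [Ring H] [Algebra k H] [QuasiHopfAlgebra k H]
  [AddCommGroup P] [Module k P]

open QuasiHopf.Bimod

/-- `a ⊗ b ⊗ t ↦ a z S(b) α (t₁ p S(t₂))`. -/
def zipAt (B : Bimod k H P) (z : H) (p : P) : H ⊗[k] (H ⊗[k] (H ⊗[k] H)) →ₗ[k] P :=
  TensorProduct.lift B.l.toLinearMap ∘ₗ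
    TensorProduct.map (LinearMap.mulRight k (alpha k : H) ∘ₗ (adS k H).toLinearMap.flip z)
      (B.adj.toLinearMap.flip p) ∘ₗ (TensorProduct.assoc k H H (H ⊗[k] H)).symm.toLinearMap

@[simp] theorem zipAt_tmul (B : Bimod k H P) (z : H) (p : P) (a b : H) (t : H ⊗[k] H) :
    zipAt B z p (a ⊗ₜ[k] (b ⊗ₜ[k] t)) =
      B.l (a * z * S (k := k) b * alpha k) (B.adj t p) := by
  simp [zipAt, adS_tmul]

/-- The pentagon removes the coproduct from the part next to `z`, giving `X¹ z S(x¹X²) α (x²X³₁ p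
S(x³X³₂))`. For the regular bimodule this is the product of `H₀`; for `H ⊗ H` it is the starting
point for the coaction. -/
theorem adAct_eq_zipAt (B : Bimod k H P) (z : H) (p : P) : adAct B (z ⊗ₜ[k] p) =
    zipAt B z p (padL k H (reassocInv k H) * comul₃ k H (reassoc k H)) := by
  have key : ∀ s t : H ⊗[k] (H ⊗[k] H), TensorProduct.lift (B.l.toLinearMap ∘ₗ
      (⟨⟨fun p => (Bimod.regular k H).evalAt p s, fun p q => Bimod.evalAt_add _ p q _⟩,
        fun c p => Bimod.evalAt_smul _ c p _⟩ : H →ₗ[k] H))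
      (tensorAct (zAct k H) B.adj t (z ⊗ₜ[k] p)) =
        zipAt B z p (padR k H s * comul₁ k H t) := by
    intro s t
    induction t using tensor_induction₃ with
    | zero => simp
    | add x y hx hy => simp only [map_add, mul_add, LinearMap.add_apply, hx, hy]
    | tmul x y e =>
      simp only [tensorAct_tmul, TensorProduct.lift.tmul, LinearMap.comp_apply,
        LinearMap.coe_mk, AddHom.coe_mk, ad_apply, comul₁_tmul, AlgHom.toLinearMap_apply]
      induction comul (k := k) x with
      | zero => simp [evalAt_zero]
      | add x y hx hy => simp only [map_add, mul_add, TensorProduct.add_tmul, LinearMap.add_apply,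
          evalAt_add, hx, hy]
      | tmul c d =>
        induction s using tensor_induction₃ with
        | zero => simp
        | add x y hx hy => simp only [map_add, add_mul, LinearMap.add_apply, hx, hy]
        | tmul u v w => simp [S_mul, mul_assoc]
  have h₂ : ∀ (u : H) s, zipAt B z p (((1 : H) ⊗ₜ[k] TensorProduct.assoc k H H H
      (comul u ⊗ₜ[k] 1)) * s) = (counit u : k) • zipAt B z p s := by
    intro u s
    induction s using tensor_induction₄ with
    | zero => simp
    | add x y hx hy => simp only [map_add, mul_add, smul_add, hx, hy]
    | tmul a b c d =>
      have : ∀ w : H ⊗[k] H, zipAt B z p (((1 : H) ⊗ₜ[k] TensorProduct.assoc k H H H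
          (w ⊗ₜ[k] 1)) * (a ⊗ₜ[k] (b ⊗ₜ[k] (c ⊗ₜ[k] d)))) =
          B.l (a * z * S (k := k) b * evA k H w) (B.adj (c ⊗ₜ[k] d) p) := by
        intro w
        induction w with
        | zero => simp
        | add x y hx hy => simp only [map_add, add_mul, mul_add, TensorProduct.add_tmul,
            TensorProduct.tmul_add, LinearMap.add_apply, hx, hy]
        | tmul x y => simp [S_mul, mul_assoc]
      rw [this, evA_comul, mul_smul_comm, map_smul, zipAt_tmul]
      rfl
  refine (key (reassoc k H) (reassocInv k H)).trans ?_
  rw [padR_comul₁_inv, absorb_comul₂ h₂ _ counit_reassocInv_mid]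

variable (k H)

theorem HZero_mul (x : H ⊗[k] H) : (HZero k H).mul x = zMul k H x := by
  induction x with
  | zero => simp
  | add x y hx hy => simp only [map_add, hx, hy]
  | tmul z w =>
    have key : ∀ s t : H ⊗[k] (H ⊗[k] H), LinearMap.mul' k H
        (tensorAct (adS k H) (adS k H) (LinearMap.lTensor (H ⊗[k] H)
          (LinearMap.mulLeft k (LinearMap.rTensor H (evA k H)
            ((Algebra.TensorProduct.assoc k k k H H H).symm s)) ∘ₗ
              (comul (k := k) (H := H)).toLinearMap)
          ((Algebra.TensorProduct.assoc k k k H H H).symm t)) (z ⊗ₜ[k] w)) =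
        zipAt (Bimod.regular k H) z w (padL k H s * comul₃ k H t) := by
      intro s t
      induction t using tensor_induction₃ with
      | zero => simp
      | add x y hx hy => simp only [map_add, mul_add, LinearMap.add_apply, hx, hy]
      | tmul a b c =>
        induction s using tensor_induction₃ with
        | zero => simp
        | add x y hx hy =>
          simp only [map_add, add_mul, LinearMap.add_apply, Algebra.TensorProduct.assoc_symm_tmul,
            LinearMap.lTensor_tmul, LinearMap.comp_apply, LinearMap.mulLeft_apply,
            TensorProduct.tmul_add] at hx hy ⊢
          rw [hx, hy]
        | tmul x y e =>
          simp only [Algebra.TensorProduct.assoc_symm_tmul, LinearMap.lTensor_tmul,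
            LinearMap.comp_apply, LinearMap.mulLeft_apply, LinearMap.rTensor_tmul, padL_apply,
            comul₃_tmul, AlgHom.toLinearMap_apply]
          induction comul (k := k) c with
          | zero => simp
          | add x y hx hy => simp only [map_add, mul_add, TensorProduct.tmul_add,
              LinearMap.add_apply, hx, hy]
          | tmul u v => simp [adS_tmul, S_mul, mul_assoc]
    exact (key _ _).trans (adAct_eq_zipAt _ z w).symm

theorem zCoev_one : zCoev (Algebra.lmul k H) 1 = coevElem k H := by
  rw [zCoev_apply, assocAd_apply, coevElem]
  induction reassocInv k H using tensor_induction₃ with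
  | zero => simp
  | add x y hx hy => simp only [map_add, LinearMap.add_apply, hx, hy]
  | tmul a b c => simp [mul_assoc]

theorem zCoev_lmul (u : H) :
    zCoev (Algebra.lmul k H) u = coevElem k H * (u ⊗ₜ[k] 1) := by
  rw [zCoev_apply, assocAd_apply, coevElem]
  induction reassocInv k H using tensor_induction₃ with
  | zero => simp
  | add x y hx hy => simp only [map_add, add_mul, LinearMap.add_apply, hx, hy]
  | tmul a b c => simp [mul_assoc]

/-- `zBraid` at `1` acts by `z` on the coevaluation `x¹ ⊗ x² β S(x³)` in the adjoint module of `H ⊗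
H`, then applies `Φ`. The twist `f⁻¹` enters because the left action on this bimodule is through
`Δ`, so `Δ(S(X²))` must be rewritten through `S ⊗ S`. -/
theorem HZero_coact (z : H) :
    (HZero k H).coact z = zBraid (Algebra.lmul k H) (z ⊗ₜ[k] 1) := by
  have outer : ∀ (t : H ⊗[k] (H ⊗[k] H)) (q : H ⊗[k] H),
      tensorAct (Algebra.lmul k H) (Bimod.regular k H).adj t q =
      twoSided (H ⊗[k] H) (LinearMap.lTensor (H ⊗[k] H)
          (Algebra.TensorProduct.includeRight.toLinearMap ∘ₗ (S (k := k) (H := H)).toLinearMap)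
          ((Algebra.TensorProduct.assoc k k k H H H).symm t)) q := by
    intro t q
    induction t using tensor_induction₃ with
    | zero => simp
    | add x y hx hy => simp only [map_add, LinearMap.add_apply, hx, hy]
    | tmul a b c =>
      induction q with
      | zero => simp
      | add x y hx hy => simp only [map_add, hx, hy]
      | tmul x y => simp [twoSided_tmul (k := k), mul_assoc]
  set B := (Bimod.regular k H).tensor (Algebra.lmul k H) with hB
  have hl : ∀ (a : H) (q : H ⊗[k] H), B.l a q = comul a * q := by
    intro a q
    rw [hB, tensor_l]
    induction comul (k := k) a with
    | zero => simp
    | add x y hx hy => simp only [map_add, add_mul, LinearMap.add_apply, hx, hy]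
    | tmul c d =>
      induction q with
      | zero => simp
      | add x y hx hy => simp only [map_add, mul_add, hx, hy]
      | tmul x y => simp
  have hr : ∀ (a : H) (q : H ⊗[k] H), B.r a q = q * (1 ⊗ₜ[k] a) := by
    intro a q
    induction q with
    | zero => simp
    | add x y hx hy => simp only [map_add, add_mul, hx, hy]
    | tmul x y => simp [hB]
  -- `H`-linearity of the coevaluation lets the adjoint action of `X³` be traded for right
  -- multiplication by `X³ ⊗ 1`.
  have slide : ∀ c, B.adj (comul c) (coevElem k H) = coevElem k H * (c ⊗ₜ[k] 1) := by
    intro c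
    have h : zCoev (Algebra.lmul k H) (c * 1) = B.ad c (zCoev (Algebra.lmul k H) 1) :=
      (zCoev (Algebra.lmul k H)).map_act c 1
    rw [zCoev_one, mul_one, zCoev_lmul] at h
    exact h.symm
  have inner : ∀ s t : H ⊗[k] (H ⊗[k] H), zipAt B z (coevElem k H) (padL k H s * comul₃ k H t) =
      twoSided (H ⊗[k] H) (TensorProduct.map
        ((comul (k := k) (H := H)).toLinearMap ∘ₗ (adS k H).toLinearMap.flip z)
        (Algebra.TensorProduct.includeLeft : H →ₐ[k] H ⊗[k] H).toLinearMap
        ((Algebra.TensorProduct.assoc k k k H H H).symm t))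
      (LinearMap.mul' k (H ⊗[k] H) (TensorProduct.map
      (LinearMap.mulRight k (coevElem k H) ∘ₗ (comul (k := k) (H := H)).toLinearMap ∘ₗ evA k H)
      ((Algebra.TensorProduct.includeRight : H →ₐ[k] H ⊗[k] H).toLinearMap ∘ₗ
        (S (k := k) (H := H)).toLinearMap)
      ((TensorProduct.assoc k H H H).symm s))) := by
    intro s t
    induction t using tensor_induction₃ with
    | zero => simp
    | add x y hx hy => simp only [map_add, mul_add, LinearMap.add_apply, hx, hy]
    | tmul a b c =>
      induction s using tensor_induction₃ with
      | zero => simp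
      | add x y hx hy => simp only [map_add, add_mul, hx, hy]
      | tmul x y e =>
        have : (1 ⊗ₜ[k] (x ⊗ₜ[k] (y ⊗ₜ[k] e))) * (a ⊗ₜ[k] (b ⊗ₜ[k] comul c)) =
          (a ⊗ₜ[k] ((x * b) ⊗ₜ[k] ((y ⊗ₜ[k] e) * comul (k := k) c))) := by simp
        rw [padL_apply, comul₃_tmul, this, zipAt_tmul, map_mul B.adj, Module.End.mul_apply, slide,
          adj_tmul, hl, hr, hl]
        simp [twoSided_tmul (k := k), adS_tmul, S_mul, mul_assoc]
  -- `Δ(S(X²)) f⁻¹ = f⁻¹ (S ⊗ S)(Δᶜᵒᵖ(X²))`, and the last factor combines with `S(q²) ⊗ S(q¹)` into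
  -- `S(q²X²₂) ⊗ S(q¹X²₁)`, as in the definition of the coaction.
  have final : ∀ t : H ⊗[k] (H ⊗[k] H), twoSided (H ⊗[k] H) (TensorProduct.map
        ((comul (k := k) (H := H)).toLinearMap ∘ₗ (adS k H).toLinearMap.flip z)
        (Algebra.TensorProduct.includeLeft : H →ₐ[k] H ⊗[k] H).toLinearMap
        ((Algebra.TensorProduct.assoc k k k H H H).symm t))
        (drinfeldTwistInv k H * qFun k H (reassoc k H)) =
      twoSided (H ⊗[k] H)
        (TensorProduct.map (comul (k := k) (H := H)).toLinearMap
          (LinearMap.mul' k (H ⊗[k] H) ∘ₗ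
            TensorProduct.map
              (flipSS k H ∘ₗ LinearMap.mulLeft k (qR k H) ∘ₗ
                (comul (k := k) (H := H)).toLinearMap)
              (Algebra.TensorProduct.includeLeft : H →ₐ[k] H ⊗[k] H).toLinearMap) t)
        (comul z * drinfeldTwistInv k H) := by
    intro t
    induction t using tensor_induction₃ with
    | zero => simp
    | add x y hx hy => simp only [map_add, LinearMap.add_apply, hx, hy]
    | tmul a b c =>
      have h := drinfeldTwistInv_coS (k := k) b
      rw [coS_apply] at h
      simp only [Algebra.TensorProduct.assoc_symm_tmul, TensorProduct.map_tmul,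
        twoSided_tmul (k := k), LinearMap.comp_apply, LinearMap.mul'_apply,
        LinearMap.mulLeft_apply, AlgHom.toLinearMap_apply, flipSS_mul, LinearMap.flip_apply,
        adS_tmul, map_mul, ← qFun_reassoc, mul_assoc]
      rw [← mul_assoc (drinfeldTwistInv k H) (flipSS k H (comul b)), h]
      simp only [mul_assoc]
  rw [zBraid_apply, assocAdInv_apply, outer, whL_tmul, zCoev_one, adAct_eq_zipAt, inner,
    comul_coevElem, final]
  rfl

theorem isYetterDrinfeldAlgebra_HZero : IsYetterDrinfeldAlgebra (HZero k H) :=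
  isYetterDrinfeldAlgebra_of_zBraid rfl (HZero_mul k H) rfl (HZero_coact k H)

end HZero

end QuasiHopf

end

/-! ### The proposition -/

theorem proposition6p7 {k H M N : Type*} [Field k] [Ring H] [Algebra k H] [QuasiHopfAlgebra k H]
    [AddCommGroup M] [Module k M] [AddCommGroup N] [Module k N]
    (A : QuasiHopf.YDAlgData k H M) (hA : QuasiHopf.IsYetterDrinfeldAlgebra A)
    (C : QuasiHopf.ModAlgData k H N) (hC : QuasiHopf.IsModuleAlgebra C) :
    -- the objects involved are well defined
    QuasiHopf.IsYetterDrinfeldAlgebra (QuasiHopf.HZero k H) ∧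
    QuasiHopf.IsModuleAlgebra (QuasiHopf.diamond C A) ∧
    QuasiHopf.IsYetterDrinfeldAlgebra (QuasiHopf.braidedTensor A (QuasiHopf.HZero k H)) ∧
    QuasiHopf.IsModuleAlgebra
      (QuasiHopf.diamond (QuasiHopf.diamond C A) (QuasiHopf.HZero k H)) ∧
    QuasiHopf.IsModuleAlgebra
      (QuasiHopf.diamond C (QuasiHopf.braidedTensor A (QuasiHopf.HZero k H))) ∧
    -- the isomorphism `(c ⊗ a) ⊗ h ↦ X¹·c ⊗ (X²·a ⊗ X³▷h)`
    ∃ e : (N ⊗[k] M) ⊗[k] H ≃ₗ[k] N ⊗[k] (M ⊗[k] H),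
      (∀ (c : N) (a : M) (h : H),
        e ((c ⊗ₜ[k] a) ⊗ₜ[k] h) =
          QuasiHopf.tensorAct C.act (QuasiHopf.tensorAct A.act (QuasiHopf.HZero k H).act)
            (QuasiHopf.reassoc k H) (c ⊗ₜ[k] (a ⊗ₜ[k] h))) ∧
      QuasiHopf.IsModuleAlgebraIso
        (QuasiHopf.diamond (QuasiHopf.diamond C A) (QuasiHopf.HZero k H))
        (QuasiHopf.diamond C (QuasiHopf.braidedTensor A (QuasiHopf.HZero k H))) e := by
  have hZ := QuasiHopf.isYetterDrinfeldAlgebra_HZero k H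
  have hAZ := QuasiHopf.isYetterDrinfeldAlgebra_braidedTensor hA hZ
  have hD := QuasiHopf.isModuleAlgebra_diamond hC hA
  exact ⟨hZ, hD, hAZ, QuasiHopf.isModuleAlgebra_diamond hD hZ,
    QuasiHopf.isModuleAlgebra_diamond hC hAZ,
    QuasiHopf.assocEquiv (ρ := C.act) (σ := A.act) (τ := (QuasiHopf.HZero k H).act),
    fun _ _ _ => rfl, QuasiHopf.isModuleAlgebraIso_assoc hC hA hZ⟩
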